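/- Let $N=\langle x,y\mid [[x,y],x]=[[x,y],y]=1\rangle$ with the generating set $\{x^{\pm1},y^{\pm1},t^{\pm1}\}$, where $t=xy$ and $[x,y]=xyx^{-1}y^{-1}$. Let $\ell$ and $d$ be the word length and word metric of $N$, and let $p:N\to\mathbb Z^2$ be the homomorphism with $p(x)=(1,0)$, $p(y)=(0,1)$. The Cayley graph of $\mathbb Z^2$ with respect to $p(x),p(y),p(t)$ is the $1$-skeleton of the tessellation of the plane by equilateral triangles; it carries its path metric, in which edges have length $1$, and $\ell_{\mathbb Z^2}$ is the corresponding word length. A word $w$ is identified with the unit-speed path it labels from $1$, constant after time $\ell(w)$; it is a geodesic if its length is the length of the element it represents. The axial directions are, in cyclic order, $x,t,y,x^{-1},t^{-1},y^{-1}$, and the axes are the three lines through the origin in the directions $x$, $y$, $t$. A path crosses an axis if it has vertices strictly on both sides of it. For $P=(a,b)\in\mathbb Z^2$ and $m\ge 0$ an element $x^ay^b[x,y]^s$ of length at most $m$ is an extremal of $B_P(m)$ if $s$ is the largest or the smallest integer for which this element has length at most $m$. An almost regular hexagon is a closed circuit in the tessellation with six successive sides in the six axial directions (in one of the two cyclic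 orders), no two of which differ in length by more than $2$. An extremal path of $B_P(m)$ is a geodesic for an extremal of $B_P(m)$ whose projection is, up to translation, a subpath of an almost regular hexagon going round at most once. A standard geodesic for $g\in N$ is a geodesic $w$ for $g$ of the following form. If $\ell(g)=\ell_{\mathbb Z^2}(p(g))$, then $w=u^{i}v^{j}u^{e}v^{k}u^{l}$ with $u,v$ cyclically neighbouring axial directions, $i,j,k,l\ge0$ and $e\in\{0,1\}$ (so that in projection it stays as long as possible along one side of the parallelogram with corners $0$ and $p(g)$). If $\ell(g)=m+1>\ell_{\mathbb Z^2}(p(g))$, then $w=w_1cw_2$ with $w_1$ an initial segment of an extremal path of $B_{p(g)}(m)$, $c$ a single letter, and $w_2$ a final segment of an extremal path of $B_{p(g)}(m+1)$. Say that $(g,h)$ has property $(\ast)$ if there are standard geodesics for $g$ and for $h$ whose projections to the Cayley graph of $\mathbb Z^2$ lie in the $25$-neighbourhoods of each other and $50$-fellow travel (i.e. are at distance at most $50$ at every time $\tau\ge0$). **Lemma.** Let $g,g'\in N$ with $\ell(g)=\ell(g')=n$, and let $r$ be a word of length at most $2$ in the generators such that $g'=g\bar r$, where $\bar r$ is the element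 represented by $r$. Then at least one of the following holds. 1. $\ell(g)<50$ and $\ell(g')<50$. 2. $(g,g')$ has property $(\ast)$. 3. The projection of the path from $g$ to $g'$ labelled $r$ crosses an axis; and if it crosses exactly one axis, then there is $g''\in N$ with $\ell(g'')=n$, $d(g,g'')\le2$, $d(g',g'')\le2$, such that $p(g'')$ lies on that axis and both $(g,g'')$ and $(g'',g')$ have property $(\ast)$. -/

import Mathlib

/-
In coordinates, `N` is the discrete Heisenberg group, and the central coordinate of a word is an
area determined by its projected path. The symmetries of the hexagon of axial directions, called
frames, reduce every question to end points in a single sector of the plane. Among the words with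
given numbers of letters, the one sorted by direction has the largest area, so that only hexagonal
paths, given by the four offsets of their sides, compete for the extremal area. That area is a
concave quadratic function of the offsets: moving outwards a side of maximal gain, one step at a
time, produces the optimum for every length, and the sides of the optimal hexagons differ in
length by at most 2. Hence extremals run along almost regular hexagons, and an element between
two successive extremals is reached by turning off one hexagon onto the next.

For elements of equal length at distance at most 2 over a common sector, comparing the areas shows
that their hexagons differ by boundedly many moves, so that the paths along them track each other;
elements no longer than their projections are joined by paths in parallelograms, which are
compared directly. If instead `r` crosses a single axis, then its middle vertex lies over the axis,
and the same estimates show that this vertex, or one of its neighbours over the axis, has length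
`n`. It lies over a common sector with either end point.
-/

namespace NilHex

open scoped commutatorElement

/-! ### The group and its generating set -/

inductive Gen
  | x
  | y

/-- The relators `[[x,y],x]` and `[[x,y],y]`. -/
def rels : Set (FreeGroup Gen) :=
  {⁅⁅FreeGroup.of Gen.x, FreeGroup.of Gen.y⁆, FreeGroup.of Gen.x⁆,
   ⁅⁅FreeGroup.of Gen.x, FreeGroup.of Gen.y⁆, FreeGroup.of Gen.y⁆}

/-- The group `N = ⟨x, y | [[x,y],x] = [[x,y],y] = 1⟩`. -/
abbrev N : Type := PresentedGroup rels

def x : N := PresentedGroup.of Gen.x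

def y : N := PresentedGroup.of Gen.y

/-- `z = [x,y] = x y x⁻¹ y⁻¹`. -/
def z : N := ⁅x, y⁆

/-- The letters `x, y, t` and their formal inverses `xi, yi, ti`. -/
inductive Letter
  | x
  | y
  | t
  | xi
  | yi
  | ti

/-- The element of `N` named by a letter, where `t = x y`. -/
def Letter.val : Letter → N
  | .x => NilHex.x
  | .y => NilHex.y
  | .t => NilHex.x * NilHex.y
  | .xi => (NilHex.x)⁻¹
  | .yi => (NilHex.y)⁻¹
  | .ti => (NilHex.x * NilHex.y)⁻¹

/-- The six axial directions in cyclic order are `x, t, y, x⁻¹, t⁻¹, y⁻¹`;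
`next` is the rotation by 60 degrees. -/
def Letter.next : Letter → Letter
  | .x => .t
  | .t => .y
  | .y => .xi
  | .xi => .ti
  | .ti => .yi
  | .yi => .x

/-- Rotation by 60 degrees in the other direction. -/
def Letter.prev : Letter → Letter
  | .x => .yi
  | .t => .x
  | .y => .t
  | .xi => .y
  | .ti => .xi
  | .yi => .ti

abbrev Word : Type := List Letter

/-- The element of `N` represented by a word. -/
def eval (w : Word) : N := (w.map Letter.val).prod

/-! ### The projection to `ℤ²` -/

/-- The group `ℤ²`, written multiplicatively. -/
abbrev Plane : Type := Multiplicative (ℤ × ℤ)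

def genPlane : Gen → Plane
  | .x => Multiplicative.ofAdd (1, 0)
  | .y => Multiplicative.ofAdd (0, 1)

theorem genPlane_rels : ∀ r ∈ rels, FreeGroup.lift genPlane r = 1 := by
  intro r hr
  rcases hr with rfl | rfl <;> simp [map_commutatorElement, commutatorElement_eq_one_iff_mul_comm, mul_comm]

/-- The projection `N → ℤ²` with `x ↦ (1,0)` and `y ↦ (0,1)`. -/
def p : N →* Plane := PresentedGroup.toGroup genPlane_rels

/-- First coordinate of a point of `ℤ²`. -/
def fstCoord (P : Plane) : ℤ := (Multiplicative.toAdd P).1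

/-- Second coordinate of a point of `ℤ²`. -/
def sndCoord (P : Plane) : ℤ := (Multiplicative.toAdd P).2

/-! ### Word metrics -/

/-- Word length with respect to the generators `gen`. -/
noncomputable def wordLength {G : Type} [Group G] (gen : Letter → G) (g : G) : ℕ :=
  sInf {k : ℕ | ∃ w : Word, w.length = k ∧ (w.map gen).prod = g}

/-- The length of an element of `N` with respect to `{x, y, t}`. -/
noncomputable def len (g : N) : ℕ := wordLength Letter.val g

/-- The word metric of `N` with respect to `{x, y, t}`. -/
noncomputable def dist (g h : N) : ℕ := len (g⁻¹ * h)

/-- The length of an element of `ℤ²` with respect to the projections of `x, y, t`. -/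
noncomputable def planeLen (P : Plane) : ℕ := wordLength (fun l => p l.val) P

/-- The word metric of `ℤ²` with respect to the projections of `x, y, t`. -/
noncomputable def planeDist (P Q : Plane) : ℕ := planeLen (P⁻¹ * Q)

/-- A word is a geodesic if its length is the length of the element it represents. -/
def IsGeodesic (w : Word) : Prop := w.length = len (eval w)

/-! ### Paths in the Cayley graph of `ℤ²`, fellow travelling -/

/-- A point of the Cayley graph of `ℤ²` (every edge a unit interval): the point at distance
`s ∈ [0,1]` from `v` on the edge from `v` to `v'`. A vertex is also given by `v = v'`, `s = 0`. -/
structure GraphPoint where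
  v : Plane
  v' : Plane
  s : ℝ

open Classical in
/-- The path metric of the Cayley graph of `ℤ²`: a shortest path between two points either leaves
the edges of both points through end points, or runs inside a common edge. -/
noncomputable def graphDist (P Q : GraphPoint) : ℝ :=
  let via : ℝ :=
    min (min (P.s + planeDist P.v Q.v + Q.s) (P.s + planeDist P.v Q.v' + (1 - Q.s)))
      (min ((1 - P.s) + planeDist P.v' Q.v + Q.s) ((1 - P.s) + planeDist P.v' Q.v' + (1 - Q.s)))
  if P.v = Q.v ∧ P.v' = Q.v' then min via |P.s - Q.s|
  else if P.v = Q.v' ∧ P.v' = Q.v then min via |P.s - (1 - Q.s)|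
  else via

/-- The projection to the Cayley graph of `ℤ²` of the path labelled `w` from the identity, at time
`τ ≥ 0`; unit speed on `[0, ℓ(w)]`, constant afterwards. -/
noncomputable def projPath (w : Word) (τ : ℝ) : GraphPoint :=
  let σ : ℝ := min τ w.length
  { v := p (eval (w.take ⌊σ⌋₊))
    v' := p (eval (w.take (⌊σ⌋₊ + 1)))
    s := Int.fract σ }

/-- The projections of `w` and `w'` `K`-fellow travel. -/
def FellowTravel (K : ℝ) (w w' : Word) : Prop :=
  ∀ τ : ℝ, 0 ≤ τ → graphDist (projPath w τ) (projPath w' τ) ≤ K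

/-- The projection of `w` lies in the `K`-neighbourhood of the projection of `w'`. -/
def InNeighbourhood (K : ℝ) (w w' : Word) : Prop :=
  ∀ τ : ℝ, 0 ≤ τ → ∃ σ : ℝ, 0 ≤ σ ∧ graphDist (projPath w τ) (projPath w' σ) ≤ K

/-! ### Standard geodesics -/

/-- The part of the ball of radius `m` of `N` that lies over `P = (a,b) ∈ ℤ²`, where
`x^a y^b [x,y]^s` is identified with `s ∈ ℤ`. -/
def fibreBall (P : Plane) (m : ℕ) : Set ℤ :=
  {s : ℤ | len (x ^ fstCoord P * y ^ sndCoord P * z ^ s) ≤ m}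

/-- `e` is at one of the two extremes of the part of the ball of radius `m` that lies over `P`. -/
def IsExtremal (P : Plane) (m : ℕ) (e : N) : Prop :=
  ∃ s : ℤ, e = x ^ fstCoord P * y ^ sndCoord P * z ^ s ∧
    (IsGreatest (fibreBall P m) s ∨ IsLeast (fibreBall P m) s)

/-- The word that starts in direction `d`, and runs along six sides of lengths `s 0, …, s 5`,
changing direction by `turn` after every side. -/
def hexWord (turn : Letter → Letter) (d : Letter) (s : Fin 6 → ℕ) : Word :=
  (List.finRange 6).flatMap fun i => List.replicate (s i) (turn^[(i : ℕ)] d)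

/-- The boundary of an almost regular hexagon, read from one of its corners in one of the two
directions: the circuit closes up in `ℤ²`, and no two sides differ in length by more than `2`. -/
def IsAlmostRegularHexagon (H : Word) : Prop :=
  ∃ (turn : Letter → Letter) (d : Letter) (s : Fin 6 → ℕ),
    (turn = Letter.next ∨ turn = Letter.prev) ∧ (∀ i j, s i ≤ s j + 2) ∧
      H = hexWord turn d s ∧ p (eval H) = 1

/-- The projection of `w` is (up to translation) a subpath of an almost regular hexagon, going
round at most once. -/
def IsHexagonSubpath (w : Word) : Prop :=
  ∃ H : Word, IsAlmostRegularHexagon H ∧ w <:+: H ++ H ∧ w.length ≤ H.length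

/-- `w` is a geodesic, running along an almost regular hexagon, for an extremal element over `P`
of the ball of radius `m`. -/
def IsExtremalPath (P : Plane) (m : ℕ) (w : Word) : Prop :=
  IsGeodesic w ∧ IsExtremal P m (eval w) ∧ IsHexagonSubpath w

/-- A path in a parallelogram with sides in two neighbouring axial directions `a`, `b` that stays
along the `a`-side through the starting corner as long as possible: it follows that side, crosses
in direction `b` to the opposite side (with at most one unit step sideways, which adjusts the
enclosed area), and follows the opposite side to the end. For given directions `a`, `b`, each
element represented by a word in `a`, `b` has exactly one such word, and no other word in `a`, `b`
for it has a longer initial power of `a`. -/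
def IsParallelogramPath (w : Word) : Prop :=
  ∃ (a b : Letter) (i j e k l : ℕ), (b = a.next ∨ b = a.prev) ∧ e ≤ 1 ∧
    w = List.replicate i a ++ List.replicate j b ++ List.replicate e a ++
      List.replicate k b ++ List.replicate l a

/-- A path over `P` that first follows the almost regular hexagon of an extremal element of the
ball of radius `m`, then crosses by a single edge to the almost regular hexagon of an extremal
element of the ball of radius `m + 1`, and follows that one to its end. -/
def IsHexagonPath (P : Plane) (m : ℕ) (w : Word) : Prop :=
  ∃ α β u v : Word, ∃ c : Letter, IsExtremalPath P m α ∧ IsExtremalPath P (m + 1) β ∧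
    u <+: α ∧ v <:+ β ∧ w = u ++ c :: v

/-- Standard geodesics: for an element as short as its projection to `ℤ²`, a parallelogram path;
for any other element, a path along two successive extremal hexagons. -/
def IsStandardGeodesic (w : Word) (g : N) : Prop :=
  eval w = g ∧ IsGeodesic w ∧
    ((len g = planeLen (p g) ∧ IsParallelogramPath w) ∨
      ∃ m : ℕ, len g = m + 1 ∧ planeLen (p g) ≤ m ∧ IsHexagonPath (p g) m w)

/-- `g` and `h` have standard geodesics whose projections lie in `25`-neighbourhoods of each other
and `50`-fellow travel. -/
def HaveFellowTravellingGeodesics (g h : N) : Prop :=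
  ∃ w w' : Word, IsStandardGeodesic w g ∧ IsStandardGeodesic w' h ∧
    InNeighbourhood 25 w w' ∧ InNeighbourhood 25 w' w ∧ FellowTravel 50 w w'

/-! ### Axes -/

/-- The three axes of the plane: the lines through the origin in the directions `x`, `y`, `t`. -/
inductive Axis
  | x
  | y
  | t

/-- A linear form that vanishes on the axis; its sign distinguishes the two sides. -/
def Axis.form : Axis → Plane → ℤ
  | .x, P => sndCoord P
  | .y, P => fstCoord P
  | .t, P => fstCoord P - sndCoord P

/-- The projection of the path based at `g` with label `r` crosses the axis `A`, that is, has
vertices strictly on both sides of it. -/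
def Crosses (g : N) (r : Word) (A : Axis) : Prop :=
  ∃ i j : ℕ, A.form (p (g * eval (r.take i))) < 0 ∧ 0 < A.form (p (g * eval (r.take j)))

end NilHex

namespace NilHex

open scoped commutatorElement

/-! ### The discrete Heisenberg group -/

/-- The discrete Heisenberg group, a model of `N`: the triple `(a, b, s)` stands for
`x ^ a * y ^ b * z ^ s`. -/
@[ext]
structure Heis where
  a : ℤ
  b : ℤ
  s : ℤ

namespace Heis

instance : Mul Heis := ⟨fun g h => ⟨g.a + h.a, g.b + h.b, g.s + h.s - g.b * h.a⟩⟩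
instance : One Heis := ⟨⟨0, 0, 0⟩⟩
instance : Inv Heis := ⟨fun g => ⟨-g.a, -g.b, -g.s - g.a * g.b⟩⟩

@[simp] theorem mul_a (g h : Heis) : (g * h).a = g.a + h.a := rfl
@[simp] theorem mul_b (g h : Heis) : (g * h).b = g.b + h.b := rfl
@[simp] theorem mul_s (g h : Heis) : (g * h).s = g.s + h.s - g.b * h.a := rfl
@[simp] theorem one_a : (1 : Heis).a = 0 := rfl
@[simp] theorem one_b : (1 : Heis).b = 0 := rfl
@[simp] theorem one_s : (1 : Heis).s = 0 := rfl
@[simp] theorem inv_a (g : Heis) : (g⁻¹).a = -g.a := rfl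
@[simp] theorem inv_b (g : Heis) : (g⁻¹).b = -g.b := rfl
@[simp] theorem inv_s (g : Heis) : (g⁻¹).s = -g.s - g.a * g.b := rfl

instance : Group Heis :=
  Group.ofLeftAxioms (fun g h k => by ext <;> simp <;> ring) (fun g => by ext <;> simp)
    (fun g => by ext <;> simp; ring)

theorem zpow_of_mul_eq_zero {a b : ℤ} (h : a * b = 0) (s i : ℤ) :
    (⟨a, b, s⟩ : Heis) ^ i = ⟨i * a, i * b, i * s⟩ := by
  induction i with
  | zero => ext <;> simp
  | succ i ih =>
    rw [zpow_add_one, ih]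
    ext <;> simp only [mul_a, mul_b, mul_s]
    · ring
    · ring
    · linear_combination -(i : ℤ) * h
  | pred i ih =>
    rw [zpow_sub_one, ih]
    ext <;> simp only [mul_a, mul_b, mul_s, inv_a, inv_b, inv_s]
    · ring
    · ring
    · linear_combination (-1 - (i : ℤ)) * h

end Heis

/-- The images of the two generators of `N` in the Heisenberg group. -/
def genHeis : Gen → Heis
  | .x => ⟨1, 0, 0⟩
  | .y => ⟨0, 1, 0⟩

theorem genHeis_rels : ∀ r ∈ rels, FreeGroup.lift genHeis r = 1 := by
  rintro r (rfl | rfl) <;> ext <;> simp [commutatorElement_def, genHeis]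

/-- The isomorphism of `N` with the Heisenberg group, as a homomorphism. -/
def toHeis : N →* Heis := PresentedGroup.toGroup genHeis_rels

@[simp] theorem toHeis_x : toHeis x = ⟨1, 0, 0⟩ := PresentedGroup.toGroup.of genHeis_rels

@[simp] theorem toHeis_y : toHeis y = ⟨0, 1, 0⟩ := PresentedGroup.toGroup.of genHeis_rels

@[simp] theorem toHeis_z : toHeis z = ⟨0, 0, 1⟩ := by
  ext <;> simp [z, commutatorElement_def]

theorem commute_z_of (l : Gen) : Commute z (PresentedGroup.of l : N) := by
  have hrel : ⁅⁅FreeGroup.of Gen.x, FreeGroup.of Gen.y⁆, FreeGroup.of l⁆ ∈ rels := by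
    cases l <;> simp [rels]
  rw [← commutatorElement_eq_one_iff_commute]
  simpa only [map_commutatorElement] using! PresentedGroup.one_of_mem hrel

theorem commute_z (g : N) : Commute z g := by
  have hg : g ∈ Subgroup.closure (Set.range (PresentedGroup.of : Gen → N)) := by
    simp only [PresentedGroup.closure_range_of, Subgroup.mem_top]
  induction hg using Subgroup.closure_induction with
  | mem _ h => obtain ⟨l, rfl⟩ := h; exact commute_z_of l
  | one => exact Commute.one_right z
  | mul _ _ _ _ hg hh => exact hg.mul_right hh
  | inv _ _ hg => exact hg.inv_right

theorem zpow_mul_zpow_of_commutator_central {G : Type*} [Group G] {U V Z : G} (hZU : Commute Z U)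
    (hZV : Commute Z V) (hUV : U * V = V * U * Z) (a b : ℤ) :
    V ^ b * U ^ a = U ^ a * V ^ b * Z ^ (-(b * a)) := by
  have hV : SemiconjBy V U (Z⁻¹ * U) := by
    rw [SemiconjBy, mul_assoc, hUV, ← mul_assoc, ((hZV.mul_right hZU).inv_left).eq,
      inv_mul_cancel_right]
  have hU : SemiconjBy (U ^ a) (Z ^ (-a) * V) V := by
    have h := (hV.zpow_right a).eq
    rw [hZU.inv_left.mul_zpow, ((hZU.inv_left.zpow_left a).zpow_right a).eq] at h
    rw [SemiconjBy, h, inv_zpow', mul_assoc]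
  have h := (hU.zpow_right b).eq
  rw [(hZV.zpow_left _).mul_zpow, ← zpow_mul] at h
  rw [← h, ((hZV.zpow_left _).zpow_right _).eq, mul_assoc]
  congr 3
  ring

theorem normalForm_mul {G : Type*} [Group G] {U V Z : G} (hZU : Commute Z U) (hZV : Commute Z V)
    (hUV : U * V = V * U * Z) (a b s a' b' s' : ℤ) :
    U ^ a * V ^ b * Z ^ s * (U ^ a' * V ^ b' * Z ^ s') =
      U ^ (a + a') * V ^ (b + b') * Z ^ (s + s' - b * a') := by
  have hZ : Commute (Z ^ s) (U ^ a' * V ^ b') :=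
    ((hZU.zpow_right _).mul_right (hZV.zpow_right _)).zpow_left _
  have hZ' : Commute (Z ^ (-(b * a'))) (V ^ b') := (hZV.zpow_right _).zpow_left _
  calc U ^ a * V ^ b * Z ^ s * (U ^ a' * V ^ b' * Z ^ s')
      = U ^ a * V ^ b * (Z ^ s * (U ^ a' * V ^ b')) * Z ^ s' := by group
    _ = U ^ a * (V ^ b * U ^ a') * V ^ b' * Z ^ s * Z ^ s' := by rw [hZ.eq]; group
    _ = U ^ a * U ^ a' * V ^ b * (Z ^ (-(b * a')) * V ^ b') * Z ^ s * Z ^ s' := by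
        rw [zpow_mul_zpow_of_commutator_central hZU hZV hUV]; group
    _ = U ^ (a + a') * V ^ (b + b') * Z ^ (s + s' - b * a') := by rw [hZ'.eq]; group

theorem x_mul_y : x * y = y * x * z := by
  rw [← (commute_z (y * x)).eq, z, commutatorElement_def]; group

theorem exists_eq_normalForm (g : N) : ∃ a b s : ℤ, g = x ^ a * y ^ b * z ^ s := by
  have hmul := normalForm_mul (commute_z x) (commute_z y) x_mul_y
  have hg : g ∈ Subgroup.closure (Set.range (PresentedGroup.of : Gen → N)) := by
    simp only [PresentedGroup.closure_range_of, Subgroup.mem_top]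
  induction hg using Subgroup.closure_induction with
  | mem _ h =>
    obtain ⟨l, rfl⟩ := h
    cases l
    · exact ⟨1, 0, 0, by simp [x]⟩
    · exact ⟨0, 1, 0, by simp [y]⟩
  | one => exact ⟨0, 0, 0, by simp⟩
  | mul _ _ _ _ hg hh =>
    obtain ⟨a, b, s, rfl⟩ := hg
    obtain ⟨a', b', s', rfl⟩ := hh
    exact ⟨_, _, _, hmul a b s a' b' s'⟩
  | inv _ _ hg =>
    obtain ⟨a, b, s, rfl⟩ := hg
    refine ⟨-a, -b, -s - a * b, inv_eq_of_mul_eq_one_right ?_⟩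
    rw [hmul, add_neg_cancel, add_neg_cancel, show s + (-s - a * b) - b * -a = 0 by ring]
    simp only [zpow_zero, mul_one]

theorem toHeis_normalForm (a b s : ℤ) : toHeis (x ^ a * y ^ b * z ^ s) = ⟨a, b, s⟩ := by
  ext <;> simp [Heis.zpow_of_mul_eq_zero]

theorem toHeis_injective : Function.Injective toHeis := by
  intro g h hgh
  obtain ⟨a, b, s, rfl⟩ := exists_eq_normalForm g
  obtain ⟨a', b', s', rfl⟩ := exists_eq_normalForm h
  simp only [toHeis_normalForm, Heis.mk.injEq] at hgh
  obtain ⟨rfl, rfl, rfl⟩ := hgh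
  rfl

@[simp] theorem p_x : p x = Multiplicative.ofAdd (1, 0) := PresentedGroup.toGroup.of genPlane_rels

@[simp] theorem p_y : p y = Multiplicative.ofAdd (0, 1) := PresentedGroup.toGroup.of genPlane_rels

theorem p_z : p z = 1 := by
  rw [z, map_commutatorElement, commutatorElement_eq_one_iff_mul_comm, mul_comm]

theorem p_normalForm (a b s : ℤ) :
    p (x ^ a * y ^ b * z ^ s) = Multiplicative.ofAdd (a, b) := by
  simp only [map_mul, map_zpow, p_z, p_x, p_y, one_zpow, mul_one, ← ofAdd_zsmul, ← ofAdd_add]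
  simp

/-! ### Frames -/

/-- A frame: an axial direction and a sense of rotation. The frames are permuted simply
transitively by the symmetries of the hexagon of axial directions, and every construction below is
carried out in the coordinates of a frame. -/
structure Frame where
  /-- The first direction. -/
  u : Letter
  /-- Whether the directions are counted along `Letter.next`. -/
  pos : Bool

/-- The first coordinate, in a frame, of the direction with index `i`. -/
def dU : Fin 6 → ℤ
  | 0 => 1 | 1 => 0 | 2 => -1 | 3 => -1 | 4 => 0 | 5 => 1

/-- The second coordinate, in a frame, of the direction with index `i`. -/
def dV : Fin 6 → ℤ
  | 0 => 0 | 1 => 1 | 2 => 1 | 3 => 0 | 4 => -1 | 5 => -1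

/-- The central coordinate, in a frame, of the letter with index `i`; here `ε` is `Frame.eps`. -/
def dS (ε : ℤ) : Fin 6 → ℤ
  | 0 => 0 | 1 => 0 | 2 => ε | 3 => 0 | 4 => 0 | 5 => 1 - ε

/-- The first coordinate of the end point of a word in the directions of a frame. -/
def posU (W : List (Fin 6)) : ℤ := (W.map dU).sum

/-- The second coordinate of the end point of a word in the directions of a frame. -/
def posV (W : List (Fin 6)) : ℤ := (W.map dV).sum

/-- The central coordinate of the end point of a word in the directions of a frame. -/
def area (ε : ℤ) : List (Fin 6) → ℤ
  | [] => 0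
  | i :: W => dS ε i + area ε W - dV i * posU W

@[simp] theorem posU_nil : posU [] = 0 := rfl
@[simp] theorem posV_nil : posV [] = 0 := rfl
@[simp] theorem area_nil (ε : ℤ) : area ε [] = 0 := rfl
@[simp] theorem posU_cons (i : Fin 6) (W : List (Fin 6)) : posU (i :: W) = dU i + posU W := by
  simp [posU]
@[simp] theorem posV_cons (i : Fin 6) (W : List (Fin 6)) : posV (i :: W) = dV i + posV W := by
  simp [posV]
@[simp] theorem area_cons (ε : ℤ) (i : Fin 6) (W : List (Fin 6)) :
    area ε (i :: W) = dS ε i + area ε W - dV i * posU W := rfl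
@[simp] theorem posU_append (W W' : List (Fin 6)) : posU (W ++ W') = posU W + posU W' := by
  simp [posU]
@[simp] theorem posV_append (W W' : List (Fin 6)) : posV (W ++ W') = posV W + posV W' := by
  simp [posV]
@[simp] theorem area_append (ε : ℤ) (W W' : List (Fin 6)) :
    area ε (W ++ W') = area ε W + area ε W' - posV W * posU W' := by
  induction W with
  | nil => simp
  | cons i W ih => simp only [List.cons_append, area_cons, ih, posU_append, posV_cons]; ring

namespace Frame

/-- The rotation by 60 degrees in the sense of the frame. -/
def turn (f : Frame) : Letter → Letter := match f.pos with
  | true => Letter.next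
  | false => Letter.prev

/-- The axial directions, counted from `f.u` in the sense of rotation of the frame. -/
def letter (f : Frame) (i : Fin 6) : Letter := f.turn^[(i : ℕ)] f.u

/-- The element of `N` in the first direction of the frame. -/
def U (f : Frame) : N := (f.letter 0).val

/-- The element of `N` in the second direction of the frame. -/
def V (f : Frame) : N := (f.letter 1).val

/-- The commutator of the first two directions of the frame. -/
def Z (f : Frame) : N := match f.pos with
  | true => z
  | false => z⁻¹

/-- Whether the third direction is `U⁻¹ V` (value `0`) or `V U⁻¹` (value `1`). -/
def eps (f : Frame) : ℤ := match f.pos, f.u with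
  | true, .x => 0
  | true, .y => 0
  | true, .ti => 0
  | true, _ => 1
  | false, .x => 1
  | false, .y => 1
  | false, .ti => 1
  | false, _ => 0

/-- The element of `N` with coordinates `a`, `b`, `s` in the frame. -/
def pt (f : Frame) (a b s : ℤ) : N := f.U ^ a * f.V ^ b * f.Z ^ s

variable (f : Frame)

theorem eps_eq_zero_or_one : f.eps = 0 ∨ f.eps = 1 := by
  rcases f with ⟨u, pos⟩
  cases u <;> cases pos <;> simp [eps]

theorem commute_Z (g : N) : Commute f.Z g := by
  unfold Z
  split
  · exact commute_z g
  · exact (commute_z g).inv_left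

theorem val_letter (i : Fin 6) : (f.letter i).val = f.pt (dU i) (dV i) (dS f.eps i) := by
  apply toHeis_injective
  rcases f with ⟨u, pos⟩
  cases pos <;> cases u <;> fin_cases i <;> ext <;>
    simp [letter, pt, U, V, Z, turn, eps, dU, dV, dS, Letter.val, Letter.next, Letter.prev]

theorem U_mul_V : f.U * f.V = f.V * f.U * f.Z := by
  apply toHeis_injective
  rcases f with ⟨u, pos⟩
  cases pos <;> cases u <;> ext <;>
    simp [letter, U, V, Z, turn, Letter.val, Letter.next, Letter.prev]

theorem pt_mul (a b s a' b' s' : ℤ) :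
    f.pt a b s * f.pt a' b' s' = f.pt (a + a') (b + b') (s + s' - b * a') :=
  normalForm_mul (f.commute_Z _) (f.commute_Z _) f.U_mul_V _ _ _ _ _ _

theorem pt_zero : f.pt 0 0 0 = 1 := by simp [pt]

theorem eval_map (W : List (Fin 6)) :
    eval (W.map f.letter) = f.pt (posU W) (posV W) (area f.eps W) := by
  induction W with
  | nil => simp [eval, pt_zero]
  | cons i W ih =>
    have hcons : eval ((i :: W).map f.letter) = (f.letter i).val * eval (W.map f.letter) := by
      simp [eval]
    rw [hcons, ih, val_letter, pt_mul]
    simp only [posU_cons, posV_cons, area_cons]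

end Frame

/-! ### Hexagonal paths and the rearrangement inequality -/

/-- Four integers, one for each of the directions `5, 0, 1, 2` of a frame. They serve as offsets:
a hexagonal path to the point `(c₁, c₂)` of the sector `c₁, c₂ ≥ 0` is a path whose sides have the
directions `4, 5, 0, 1, 2, 3`, and the offset of a side is the distance by which it has been moved
outwards from a corner or a side of the parallelogram spanned by `(c₁, c₂)`. -/
abbrev Quad : Type := Fin 4 → ℤ

namespace Quad

/-- Twice the area of the hexagonal path with offsets `n` to `(c₁, c₂)`. -/
def area (ε c₁ c₂ : ℤ) (n : Quad) : ℤ :=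
  2 * (c₁ * n 1 + c₂ * n 2 + n 0 * n 1 + n 1 * n 2 + n 2 * n 3)
    - (n 0 ^ 2 + n 1 ^ 2 + n 2 ^ 2 + n 3 ^ 2)
    + (2 * ε - 1) * (n 0 + n 2) + (1 - 2 * ε) * (n 1 + n 3)

end Quad

/-- The linear form `dU (i - 1) * b - dV (i - 1) * a`, nonnegative on the half plane that is bounded
by the line in direction `i - 1` and contains the direction `i`. -/
def sectorForm (a b : ℤ) : Fin 6 → ℤ
  | 0 => a | 1 => a + b | 2 => b | 3 => -a | 4 => -(a + b) | 5 => -b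

/-- The closed sector of the plane between the directions `i` and `i + 1`. -/
def InSector (i : Fin 6) (a b : ℤ) : Prop := 0 ≤ sectorForm a b i ∧ 0 ≤ sectorForm a b (i + 2)

theorem exists_inSector (a b : ℤ) : ∃ i, InSector i a b := by
  have h : InSector 0 a b ∨ InSector 1 a b ∨ InSector 2 a b ∨ InSector 3 a b ∨ InSector 4 a b ∨
      InSector 5 a b := by
    simp only [InSector, sectorForm, Fin.isValue, Fin.reduceAdd]
    omega
  rcases h with h | h | h | h | h | h <;> exact ⟨_, h⟩

theorem sectorForm_add_one (a b : ℤ) (i : Fin 6) :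
    sectorForm a b (i + 1) = sectorForm a b i + sectorForm a b (i + 2) := by
  fin_cases i <;> simp only [sectorForm, Fin.reduceFinMk, Fin.zero_eta, Fin.mk_one, Fin.isValue,
    Fin.reduceAdd] <;> ring

theorem sectorForm_add_three (a b : ℤ) (i : Fin 6) :
    sectorForm a b (i + 3) = -sectorForm a b i := by
  fin_cases i <;> simp [sectorForm]

/-- The first coordinate of the end point of a word with `k i` letters of each direction `i`. -/
def sumU (k : Fin 6 → ℤ) : ℤ := k 0 + k 5 - k 2 - k 3

/-- The second coordinate of the end point of a word with `k i` letters of each direction `i`. -/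
def sumV (k : Fin 6 → ℤ) : ℤ := k 1 + k 2 - k 4 - k 5

/-- The offsets of the word with `k i` letters of each direction `i`, sorted by direction, starting
with the direction `4`. -/
def sortedOffsets (k : Fin 6 → ℤ) : Quad := ![k 4, k 4 + k 5, k 2 + k 3, k 3]

/-- Twice the area of the word with `k i` letters of each direction `i`, sorted by direction,
starting with the direction `i + 4`. -/
def sortedArea (ε : ℤ) (i : Fin 6) (k : Fin 6 → ℤ) : ℤ :=
  (sortedOffsets k).area ε (sumU k) (sumV k) -
    2 * ∑ j, if j < i then k (j + 4) * sectorForm (sumU k) (sumV k) j else 0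

theorem sortedArea_add_one (ε : ℤ) (i : Fin 6) (k : Fin 6 → ℤ) :
    sortedArea ε (i + 1) k =
      sortedArea ε i k - 2 * (k (i + 4) * sectorForm (sumU k) (sumV k) i) := by
  fin_cases i <;>
    simp [sortedArea, Fin.sum_univ_six, sectorForm, sumU, sumV] <;> ring

theorem sortedArea_le (ε : ℤ) (i j : Fin 6) {k : Fin 6 → ℤ} (hk : ∀ l, 0 ≤ k l)
    (hi : InSector i (sumU k) (sumV k)) : sortedArea ε j k ≤ sortedArea ε i k := by
  obtain ⟨h₀, h₂⟩ := hi
  have h₁ : 0 ≤ sectorForm (sumU k) (sumV k) (i + 1) := by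
    rw [sectorForm_add_one]; exact add_nonneg h₀ h₂
  have down : ∀ l, 0 ≤ sectorForm (sumU k) (sumV k) l →
      sortedArea ε (l + 1) k ≤ sortedArea ε l k := fun l hl => by
    rw [sortedArea_add_one]
    linarith [mul_nonneg (hk (l + 4)) hl]
  have up : ∀ l, 0 ≤ sectorForm (sumU k) (sumV k) l →
      sortedArea ε (l + 3) k ≤ sortedArea ε (l + 3 + 1) k := fun l hl => by
    rw [sortedArea_add_one, sectorForm_add_three]
    linarith [mul_nonneg (hk (l + 3 + 4)) hl]
  have d₀ := down i h₀
  have d₁ := down (i + 1) h₁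
  have d₂ := down (i + 2) h₂
  have u₁ := up (i + 1) h₁
  have u₂ := up (i + 2) h₂
  simp only [add_assoc, Fin.isValue, Fin.reduceAdd, add_zero] at d₀ d₁ d₂ u₁ u₂
  obtain ⟨m, rfl⟩ : ∃ m, j = i + m := ⟨j - i, (add_sub_cancel i j).symm⟩
  fin_cases m <;> simp only [Fin.zero_eta, Fin.mk_one, Fin.reduceFinMk, Fin.isValue, add_zero] <;>
    linarith

/-- The number of letters of each direction in a word. -/
def letterCount (W : List (Fin 6)) (i : Fin 6) : ℤ := W.count i

theorem letterCount_nonneg (W : List (Fin 6)) (i : Fin 6) : 0 ≤ letterCount W i :=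
  Int.natCast_nonneg _

theorem letterCount_cons (l : Fin 6) (W : List (Fin 6)) (i : Fin 6) :
    letterCount (l :: W) i = letterCount W i + if l = i then 1 else 0 := by
  simp only [letterCount, List.count_cons, beq_iff_eq]
  split <;> simp

theorem sumU_letterCount (W : List (Fin 6)) : sumU (letterCount W) = posU W := by
  induction W with
  | nil => rfl
  | cons l W ih =>
    rw [posU_cons, ← ih]
    fin_cases l <;> simp [sumU, letterCount_cons, dU] <;> ring

theorem sumV_letterCount (W : List (Fin 6)) : sumV (letterCount W) = posV W := by
  induction W with
  | nil => rfl
  | cons l W ih =>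
    rw [posV_cons, ← ih]
    fin_cases l <;> simp [sumV, letterCount_cons, dV] <;> ring

theorem sum_letterCount (W : List (Fin 6)) : ∑ i, letterCount W i = W.length := by
  induction W with
  | nil => rfl
  | cons l W ih => simp [letterCount_cons, Finset.sum_add_distrib, ih]

theorem sortedArea_add_single_ge (ε : ℤ) (l j : Fin 6) {k : Fin 6 → ℤ} (hk : ∀ i, 0 ≤ k i)
    (hj : InSector j (sumU k) (sumV k)) :
    sortedArea ε j k + 2 * (dS ε l - dV l * sumU k) ≤
      sortedArea ε j (fun i => k i + if l = i then 1 else 0) := by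
  have h₀ := hk 0; have h₁ := hk 1; have h₂ := hk 2
  have h₃ := hk 3; have h₄ := hk 4; have h₅ := hk 5
  fin_cases j <;> simp only [InSector, sectorForm, sumU, sumV, Fin.zero_eta, Fin.mk_one,
      Fin.reduceFinMk, Fin.isValue, Fin.reduceAdd] at hj <;>
    fin_cases l <;>
    simp [sortedArea, sortedOffsets, Quad.area, Fin.sum_univ_six, sectorForm, sumU, sumV, dS,
      dV] <;>
    linarith

theorem two_mul_area_le_sortedArea {ε : ℤ} (W : List (Fin 6)) (i : Fin 6)
    (hi : InSector i (posU W) (posV W)) : 2 * area ε W ≤ sortedArea ε i (letterCount W) := by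
  induction W generalizing i with
  | nil => simp [sortedArea, sortedOffsets, letterCount, Quad.area, sumU, sumV, sectorForm]
  | cons l W ih =>
    obtain ⟨j, hj⟩ := exists_inSector (posU W) (posV W)
    calc 2 * area ε (l :: W)
        = 2 * area ε W + 2 * (dS ε l - dV l * posU W) := by rw [area_cons]; ring
      _ ≤ sortedArea ε j (letterCount W) + 2 * (dS ε l - dV l * posU W) :=
          add_le_add_left (ih j hj) _
      _ ≤ sortedArea ε j (letterCount (l :: W)) := by
          rw [← sumU_letterCount, funext (letterCount_cons l W)]
          exact sortedArea_add_single_ge ε l j (letterCount_nonneg W)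
            (by rwa [sumU_letterCount, sumV_letterCount])
      _ ≤ sortedArea ε i (letterCount (l :: W)) :=
          sortedArea_le ε i j (letterCount_nonneg _)
            (by rwa [sumU_letterCount, sumV_letterCount])

/-- The hexagonal path is the word sorted by direction. -/
theorem exists_quad_area_ge {ε : ℤ} (W : List (Fin 6)) (ha : 0 ≤ posU W) (hb : 0 ≤ posV W) :
    ∃ n : Quad, (∀ j, 0 ≤ n j) ∧ ∑ j, n j = W.length - posU W - posV W ∧
      2 * area ε W ≤ n.area ε (posU W) (posV W) := by
  have hk := letterCount_nonneg W
  refine ⟨sortedOffsets (letterCount W), ?_, ?_, ?_⟩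
  · have h₂ := hk 2; have h₃ := hk 3; have h₄ := hk 4; have h₅ := hk 5
    intro j
    fin_cases j
    exacts [h₄, add_nonneg h₄ h₅, add_nonneg h₂ h₃, h₃]
  · rw [← sum_letterCount, ← sumU_letterCount, ← sumV_letterCount]
    simp only [sortedOffsets, sumU, sumV, Fin.sum_univ_four, Fin.sum_univ_six, Matrix.cons_val_zero,
      Matrix.cons_val_one, Matrix.cons_val, Fin.isValue]
    ring
  · have h := two_mul_area_le_sortedArea (ε := ε) W 0 ⟨ha, hb⟩
    simpa [sortedArea, sumU_letterCount, sumV_letterCount] using h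

/-! ### Optimal hexagonal paths -/

namespace Quad

/-- The offsets `n` with the side in direction `j - 1` moved outwards by one. -/
def push (n : Quad) (j : Fin 4) : Quad := n + Pi.single j 1

/-- The lengths of the sides in the directions `5, 0, 1, 2` of the hexagonal path with offsets `n`
to `(c₁, c₂)`; the sides in the directions `4` and `3` have the lengths `n 0` and `n 3`. -/
def sides (c₁ c₂ : ℤ) (n : Quad) : Quad
  | 0 => n 1 - n 0
  | 1 => c₁ - n 1 + n 0 + n 2
  | 2 => c₂ + n 1 - n 2 + n 3
  | 3 => n 2 - n 3

/-- Half of the growth of `Quad.area` when one of the sides of lengths `t` is moved outwards. -/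
def gain (ε : ℤ) (t : Quad) : Quad
  | 0 => t 0 - (1 - ε)
  | 1 => t 1 - ε
  | 2 => t 2 - (1 - ε)
  | 3 => t 3 - ε

/-- The side lengths `t` with the `j`-th one decreased by one. -/
def lower (t : Quad) (j : Fin 4) : Quad := t - Pi.single j 1

/-- The side lengths of a hexagon with side lengths `t` after its `j`-th side has been moved
outwards, which shortens that side and lengthens the two neighbouring ones. -/
def cut (t : Quad) : Fin 4 → Quad
  | 0 => t + ![-1, 1, 0, 0]
  | 1 => t + ![1, -1, 1, 0]
  | 2 => t + ![0, 1, -1, 1]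
  | 3 => t + ![0, 0, 1, -1]

/-- The gains `g` of an optimal hexagon. For given `ε` these are the almost regular hexagons that
one runs through by always moving outwards a side with maximal gain. -/
def Balanced (ε : ℤ) (g : Quad) : Prop :=
  |g 0 - g 2| ≤ 1 ∧ |g 1 - g 3| ≤ 1 ∧ |g 0 - g 2 + (g 1 - g 3)| ≤ 1 ∧ |g 0 - g 3| ≤ 1 ∧
  ((ε = 0 ∧ (g 0 - g 3 = 1 → g 0 = g 2 ∧ g 1 = g 3) ∧ (g 0 - g 3 = -1 → g 2 ≤ g 0)) ∨
    (ε = 1 ∧ (g 3 - g 0 = 1 → g 0 = g 2 ∧ g 1 = g 3) ∧ (g 3 - g 0 = -1 → g 1 ≤ g 3)))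

theorem area_push (ε c₁ c₂ : ℤ) (n : Quad) (j : Fin 4) :
    (n.push j).area ε c₁ c₂ = n.area ε c₁ c₂ + 2 * (n.sides c₁ c₂).gain ε j := by
  fin_cases j <;> simp [push, area, sides, gain] <;> ring

theorem sum_push (n : Quad) (j : Fin 4) : ∑ i, n.push j i = ∑ i, n i + 1 := by
  simp [push, Finset.sum_add_distrib]

theorem sides_push (c₁ c₂ : ℤ) (n : Quad) (j : Fin 4) :
    (n.push j).sides c₁ c₂ = (n.sides c₁ c₂).cut j := by
  funext i
  fin_cases j <;> fin_cases i <;> simp [push, sides, cut] <;> ring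

theorem gain_lower (ε : ℤ) (t : Quad) (j : Fin 4) : (t.lower j).gain ε = (t.gain ε).lower j := by
  funext i
  fin_cases i <;> exact sub_right_comm _ _ _

theorem gain_cut (ε : ℤ) (t : Quad) (j : Fin 4) : (t.cut j).gain ε = (t.gain ε).cut j := by
  funext i
  fin_cases j <;> fin_cases i <;> simp [cut, gain] <;> ring

theorem Balanced.eq_zero_or_one {ε : ℤ} {g : Quad} (h : g.Balanced ε) : ε = 0 ∨ ε = 1 := by
  obtain ⟨-, -, -, -, ⟨h, -⟩ | ⟨h, -⟩⟩ := h
  exacts [.inl h, .inr h]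

theorem balanced_add_const (ε : ℤ) (g : Quad) (c : ℤ) :
    (g + fun _ => c).Balanced ε ↔ g.Balanced ε := by
  simp only [Balanced, Pi.add_apply, add_sub_add_right_eq_sub, add_left_inj, add_le_add_iff_right]

theorem cut_add (t t' : Quad) (j : Fin 4) : (t + t').cut j = t.cut j + t' := by
  fin_cases j <;> exact add_right_comm _ _ _

theorem lower_add (t t' : Quad) (j : Fin 4) : (t + t').lower j = t.lower j + t' :=
  add_sub_right_comm _ _ _

instance (ε : ℤ) (g : Quad) : Decidable (g.Balanced ε) := by
  unfold Balanced; infer_instance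

theorem Balanced.exists_cut_of_mem : ∀ ε ∈ ({0, 1} : Finset ℤ), ∀ g₀ ∈ Finset.Icc (-1 : ℤ) 1,
    ∀ g₁ ∈ Finset.Icc (-1 : ℤ) 1, ∀ g₂ ∈ Finset.Icc (g₀ - 1) (g₀ + 1),
      Balanced ε ![g₀, g₁, g₂, 0] →
      ∃ j, (cut ![g₀, g₁, g₂, 0] j).Balanced ε ∧ (lower ![g₀, g₁, g₂, 0] j).Balanced ε ∧
        ∀ i, (![g₀, g₁, g₂, 0] : Quad) i ≤ (![g₀, g₁, g₂, 0] : Quad) j := by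
  decide +kernel

theorem Balanced.exists_cut {ε : ℤ} {g : Quad} (h : g.Balanced ε) :
    ∃ j, (g.cut j).Balanced ε ∧ (g.lower j).Balanced ε ∧ ∀ i, g i ≤ g j := by
  have hg : g = ![g 0 - g 3, g 1 - g 3, g 2 - g 3, 0] + fun _ => g 3 := by
    funext i
    fin_cases i <;> simp
  have hε : ε ∈ ({0, 1} : Finset ℤ) := by simpa using h.eq_zero_or_one
  obtain ⟨h₀₂, h₁₃, -, h₀₃, -⟩ := id h
  rw [abs_le] at h₀₂ h₁₃ h₀₃
  rw [hg, balanced_add_const] at h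
  obtain ⟨j, hcut, hlower, hmax⟩ := exists_cut_of_mem ε hε _ (Finset.mem_Icc.2 h₀₃) _
    (Finset.mem_Icc.2 h₁₃) _ (Finset.mem_Icc.2 ⟨by linarith, by linarith⟩) h
  refine ⟨j, ?_, ?_, fun i => ?_⟩
  · rwa [hg, cut_add, balanced_add_const]
  · rwa [hg, lower_add, balanced_add_const]
  · rw [hg]
    exact add_le_add_left (hmax i) _

end Quad

/-- The hexagonal path with offsets `n` to `(c₁, c₂)` runs along an optimal hexagon, whose sides in
the directions `5, 0, 1, 2` have the lengths `t`: it covers completely each side that has been moved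
outwards. By complementary slackness such a path maximises the area among the hexagonal paths of its
length. -/
structure IsOptimal (ε c₁ c₂ : ℤ) (n t : Quad) : Prop where
  nonneg : ∀ j, 0 ≤ n j
  balanced : (t.gain ε).Balanced ε
  le : ∀ j, n.sides c₁ c₂ j ≤ t j
  eq_of_pos : ∀ j, 0 < n j → n.sides c₁ c₂ j = t j

theorem mul_sub_nonneg_of_complementary {m m' a b : ℤ} (hm : 0 ≤ m) (hm' : 0 ≤ m') (hab : a ≤ b)
    (heq : 0 < m → a = b) : 0 ≤ (m' - m) * (b - a) := by
  rcases hm.lt_or_eq with hlt | rfl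
  · rw [heq hlt, sub_self, mul_zero]
  · exact mul_nonneg (by linarith) (by linarith)

theorem linear_le_quadratic {x y w : ℤ} (hx : |x| ≤ 1) (hy : |y| ≤ 1) (hxy : |x + y| ≤ 1)
    (hw : |w| ≤ 1) (f₁ f₂ f₃ : ℤ) :
    2 * (f₂ * y - f₃ * x + (f₁ + f₃) * w) ≤
      f₂ ^ 2 + f₃ ^ 2 + (f₂ + f₃) ^ 2 + 2 * (f₁ + f₃) ^ 2 := by
  have le_sq : ∀ a : ℤ, a ≤ a ^ 2 ∧ -a ≤ a ^ 2 := fun a =>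
    ⟨Int.le_self_sq a, by simpa using Int.le_self_sq (-a)⟩
  have h₂ := le_sq f₂; have h₃ := le_sq f₃; have h₂₃ := le_sq (f₂ + f₃)
  have h₁₃ := le_sq (f₁ + f₃)
  rw [abs_le] at hx hy hxy hw
  have hA : 2 * (f₂ * y - f₃ * x) ≤ f₂ ^ 2 + f₃ ^ 2 + (f₂ + f₃) ^ 2 := by
    obtain rfl | rfl | rfl : x = -1 ∨ x = 0 ∨ x = 1 := by omega
    all_goals
      obtain rfl | rfl | rfl : y = -1 ∨ y = 0 ∨ y = 1 := by omega
      all_goals omega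
  have hB : (f₁ + f₃) * w ≤ (f₁ + f₃) ^ 2 := by
    obtain rfl | rfl | rfl : w = -1 ∨ w = 0 ∨ w = 1 := by omega
    all_goals linarith
  linarith

theorem abs_le_of_quadratic_le {x y w f g b : ℤ} (hx : |x| ≤ 4) (hy : |y| ≤ 4) (hw : |w| ≤ 2)
    (h : f ^ 2 + g ^ 2 + (f + g) ^ 2 + 2 * b ^ 2 ≤ f * y - g * x + b * w) :
    |2 * f - y| ≤ 5 ∧ |2 * g + x| ≤ 5 ∧ |b| ≤ 2 := by
  have hbw : b * w ≤ 2 * |b| := by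
    calc b * w ≤ |b| * |w| := (le_abs_self _).trans_eq (abs_mul _ _)
      _ ≤ |b| * 2 := by gcongr
      _ = 2 * |b| := mul_comm _ _
  have hx2 : x ^ 2 ≤ 4 ^ 2 := sq_le_sq.2 hx
  have hy2 : y ^ 2 ≤ 4 ^ 2 := sq_le_sq.2 hy
  have hb : |b| ≤ b ^ 2 := by simpa only [sq_abs] using Int.le_self_sq |b|
  have htotal : (2 * f - y) ^ 2 + (2 * g + x) ^ 2 + 8 * (b ^ 2 - |b|) ≤ 32 := by
    linarith [sq_nonneg (f + g)]
  have hf := sq_nonneg (2 * f - y)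
  have hg := sq_nonneg (2 * g + x)
  refine ⟨?_, ?_, ?_⟩
  · exact Int.lt_add_one_iff.1 (abs_lt_of_sq_lt_sq (by linarith) (by norm_num))
  · exact Int.lt_add_one_iff.1 (abs_lt_of_sq_lt_sq (by linarith) (by norm_num))
  · rw [← sq_abs b] at htotal
    nlinarith

namespace IsOptimal

variable {ε c₁ c₂ : ℤ} {n t : Quad}

theorem lower (h : IsOptimal ε c₁ c₂ n t) {j : Fin 4}
    (hbal : ((t.gain ε).lower j).Balanced ε) (hj : n.sides c₁ c₂ j ≠ t j) :
    IsOptimal ε c₁ c₂ n (t.lower j) where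
  nonneg := h.nonneg
  balanced := by rwa [Quad.gain_lower]
  le i := by
    have hi := h.le i
    rcases eq_or_ne i j with rfl | hij
    · simp only [Quad.lower, Pi.sub_apply, Pi.single_eq_same]; omega
    · simpa [Quad.lower, Pi.single_eq_of_ne hij] using hi
  eq_of_pos i hi := by
    have hij : i ≠ j := by rintro rfl; exact hj (h.eq_of_pos i hi)
    simpa [Quad.lower, Pi.single_eq_of_ne hij] using h.eq_of_pos i hi

theorem push (h : IsOptimal ε c₁ c₂ n t) {j : Fin 4}
    (hbal : ((t.gain ε).cut j).Balanced ε) (hj : n.sides c₁ c₂ j = t j) :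
    IsOptimal ε c₁ c₂ (n.push j) (t.cut j) where
  nonneg i := add_nonneg (h.nonneg i) (by rw [Pi.single_apply]; split <;> norm_num)
  balanced := by rwa [Quad.gain_cut]
  le i := by
    have hi := h.le i
    rw [Quad.sides_push]
    fin_cases j <;> exact add_le_add_left hi _
  eq_of_pos i hi := by
    have hi' : n.sides c₁ c₂ i = t i := by
      rcases eq_or_ne i j with rfl | hij
      · exact hj
      · exact h.eq_of_pos i (by simpa [Quad.push, Pi.single_eq_of_ne hij] using hi)
    rw [Quad.sides_push]
    fin_cases j <;> exact congrArg (· + _) hi'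

theorem gain_ge_of_max (h : IsOptimal ε c₁ c₂ n t) {j : Fin 4}
    (hmax : ∀ i, t.gain ε i ≤ t.gain ε j) (hj : n.sides c₁ c₂ j = t j) :
    2 * (c₁ + c₂) + ∑ i, n i ≤ 6 * (n.sides c₁ c₂).gain ε j + 3 := by
  have hgain : (n.sides c₁ c₂).gain ε j = t.gain ε j := by
    fin_cases j <;> exact congrArg (· - _) hj
  have := h.balanced.eq_zero_or_one
  have m₀ := hmax 0; have m₁ := hmax 1; have m₂ := hmax 2; have m₃ := hmax 3
  have l₀ := h.le 0; have l₁ := h.le 1; have l₂ := h.le 2; have l₃ := h.le 3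
  rw [hgain, Fin.sum_univ_four]
  generalize t.gain ε j = g at *
  simp only [Quad.gain, Quad.sides] at *
  omega

/-- Lower the sides of the hexagon that are not covered until a side with maximal gain is covered;
then move that side outwards. -/
theorem exists_push (h : IsOptimal ε c₁ c₂ n t) :
    ∃ j t', IsOptimal ε c₁ c₂ (n.push j) t' ∧
      2 * (c₁ + c₂) + ∑ i, n i ≤ 6 * (n.sides c₁ c₂).gain ε j + 3 := by
  induction hd : (∑ i, (t i - n.sides c₁ c₂ i)).toNat using Nat.strong_induction_on
    generalizing t with
  | _ d ih =>
  obtain ⟨j, hcut, hlower, hmax⟩ := h.balanced.exists_cut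
  by_cases hj : n.sides c₁ c₂ j = t j
  · exact ⟨j, t.cut j, h.push hcut hj, h.gain_ge_of_max hmax hj⟩
  · refine ih _ ?_ (h.lower hlower hj) rfl
    have hpos : 0 < ∑ i, (t i - n.sides c₁ c₂ i) :=
      Finset.sum_pos' (fun i _ => sub_nonneg.2 (h.le i))
        ⟨j, Finset.mem_univ j, sub_pos.2 ((h.le j).lt_of_ne hj)⟩
    have hsum : ∑ i, (t.lower j i - n.sides c₁ c₂ i) = ∑ i, (t i - n.sides c₁ c₂ i) - 1 := by
      simp [Quad.lower, Finset.sum_sub_distrib]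
      ring
    rw [hsum]
    omega

theorem area_le_of_sum_eq (h : IsOptimal ε c₁ c₂ n t) {n' : Quad} (hn' : ∀ j, 0 ≤ n' j)
    (hs : ∑ j, n' j = ∑ j, n j) : n'.area ε c₁ c₂ ≤ n.area ε c₁ c₂ := by
  have hc := fun j =>
    mul_sub_nonneg_of_complementary (h.nonneg j) (hn' j) (h.le j) (h.eq_of_pos j)
  obtain ⟨h₀₂, h₁₃, h₀₁₂₃, h₀₃, -⟩ := h.balanced
  have hq := linear_le_quadratic h₀₂ h₁₃ h₀₁₂₃ h₀₃ (n' 0 - n 0) (n' 1 - n 1) (n' 2 - n 2)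
  have hc₀ := hc 0; have hc₁ := hc 1; have hc₂ := hc 2; have hc₃ := hc 3
  rw [Fin.sum_univ_four, Fin.sum_univ_four] at hs
  have h₃ : n' 3 = n 0 + n 1 + n 2 + n 3 - n' 0 - n' 1 - n' 2 := by linarith
  simp only [Quad.sides, Quad.gain, Quad.area, h₃] at *
  linarith

end IsOptimal

theorem exists_isOptimal {ε c₁ c₂ : ℤ} (hε : ε = 0 ∨ ε = 1) (h₁ : 0 ≤ c₁) (h₂ : 0 ≤ c₂) (k : ℕ) :
    ∃ n t, IsOptimal ε c₁ c₂ n t ∧ ∑ j, n j = k := by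
  induction k with
  | zero =>
    refine ⟨0, ![c₁ + c₂ + 2 - 2 * ε, c₁ + c₂ + 1, c₁ + c₂ + 2 - 2 * ε, c₁ + c₂ + 1],
      ⟨fun _ => le_rfl, ?_, fun j => ?_, fun _ h => absurd h (lt_irrefl 0)⟩, by simp⟩
    · simp [Quad.Balanced, Quad.gain, abs_le]
      omega
    · fin_cases j <;> simp [Quad.sides] <;> omega
  | succ k ih =>
    obtain ⟨n, t, h, hs⟩ := ih
    obtain ⟨j, t', h', -⟩ := h.exists_push
    exact ⟨_, t', h', by rw [Quad.sum_push, hs, Nat.cast_succ]⟩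

namespace IsOptimal

variable {ε c₁ c₂ : ℤ} {n t : Quad}

theorem sum_nonneg (h : IsOptimal ε c₁ c₂ n t) : 0 ≤ ∑ j, n j :=
  Finset.sum_nonneg fun j _ => h.nonneg j

theorem exists_sum_eq_add (h : IsOptimal ε c₁ c₂ n t) (h₁ : 0 ≤ c₁) (h₂ : 0 ≤ c₂) (k : ℕ) :
    ∃ n' t', IsOptimal ε c₁ c₂ n' t' ∧ ∑ j, n' j = ∑ j, n j + k ∧ n ≤ n' ∧
      n.area ε c₁ c₂ ≤ n'.area ε c₁ c₂ := by
  induction k with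
  | zero => exact ⟨n, t, h, by simp, le_rfl, le_rfl⟩
  | succ k ih =>
    obtain ⟨n', t', h', hs, hle, harea⟩ := ih
    obtain ⟨j, u, hu, hgain⟩ := h'.exists_push
    have := h'.sum_nonneg
    refine ⟨_, u, hu, by rw [Quad.sum_push, hs, Nat.cast_succ, add_assoc],
      hle.trans (le_add_of_nonneg_right (Pi.single_nonneg.2 zero_le_one)), ?_⟩
    rw [Quad.area_push]
    omega

theorem area_mono (h : IsOptimal ε c₁ c₂ n t) (h₁ : 0 ≤ c₁) (h₂ : 0 ≤ c₂) {n' : Quad}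
    (hn' : ∀ j, 0 ≤ n' j) (hs : ∑ j, n' j ≤ ∑ j, n j) : n'.area ε c₁ c₂ ≤ n.area ε c₁ c₂ := by
  obtain ⟨k', hk'⟩ : ∃ k' : ℕ, ∑ j, n' j = k' :=
    Int.eq_ofNat_of_zero_le (Finset.sum_nonneg fun j _ => hn' j)
  obtain ⟨k, hk⟩ : ∃ k : ℕ, ∑ j, n j - ∑ j, n' j = k := Int.eq_ofNat_of_zero_le (sub_nonneg.2 hs)
  obtain ⟨m, u, hm, hmk⟩ := exists_isOptimal h.balanced.eq_zero_or_one h₁ h₂ k'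
  obtain ⟨m', u', hm', hmk', -, hle⟩ := hm.exists_sum_eq_add h₁ h₂ k
  calc n'.area ε c₁ c₂ ≤ m.area ε c₁ c₂ := hm.area_le_of_sum_eq hn' (by omega)
    _ ≤ m'.area ε c₁ c₂ := hle
    _ ≤ n.area ε c₁ c₂ := h.area_le_of_sum_eq hm'.nonneg (by omega)

theorem le_six_mul (h : IsOptimal ε c₁ c₂ n t) (j : Fin 4) :
    2 * (c₁ + c₂) + ∑ i, n i ≤ 6 * t j + 12 := by
  have l₀ := h.le 0; have l₁ := h.le 1; have l₂ := h.le 2; have l₃ := h.le 3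
  have hbal := h.balanced
  simp only [Quad.sides, Quad.Balanced, Quad.gain, abs_le, Fin.sum_univ_four] at *
  fin_cases j <;> simp only [Fin.zero_eta, Fin.mk_one, Fin.reduceFinMk] <;> omega

theorem sides_nonneg (h : IsOptimal ε c₁ c₂ n t) (h₁ : 0 ≤ c₁) (h₂ : 0 ≤ c₂)
    (hl : 12 ≤ 2 * (c₁ + c₂) + ∑ j, n j) (j : Fin 4) : 0 ≤ n.sides c₁ c₂ j := by
  have p₀ := h.nonneg 0; have p₁ := h.nonneg 1; have p₂ := h.nonneg 2; have p₃ := h.nonneg 3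
  rcases (h.nonneg j).lt_or_eq with hpos | hzero
  · rw [h.eq_of_pos j hpos]
    linarith [h.le_six_mul j]
  · fin_cases j <;> simp only [Quad.sides, Fin.zero_eta, Fin.mk_one, Fin.reduceFinMk] at * <;> omega

theorem mul_sub_nonneg {c₁' c₂' : ℤ} {n' t' : Quad} (h : IsOptimal ε c₁ c₂ n t)
    (h' : IsOptimal ε c₁' c₂' n' t') (j : Fin 4) :
    0 ≤ (n' j - n j) * (n'.sides c₁' c₂' j - t' j - (n.sides c₁ c₂ j - t j)) := by
  linarith [mul_sub_nonneg_of_complementary (h.nonneg j) (h'.nonneg j) (h.le j) (h.eq_of_pos j),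
    mul_sub_nonneg_of_complementary (h'.nonneg j) (h.nonneg j) (h'.le j) (h'.eq_of_pos j)]

theorem sub_bounds {c₁' c₂' : ℤ} {n' t' : Quad} (h : IsOptimal ε c₁ c₂ n t)
    (h' : IsOptimal ε c₁' c₂' n' t') (hs : ∑ j, n' j = ∑ j, n j) (hc₁ : |c₁' - c₁| ≤ 2)
    (hc₂ : |c₂' - c₂| ≤ 2) :
    |n' 0 - n 0| ≤ 6 ∧ |n' 1 - n 1| ≤ 4 ∧ |n' 2 - n 2| ≤ 4 ∧ |n' 3 - n 3| ≤ 6 := by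
  have q₀ := h.mul_sub_nonneg h' 0; have q₁ := h.mul_sub_nonneg h' 1
  have q₂ := h.mul_sub_nonneg h' 2; have q₃ := h.mul_sub_nonneg h' 3
  obtain ⟨b₀₂, b₁₃, -, b₀₃, -⟩ := h.balanced
  obtain ⟨b₀₂', b₁₃', -, b₀₃', -⟩ := h'.balanced
  simp only [Quad.gain, abs_le, Fin.sum_univ_four] at b₀₂ b₁₃ b₀₃ b₀₂' b₁₃' b₀₃' hc₁ hc₂ hs
  have hn₃ : n' 3 = n 0 + n 1 + n 2 + n 3 - n' 0 - n' 1 - n' 2 := by linarith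
  simp only [Quad.sides, hn₃] at q₀ q₁ q₂ q₃
  have hx : |-(c₂' - c₂) - ((t' 0 - t' 2) - (t 0 - t 2))| ≤ 4 := abs_le.2 ⟨by omega, by omega⟩
  have hy : |c₁' - c₁ - ((t' 1 - t' 3) - (t 1 - t 3))| ≤ 4 := abs_le.2 ⟨by omega, by omega⟩
  have hw : |t 0 - t 3 - (t' 0 - t' 3)| ≤ 2 := abs_le.2 ⟨by omega, by omega⟩
  obtain ⟨k₁, k₂, k₃⟩ := abs_le_of_quadratic_le (f := n' 1 - n 1) (g := n' 2 - n 2)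
    (b := n' 0 - n 0 + (n' 2 - n 2)) hx hy hw (by linarith)
  simp only [abs_le] at k₁ k₂ k₃ ⊢
  omega

theorem sub_bounds_of_sum_le {c₁' c₂' : ℤ} {n' t' : Quad} (h : IsOptimal ε c₁ c₂ n t)
    (h' : IsOptimal ε c₁' c₂' n' t') (h₁ : 0 ≤ c₁) (h₂ : 0 ≤ c₂) (hs : ∑ j, n j ≤ ∑ j, n' j)
    (hs' : ∑ j, n' j ≤ ∑ j, n j + 2) (hc₁ : |c₁' - c₁| ≤ 2) (hc₂ : |c₂' - c₂| ≤ 2) :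
    |n' 0 - n 0| ≤ 8 ∧ |n' 1 - n 1| ≤ 6 ∧ |n' 2 - n 2| ≤ 6 ∧ |n' 3 - n 3| ≤ 8 := by
  obtain ⟨m, u, hm, hsum, hle, -⟩ := h.exists_sum_eq_add h₁ h₂ (∑ j, n' j - ∑ j, n j).toNat
  have hbounds := hm.sub_bounds h' (by omega) hc₁ hc₂
  have l₀ := hle 0; have l₁ := hle 1; have l₂ := hle 2; have l₃ := hle 3
  simp only [abs_le, Fin.sum_univ_four] at *
  omega

end IsOptimal

/-! ### Word lengths -/

theorem wordLength_le {G : Type} [Group G] (gen : Letter → G) (w : Word) :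
    wordLength gen (w.map gen).prod ≤ w.length :=
  Nat.sInf_le ⟨w, rfl, rfl⟩

theorem exists_length_eq_wordLength {G : Type} [Group G] (gen : Letter → G) (w : Word) :
    ∃ w' : Word, w'.length = wordLength gen (w.map gen).prod ∧
      (w'.map gen).prod = (w.map gen).prod :=
  Nat.sInf_mem (s := {k | ∃ w' : Word, w'.length = k ∧ (w'.map gen).prod = (w.map gen).prod})
    ⟨_, w, rfl, rfl⟩

@[simp] theorem eval_nil : eval [] = 1 := rfl

theorem eval_cons (l : Letter) (w : Word) : eval (l :: w) = l.val * eval w := by simp [eval]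

theorem eval_append (w w' : Word) : eval (w ++ w') = eval w * eval w' := by simp [eval]

theorem Letter.exists_val_eq_inv (l : Letter) : ∃ l' : Letter, l'.val = l.val⁻¹ := by
  cases l
  exacts [⟨.xi, rfl⟩, ⟨.yi, rfl⟩, ⟨.ti, rfl⟩, ⟨.x, (inv_inv _).symm⟩, ⟨.y, (inv_inv _).symm⟩,
    ⟨.t, (inv_inv _).symm⟩]

theorem exists_eval_eq_inv (w : Word) :
    ∃ w' : Word, w'.length = w.length ∧ eval w' = (eval w)⁻¹ := by
  induction w with
  | nil => exact ⟨[], rfl, by simp⟩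
  | cons l w ih =>
    obtain ⟨w', hlength, hw'⟩ := ih
    obtain ⟨l', hl'⟩ := l.exists_val_eq_inv
    exact ⟨w' ++ [l'], by simp [hlength], by simp [eval_append, eval_cons, hw', hl']⟩

theorem exists_eval_eq (g : N) : ∃ w : Word, eval w = g := by
  let H : Subgroup N :=
    { carrier := {g | ∃ w : Word, eval w = g}
      one_mem' := ⟨[], rfl⟩
      mul_mem' := by
        rintro _ _ ⟨w, rfl⟩ ⟨w', rfl⟩
        exact ⟨w ++ w', eval_append _ _⟩
      inv_mem' := by
        rintro _ ⟨w, rfl⟩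
        exact (exists_eval_eq_inv w).imp fun _ h => h.2 }
  refine PresentedGroup.generated_by rels H (fun l => ?_) g
  cases l
  exacts [⟨[.x], mul_one x⟩, ⟨[.y], mul_one y⟩]

theorem len_eval_le (w : Word) : len (eval w) ≤ w.length := wordLength_le Letter.val w

theorem exists_length_eq_len (g : N) : ∃ w : Word, w.length = len g ∧ eval w = g := by
  obtain ⟨w, rfl⟩ := exists_eval_eq g
  exact exists_length_eq_wordLength Letter.val w

theorem p_eval (w : Word) : p (eval w) = (w.map fun l => p l.val).prod := by
  rw [eval, map_list_prod, List.map_map]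
  rfl

theorem planeLen_p_eval_le (w : Word) : planeLen (p (eval w)) ≤ w.length := by
  rw [p_eval]
  exact wordLength_le _ w

theorem p_surjective : Function.Surjective p := fun P => ⟨_, p_normalForm P.toAdd.1 P.toAdd.2 0⟩

theorem exists_length_eq_planeLen (P : Plane) :
    ∃ w : Word, w.length = planeLen P ∧ p (eval w) = P := by
  obtain ⟨g, rfl⟩ := p_surjective P
  obtain ⟨w, rfl⟩ := exists_eval_eq g
  simp only [p_eval]
  exact exists_length_eq_wordLength _ w

theorem planeLen_mul (P Q : Plane) : planeLen (P * Q) ≤ planeLen P + planeLen Q := by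
  obtain ⟨w, hw, rfl⟩ := exists_length_eq_planeLen P
  obtain ⟨w', hw', rfl⟩ := exists_length_eq_planeLen Q
  rw [← hw, ← hw', ← List.length_append, ← map_mul, ← eval_append]
  exact planeLen_p_eval_le _

theorem planeLen_inv_le (P : Plane) : planeLen P⁻¹ ≤ planeLen P := by
  obtain ⟨w, hw, rfl⟩ := exists_length_eq_planeLen P
  obtain ⟨w', hlength, hw'⟩ := exists_eval_eq_inv w
  rw [← hw, ← hlength, ← map_inv, ← hw']
  exact planeLen_p_eval_le _

theorem planeDist_comm (P Q : Plane) : planeDist P Q = planeDist Q P := by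
  have hle : ∀ P Q : Plane, planeDist P Q ≤ planeDist Q P := fun P Q => by
    simpa only [planeDist, mul_inv_rev, inv_inv] using planeLen_inv_le (Q⁻¹ * P)
  exact (hle P Q).antisymm (hle Q P)

theorem planeDist_triangle (P Q R : Plane) : planeDist P R ≤ planeDist P Q + planeDist Q R := by
  have hmul : P⁻¹ * R = P⁻¹ * Q * (Q⁻¹ * R) := by group
  rw [planeDist, hmul]
  exact planeLen_mul _ _

theorem planeDist_take_le (w : Word) {i j : ℕ} (hij : i ≤ j) :
    planeDist (p (eval (w.take i))) (p (eval (w.take j))) ≤ j - i := by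
  obtain ⟨k, rfl⟩ := Nat.exists_eq_add_of_le hij
  rw [List.take_add, eval_append, map_mul, planeDist, inv_mul_cancel_left, Nat.add_sub_cancel_left]
  exact (planeLen_p_eval_le _).trans (List.length_take_le _ _)

/-! ### Coordinates in a frame -/

/-- The image of a letter in `ℤ²`. -/
def Letter.vec : Letter → ℤ × ℤ
  | .x => (1, 0)
  | .y => (0, 1)
  | .t => (1, 1)
  | .xi => (-1, 0)
  | .yi => (0, -1)
  | .ti => (-1, -1)

theorem p_val (l : Letter) : p l.val = Multiplicative.ofAdd l.vec := by
  cases l <;> simp only [Letter.val, Letter.vec, map_mul, map_inv, p_x, p_y] <;> rfl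

namespace Frame

theorem p_pt (f : Frame) (a b s : ℤ) :
    p (f.pt a b s) = Multiplicative.ofAdd (a • (f.letter 0).vec + b • (f.letter 1).vec) := by
  have hZ : p f.Z = 1 := by
    unfold Z
    split <;> simp [p_z]
  simp only [pt, map_mul, map_zpow, hZ, one_zpow, mul_one, U, V, p_val, ofAdd_add, ofAdd_zsmul]

theorem fstCoord_pt (f : Frame) (a b s : ℤ) :
    fstCoord (p (f.pt a b s)) = a * (f.letter 0).vec.1 + b * (f.letter 1).vec.1 := by
  simp [p_pt, fstCoord]

theorem sndCoord_pt (f : Frame) (a b s : ℤ) :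
    sndCoord (p (f.pt a b s)) = a * (f.letter 0).vec.2 + b * (f.letter 1).vec.2 := by
  simp [p_pt, sndCoord]

theorem p_pt_injective (f : Frame) {a b s a' b' s' : ℤ}
    (h : p (f.pt a b s) = p (f.pt a' b' s')) : a = a' ∧ b = b' := by
  have hfst := congrArg fstCoord h
  have hsnd := congrArg sndCoord h
  rw [fstCoord_pt, fstCoord_pt] at hfst
  rw [sndCoord_pt, sndCoord_pt] at hsnd
  rcases f with ⟨u, pos⟩
  cases u <;> cases pos <;>
    simp only [letter, turn, Letter.next, Letter.prev, Letter.vec, Fin.val_zero, Fin.val_one,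
      Function.iterate_zero, Function.iterate_one, id] at hfst hsnd <;> omega

theorem Z_zpow_injective (f : Frame) : Function.Injective fun s : ℤ => f.Z ^ s := by
  intro s s' h
  have hs := congrArg (fun g => (toHeis g).s) h
  rcases f with ⟨u, _ | _⟩ <;>
    simpa [Z, Heis.zpow_of_mul_eq_zero] using hs

theorem pt_injective (f : Frame) {a b s a' b' s' : ℤ} (h : f.pt a b s = f.pt a' b' s') :
    a = a' ∧ b = b' ∧ s = s' := by
  obtain ⟨rfl, rfl⟩ := f.p_pt_injective (congrArg p h)
  exact ⟨rfl, rfl, f.Z_zpow_injective (mul_left_cancel h)⟩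

theorem letter_surjective (f : Frame) : Function.Surjective f.letter := by
  intro l
  rcases f with ⟨u, pos⟩
  cases u <;> cases pos <;> cases l <;>
    first | exact ⟨0, rfl⟩ | exact ⟨1, rfl⟩ | exact ⟨2, rfl⟩ | exact ⟨3, rfl⟩ | exact ⟨4, rfl⟩
          | exact ⟨5, rfl⟩

theorem exists_map_letter_eq (f : Frame) (w : Word) : ∃ W : List (Fin 6), W.map f.letter = w :=
  List.map_surjective_iff.2 f.letter_surjective w

theorem exists_eq_pt (f : Frame) (g : N) : ∃ a b s : ℤ, g = f.pt a b s := by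
  obtain ⟨w, rfl⟩ := exists_eval_eq g
  obtain ⟨W, rfl⟩ := f.exists_map_letter_eq w
  exact ⟨_, _, _, f.eval_map W⟩

theorem len_pt_le_iff (f : Frame) (a b s : ℤ) (m : ℕ) :
    len (f.pt a b s) ≤ m ↔ ∃ W : List (Fin 6), W.length ≤ m ∧ posU W = a ∧ posV W = b ∧
      area f.eps W = s := by
  constructor
  · intro h
    obtain ⟨w, hlength, hw⟩ := exists_length_eq_len (f.pt a b s)
    obtain ⟨W, rfl⟩ := f.exists_map_letter_eq w
    rw [f.eval_map] at hw
    obtain ⟨hu, hv, hs⟩ := f.pt_injective hw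
    rw [List.length_map] at hlength
    exact ⟨W, hlength.trans_le h, hu, hv, hs⟩
  · rintro ⟨W, hW, rfl, rfl, rfl⟩
    rw [← f.eval_map]
    exact (len_eval_le _).trans (by rwa [List.length_map])

end Frame

/-- The straight word of length `k` in the direction `i`; it is empty if `k` is negative. -/
def run (i : Fin 6) (k : ℤ) : List (Fin 6) := List.replicate k.toNat i

@[simp] theorem run_zero (i : Fin 6) : run i 0 = [] := rfl

theorem run_one (i : Fin 6) : run i 1 = [i] := rfl

theorem run_add (i : Fin 6) {k l : ℤ} (hk : 0 ≤ k) (hl : 0 ≤ l) :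
    run i (k + l) = run i k ++ run i l := by
  rw [run, run, run, List.replicate_append_replicate, Int.toNat_add hk hl]

theorem length_run (i : Fin 6) {k : ℤ} (hk : 0 ≤ k) : ((run i k).length : ℤ) = k := by
  simp [run, hk]

theorem posU_run (i : Fin 6) {k : ℤ} (hk : 0 ≤ k) : posU (run i k) = k * dU i := by
  simp [posU, run, hk]

theorem posV_run (i : Fin 6) {k : ℤ} (hk : 0 ≤ k) : posV (run i k) = k * dV i := by
  simp [posV, run, hk]

theorem two_mul_area_run (ε : ℤ) (i : Fin 6) {k : ℤ} (hk : 0 ≤ k) :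
    2 * area ε (run i k) = 2 * k * dS ε i - dU i * dV i * (k * (k - 1)) := by
  induction k, hk using Int.leInduction with
  | base => simp
  | succ k hk ih =>
    rw [add_comm, run_add i zero_le_one hk, run_one, List.singleton_append, area_cons,
      posU_run i hk]
    linear_combination ih

theorem area_run_eq_zero (ε : ℤ) {i : Fin 6} (hi : dU i * dV i = 0) {k : ℤ} (hk : 0 ≤ k) :
    area ε (run i k) = 0 := by
  have hd : dS ε i = 0 := by fin_cases i <;> simp_all [dU, dV, dS]
  have h := two_mul_area_run ε i hk
  rw [hd, hi] at h
  linarith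

theorem exists_posU_posV_eq {a b : ℤ} {K : ℕ} (ha : |a| ≤ K) (hb : |b| ≤ K) (hab : |a + b| ≤ K) :
    ∃ W : List (Fin 6), W.length ≤ K ∧ posU W = a ∧ posV W = b := by
  obtain ⟨i, h₀, h₂⟩ := exists_inSector a b
  have hsum : sectorForm a b i + sectorForm a b (i + 2) ≤ K := by
    rw [← sectorForm_add_one]
    rw [abs_le] at ha hb hab
    fin_cases i <;> simp [sectorForm] <;> omega
  have hu : sectorForm a b i * dU i + sectorForm a b (i + 2) * dU (i + 1) = a := by
    fin_cases i <;> simp [sectorForm, dU]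
  have hv : sectorForm a b i * dV i + sectorForm a b (i + 2) * dV (i + 1) = b := by
    fin_cases i <;> simp [sectorForm, dV]
  refine ⟨run i (sectorForm a b i) ++ run (i + 1) (sectorForm a b (i + 2)), ?_, ?_, ?_⟩
  · zify
    rwa [List.length_append, Nat.cast_add, length_run _ h₀, length_run _ h₂]
  · rw [posU_append, posU_run _ h₀, posU_run _ h₂, hu]
  · rw [posV_append, posV_run _ h₀, posV_run _ h₂, hv]

theorem posU_add_posV_le (W : List (Fin 6)) : posU W + posV W ≤ W.length := by
  induction W with
  | nil => rfl
  | cons i W ih =>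
    have hi : dU i + dV i ≤ 1 := by fin_cases i <;> decide
    rw [posU_cons, posV_cons, List.length_cons, Nat.cast_succ]
    linarith

namespace Frame

theorem planeLen_pt (f : Frame) {a b : ℤ} (s : ℤ) (ha : 0 ≤ a) (hb : 0 ≤ b) :
    (planeLen (p (f.pt a b s)) : ℤ) = a + b := by
  apply le_antisymm
  · obtain ⟨W, hlength, hu, hv⟩ :=
      exists_posU_posV_eq (a := a) (b := b) (K := (a + b).toNat) (by rw [abs_of_nonneg] <;> omega)
        (by rw [abs_of_nonneg] <;> omega) (by rw [abs_of_nonneg] <;> omega)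
    have hW : p (eval (W.map f.letter)) = p (f.pt a b s) := by
      rw [f.eval_map, p_pt, p_pt, hu, hv]
    have := planeLen_p_eval_le (W.map f.letter)
    rw [hW, List.length_map] at this
    omega
  · obtain ⟨w, hlength, hw⟩ := exists_length_eq_planeLen (p (f.pt a b s))
    obtain ⟨W, rfl⟩ := f.exists_map_letter_eq w
    rw [f.eval_map] at hw
    obtain ⟨rfl, rfl⟩ := f.p_pt_injective hw
    rw [← hlength, List.length_map]
    exact posU_add_posV_le W

theorem planeDist_pt_le (f : Frame) {a b s a' b' s' : ℤ} {K : ℕ} (ha : |a' - a| ≤ K)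
    (hb : |b' - b| ≤ K) (hab : |a' - a + (b' - b)| ≤ K) :
    planeDist (p (f.pt a b s)) (p (f.pt a' b' s')) ≤ K := by
  obtain ⟨W, hlength, hu, hv⟩ := exists_posU_posV_eq ha hb hab
  have hW : (p (f.pt a b s))⁻¹ * p (f.pt a' b' s') = p (eval (W.map f.letter)) := by
    rw [inv_mul_eq_iff_eq_mul, f.eval_map, ← map_mul, pt_mul, p_pt, p_pt, hu, hv]
    simp
  rw [planeDist, hW]
  exact (planeLen_p_eval_le _).trans (by rwa [List.length_map])

end Frame

/-! ### Hexagonal paths -/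

namespace Quad

/-- The path from `(0, 0)` to `(c₁, c₂)` along the sides of the hexagon with offsets `n`. -/
def path (c₁ c₂ : ℤ) (n : Quad) : List (Fin 6) :=
  run 4 (n 0) ++ run 5 (n.sides c₁ c₂ 0) ++ run 0 (n.sides c₁ c₂ 1) ++
    run 1 (n.sides c₁ c₂ 2) ++ run 2 (n.sides c₁ c₂ 3) ++ run 3 (n 3)

variable {c₁ c₂ : ℤ} {n : Quad}

theorem length_path (hn : ∀ j, 0 ≤ n j) (ht : ∀ j, 0 ≤ n.sides c₁ c₂ j) :
    ((n.path c₁ c₂).length : ℤ) = c₁ + c₂ + ∑ j, n j := by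
  simp only [path, List.length_append, Nat.cast_add, length_run, hn, ht]
  simp only [sides, Fin.sum_univ_four]
  ring

theorem posU_path (hn : ∀ j, 0 ≤ n j) (ht : ∀ j, 0 ≤ n.sides c₁ c₂ j) :
    posU (n.path c₁ c₂) = c₁ := by
  simp only [path, posU_append, posU_run, hn, ht]
  simp only [sides, dU]
  ring

theorem posV_path (hn : ∀ j, 0 ≤ n j) (ht : ∀ j, 0 ≤ n.sides c₁ c₂ j) :
    posV (n.path c₁ c₂) = c₂ := by
  simp only [path, posV_append, posV_run, hn, ht]
  simp only [sides, dV]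
  ring

theorem two_mul_area_path (ε : ℤ) (hn : ∀ j, 0 ≤ n j) (ht : ∀ j, 0 ≤ n.sides c₁ c₂ j) :
    2 * NilHex.area ε (n.path c₁ c₂) = n.area ε c₁ c₂ := by
  have h₀ := two_mul_area_run ε 4 (hn 0)
  have h₁ := two_mul_area_run ε 5 (ht 0)
  have h₂ := two_mul_area_run ε 0 (ht 1)
  have h₃ := two_mul_area_run ε 1 (ht 2)
  have h₄ := two_mul_area_run ε 2 (ht 3)
  have h₅ := two_mul_area_run ε 3 (hn 3)
  simp only [path, area_append, posV_append, posU_run, posV_run, hn, ht]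
  simp only [sides, area, dU, dV, dS] at *
  linear_combination h₀ + h₁ + h₂ + h₃ + h₄ + h₅

theorem exists_path_push_eq_append {ε : ℤ} (hε : ε = 0 ∨ ε = 1) (hn : ∀ j, 0 ≤ n j)
    (ht : ∀ j, 0 ≤ n.sides c₁ c₂ j) (j : Fin 4) :
    ∃ (i : Fin 6) (a b c : ℤ) (A B : List (Fin 6)), 0 ≤ a ∧ 0 ≤ c ∧
      (n.sides c₁ c₂).gain ε j ≤ b ∧
      n.path c₁ c₂ = A ++ (run i a ++ run (i + 1) b ++ run (i + 2) c) ++ B ∧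
      (n.push j).path c₁ c₂ =
        A ++ (run i (a + 1) ++ run (i + 1) (b - 1) ++ run (i + 2) (c + 1)) ++ B := by
  have hside : ∀ j, (n.sides c₁ c₂).gain ε j ≤ n.sides c₁ c₂ j := by
    intro j
    fin_cases j <;> simp only [gain, Fin.zero_eta, Fin.mk_one, Fin.reduceFinMk] <;> omega
  fin_cases j
  · refine ⟨4, n 0, n.sides c₁ c₂ 0, n.sides c₁ c₂ 1, [],
      run 1 (n.sides c₁ c₂ 2) ++ run 2 (n.sides c₁ c₂ 3) ++ run 3 (n 3), hn 0, ht 1, hside 0, ?_⟩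
    simp only [path, sides_push]
    simp [push, cut, sub_eq_add_neg]
  · refine ⟨5, n.sides c₁ c₂ 0, n.sides c₁ c₂ 1, n.sides c₁ c₂ 2, run 4 (n 0),
      run 2 (n.sides c₁ c₂ 3) ++ run 3 (n 3), ht 0, ht 2, hside 1, ?_⟩
    simp only [path, sides_push]
    simp [push, cut, sub_eq_add_neg]
  · refine ⟨0, n.sides c₁ c₂ 1, n.sides c₁ c₂ 2, n.sides c₁ c₂ 3,
      run 4 (n 0) ++ run 5 (n.sides c₁ c₂ 0), run 3 (n 3), ht 1, ht 3, hside 2, ?_⟩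
    simp only [path, sides_push]
    simp [push, cut, sub_eq_add_neg]
  · refine ⟨1, n.sides c₁ c₂ 2, n.sides c₁ c₂ 3, n 3,
      run 4 (n 0) ++ run 5 (n.sides c₁ c₂ 0) ++ run 0 (n.sides c₁ c₂ 1), [], ht 2, hn 3,
      hside 3, ?_⟩
    simp only [path, sides_push]
    simp [push, cut, sub_eq_add_neg]

end Quad

/-! ### Paths that stay close to each other -/

/-- The end points of two words in the directions of a frame are at distance at most `K`, and so
are their lengths. The first three conditions describe a ball of the hexagonal norm. -/
def Near (K : ℤ) (A A' : List (Fin 6)) : Prop :=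
  |posU A' - posU A| ≤ K ∧ |posV A' - posV A| ≤ K ∧
    |posU A' - posU A + (posV A' - posV A)| ≤ K ∧ |(A'.length : ℤ) - A.length| ≤ K

theorem Near.symm {K : ℤ} {A A' : List (Fin 6)} (h : Near K A A') : Near K A' A := by
  simp only [Near, abs_le] at *
  omega

theorem Near.append {K : ℤ} {A A' : List (Fin 6)} (h : Near K A A') (B : List (Fin 6)) :
    Near K (A ++ B) (A' ++ B) := by
  simpa only [Near, posU_append, posV_append, List.length_append, Nat.cast_add,
    add_sub_add_right_eq_sub] using h

theorem prefix_append_run {A W : List (Fin 6)} {i : Fin 6} {m : ℤ} (hm : 0 ≤ m)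
    (h : A <+: W ++ run i m) : A <+: W ∨ ∃ k : ℤ, 0 ≤ k ∧ k ≤ m ∧ A = W ++ run i k := by
  obtain ⟨B, hB⟩ := h
  rcases List.append_eq_append_iff.1 hB with ⟨C, hC, -⟩ | ⟨C, hC, hC'⟩
  · exact Or.inl ⟨C, hC.symm⟩
  · have hrun := List.append_eq_replicate_iff.1 hC'.symm
    exact Or.inr ⟨C.length, by omega, by omega, by rw [hC, run, Int.toNat_natCast, ← hrun.2.1]⟩

/-- Two paths each initial segment of which is near an initial segment of the other one. -/
structure Tracks (K : ℤ) (W W' : List (Fin 6)) : Prop where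
  near : Near K W W'
  left : ∀ A, A <+: W → ∃ A', A' <+: W' ∧ Near K A A'
  right : ∀ A', A' <+: W' → ∃ A, A <+: W ∧ Near K A A'

namespace Tracks

variable {K : ℤ} {W W' : List (Fin 6)}

theorem symm (h : Tracks K W W') : Tracks K W' W :=
  ⟨h.near.symm, fun A hA => (h.right A hA).imp fun _ hB => ⟨hB.1, hB.2.symm⟩,
    fun A hA => (h.left A hA).imp fun _ hB => ⟨hB.1, hB.2.symm⟩⟩

theorem nil (hK : 0 ≤ K) : Tracks K [] [] := by
  have hnear : Near K [] [] := by simp [Near, hK]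
  exact ⟨hnear, fun A hA => ⟨[], List.prefix_rfl, by rwa [List.prefix_nil.1 hA]⟩,
    fun A hA => ⟨[], List.prefix_rfl, by rwa [List.prefix_nil.1 hA]⟩⟩

/-- A point of the last side of the first path is matched with the point of the last side of the
second path at the same distance from the start of the side, or else with the end point. -/
theorem exists_near_of_prefix_append_run (h : Tracks K W W') (i : Fin 6) {m m' : ℤ} (hm : 0 ≤ m)
    (hm' : 0 ≤ m') (hnear : Near K (W ++ run i m) (W' ++ run i m')) {A : List (Fin 6)}
    (hA : A <+: W ++ run i m) : ∃ A', A' <+: W' ++ run i m' ∧ Near K A A' := by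
  rcases prefix_append_run hm hA with hA | ⟨k, hk, hkm, rfl⟩
  · obtain ⟨A', hA', hAA'⟩ := h.left A hA
    exact ⟨A', hA'.trans (List.prefix_append _ _), hAA'⟩
  · rcases le_total k m' with hkm' | hkm'
    · refine ⟨W' ++ run i k, ⟨run i (m' - k), ?_⟩, h.near.append _⟩
      rw [List.append_assoc, ← run_add i hk (by omega), add_sub_cancel]
    · refine ⟨W' ++ run i m', List.prefix_rfl, ?_⟩
      have hstart := h.near
      simp only [Near, abs_le, posU_append, posV_append, List.length_append, Nat.cast_add,
        posU_run, posV_run, length_run, hk, hm, hm'] at hstart hnear ⊢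
      fin_cases i <;> simp only [dU, dV] at hnear ⊢ <;> omega

theorem append_run (h : Tracks K W W') (i : Fin 6) {m m' : ℤ} (hm : 0 ≤ m) (hm' : 0 ≤ m')
    (hnear : Near K (W ++ run i m) (W' ++ run i m')) :
    Tracks K (W ++ run i m) (W' ++ run i m') :=
  ⟨hnear, fun _ hA => h.exists_near_of_prefix_append_run i hm hm' hnear hA, fun _ hA =>
    (h.symm.exists_near_of_prefix_append_run i hm' hm hnear.symm hA).imp
      fun _ hB => ⟨hB.1, hB.2.symm⟩⟩

theorem append_right (h : Tracks K W W') (B : List (Fin 6)) : Tracks K (W ++ B) (W' ++ B) := by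
  induction B using List.reverseRecOn with
  | nil => simpa using h
  | append_singleton B i ih =>
    rw [← run_one i, ← List.append_assoc, ← List.append_assoc]
    exact ih.append_run i zero_le_one zero_le_one (ih.near.append _)

theorem refl (hK : 0 ≤ K) (W : List (Fin 6)) : Tracks K W W := (nil hK).append_right W

end Tracks

/-- Each vertex of the first projected path is within distance `K` of a vertex of the second one
that is reached at almost the same time. -/
def Close (K : ℕ) (w w' : Word) : Prop :=
  ∀ u, u <+: w → ∃ u', u' <+: w' ∧ |(u'.length : ℤ) - u.length| ≤ K ∧
    planeDist (p (eval u)) (p (eval u')) ≤ K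

theorem Close.trans {K K' : ℕ} {w w' w'' : Word} (h : Close K w w') (h' : Close K' w' w'') :
    Close (K + K') w w'' := by
  intro u hu
  obtain ⟨u', hu', hlength, hdist⟩ := h u hu
  obtain ⟨u'', hu'', hlength', hdist'⟩ := h' u' hu'
  refine ⟨u'', hu'', ?_, (planeDist_triangle _ (p (eval u')) _).trans (add_le_add hdist hdist')⟩
  rw [abs_le] at *
  omega

theorem Close.mono {K K' : ℕ} {w w' : Word} (h : Close K w w') (hK : K ≤ K') : Close K' w w' := by
  intro u hu
  obtain ⟨u', hu', hlength, hdist⟩ := h u hu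
  exact ⟨u', hu', hlength.trans (by exact_mod_cast hK), hdist.trans hK⟩

/-- Closeness in both directions. -/
def Similar (K : ℕ) (w w' : Word) : Prop := Close K w w' ∧ Close K w' w

theorem Similar.symm {K : ℕ} {w w' : Word} (h : Similar K w w') : Similar K w' w := ⟨h.2, h.1⟩

theorem Similar.trans {K K' : ℕ} {w w' w'' : Word} (h : Similar K w w') (h' : Similar K' w' w'') :
    Similar (K + K') w w'' :=
  ⟨h.1.trans h'.1, (h'.2.trans h.2).mono (add_comm K' K).le⟩

theorem Similar.mono {K K' : ℕ} {w w' : Word} (h : Similar K w w') (hK : K ≤ K') :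
    Similar K' w w' := ⟨h.1.mono hK, h.2.mono hK⟩

theorem Tracks.close {K : ℕ} {W W' : List (Fin 6)} (h : Tracks K W W') (f : Frame) :
    Close K (W.map f.letter) (W'.map f.letter) := by
  rintro u ⟨v, huv⟩
  obtain ⟨A, B, rfl, rfl, rfl⟩ := List.map_eq_append_iff.1 huv.symm
  obtain ⟨A', hA', hu, hv, huv, hlength⟩ := h.left A (List.prefix_append _ _)
  refine ⟨A'.map f.letter, hA'.map _, by simpa using hlength, ?_⟩
  rw [f.eval_map, f.eval_map]
  exact f.planeDist_pt_le hu hv huv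

theorem Tracks.similar {K : ℕ} {W W' : List (Fin 6)} (h : Tracks K W W') (f : Frame) :
    Similar K (W.map f.letter) (W'.map f.letter) := ⟨h.close f, h.symm.close f⟩

theorem graphDist_le (P Q : GraphPoint) : graphDist P Q ≤ P.s + planeDist P.v Q.v + Q.s := by
  unfold graphDist
  dsimp only
  split_ifs
  · exact (min_le_left _ _).trans ((min_le_left _ _).trans (min_le_left _ _))
  · exact (min_le_left _ _).trans ((min_le_left _ _).trans (min_le_left _ _))
  · exact (min_le_left _ _).trans (min_le_left _ _)

theorem Close.take {K : ℕ} {w w' : Word} (h : Close K w w') {i : ℕ} (hi : i ≤ w.length) :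
    ∃ i' ≤ w'.length, i' ≤ i + K ∧ i ≤ i' + K ∧
      planeDist (p (eval (w.take i))) (p (eval (w'.take i'))) ≤ K := by
  obtain ⟨u', hu', hlength, hdist⟩ := h (w.take i) (List.take_prefix _ _)
  rw [List.length_take, min_eq_left hi, abs_le] at hlength
  exact ⟨u'.length, hu'.length_le, by omega, by omega,
    by rwa [← List.prefix_iff_eq_take.1 hu']⟩

theorem Close.inNeighbourhood {K : ℕ} {w w' : Word} (h : Close K w w') :
    InNeighbourhood (K + 1) w w' := by
  intro τ _
  obtain ⟨i', hi', -, -, hdist⟩ := h.take (Nat.floor_le_of_le (min_le_right τ w.length))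
  refine ⟨i', Nat.cast_nonneg _, (graphDist_le _ _).trans ?_⟩
  have hend : min (i' : ℝ) w'.length = i' := min_eq_left (by exact_mod_cast hi')
  simp only [projPath, hend, Nat.floor_natCast, Int.fract_natCast]
  have hfract := (Int.fract_lt_one (min τ (w.length : ℝ))).le
  have hdist' : (planeDist (p (eval (w.take ⌊min τ (w.length : ℝ)⌋₊)))
      (p (eval (w'.take i'))) : ℝ) ≤ K := by exact_mod_cast hdist
  linarith

theorem Close.fellowTravel {K : ℕ} {w w' : Word} (h : Close K w w') (hl : w.length = w'.length) :
    FellowTravel (2 * K + 2) w w' := by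
  intro τ _
  refine (graphDist_le _ _).trans ?_
  simp only [projPath, ← hl]
  obtain ⟨i', -, hle, hge, hdist⟩ := h.take (Nat.floor_le_of_le (min_le_right τ w.length))
  generalize ⌊min τ (w.length : ℝ)⌋₊ = i at *
  have hfract := (Int.fract_lt_one (min τ (w.length : ℝ))).le
  have hshift : planeDist (p (eval (w'.take i'))) (p (eval (w'.take i))) ≤ K := by
    rcases le_total i i' with hii' | hii'
    · rw [planeDist_comm]
      exact (planeDist_take_le w' hii').trans (by omega)
    · exact (planeDist_take_le w' hii').trans (by omega)
  have hsum : (planeDist (p (eval (w.take i))) (p (eval (w'.take i))) : ℝ) ≤ K + K := by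
    exact_mod_cast (planeDist_triangle _ _ _).trans (add_le_add hdist hshift)
  linarith

/-- There are standard geodesics for `g` and `h` that are similar, with the constant `24` which
yields the constants `25` and `50` of `HaveFellowTravellingGeodesics`. -/
def HaveCloseGeodesics (g h : N) : Prop :=
  ∃ w w' : Word, IsStandardGeodesic w g ∧ IsStandardGeodesic w' h ∧ Similar 24 w w'

theorem HaveCloseGeodesics.symm {g h : N} (H : HaveCloseGeodesics g h) :
    HaveCloseGeodesics h g := by
  obtain ⟨w, w', hw, hw', hs⟩ := H
  exact ⟨w', w, hw', hw, hs.symm⟩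

theorem IsStandardGeodesic.length_eq {w : Word} {g : N} (h : IsStandardGeodesic w g) :
    w.length = len g := by
  rw [← h.1]
  exact h.2.1

theorem HaveCloseGeodesics.haveFellowTravellingGeodesics {g h : N} (H : HaveCloseGeodesics g h)
    (hgh : len g = len h) : HaveFellowTravellingGeodesics g h := by
  obtain ⟨w, w', hw, hw', hs⟩ := H
  have hlength : w.length = w'.length := by rw [hw.length_eq, hw'.length_eq, hgh]
  have hleft := hs.1.inNeighbourhood
  have hright := hs.2.inNeighbourhood
  have htravel := hs.1.fellowTravel hlength
  norm_num at hleft hright htravel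
  exact ⟨w, w', hw, hw', hleft, hright, htravel⟩

/-! ### Paths between two successive hexagons -/

theorem dU_add_dU_add_two (i : Fin 6) : dU i + dU (i + 2) = dU (i + 1) := by
  fin_cases i <;> rfl

theorem dV_add_dV_add_two (i : Fin 6) : dV i + dV (i + 2) = dV (i + 1) := by
  fin_cases i <;> rfl

theorem dV_add_one_mul_dU_sub (i : Fin 6) : dV (i + 1) * dU i - dV i * dU (i + 1) = 1 := by
  fin_cases i <;> rfl

theorem abs_dU_le_one (i : Fin 6) : |dU i| ≤ 1 := by fin_cases i <;> decide

theorem abs_dV_le_one (i : Fin 6) : |dV i| ≤ 1 := by fin_cases i <;> decide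

theorem abs_dU_add_dV_le_one (i : Fin 6) : |dU i + dV i| ≤ 1 := by fin_cases i <;> decide

theorem area_append_cons_run (ε : ℤ) (i : Fin 6) {k : ℤ} (hk : 0 ≤ k) (A B : List (Fin 6)) :
    area ε (A ++ i :: (run (i + 1) k ++ B)) = area ε (A ++ (run (i + 1) k ++ i :: B)) + k := by
  simp only [area_append, area_cons, posU_append, posU_cons, posU_run _ hk, posV_run _ hk]
  linear_combination k * dV_add_one_mul_dU_sub i

/-- The path that turns off at `A` by an edge in the direction `i` tracks the path along the next
smaller hexagon. -/
theorem tracks_append_cons (A : List (Fin 6)) (i : Fin 6) {b c : ℤ} (hb : 0 ≤ b) (hc : 0 ≤ c)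
    (B : List (Fin 6)) : Tracks 1 (A ++ i :: (run (i + 1) b ++ run (i + 2) (c + 1) ++ B))
      (A ++ (run (i + 1) (b + 1) ++ run (i + 2) c ++ B)) := by
  have hb' : 0 ≤ b + 1 := by omega
  have hc' : 0 ≤ c + 1 := by omega
  have hu := abs_dU_le_one
  have hv := abs_dV_le_one
  have huv := abs_dU_add_dV_le_one
  have hu₂ := dU_add_dU_add_two i
  have hv₂ := dV_add_dV_add_two i
  simp only [abs_le] at hu hv huv
  have hu₀ := hu i; have hv₀ := hv i; have huv₀ := huv i
  have hu₁ := hu (i + 2); have hv₁ := hv (i + 2); have huv₁ := huv (i + 2)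
  have start := Tracks.refl zero_le_one A
  have side₀ := start.append_run i (m := 1) (m' := 0) zero_le_one le_rfl (by
    simp only [Near, abs_le, posU_append, posV_append, List.length_append, Nat.cast_add, run_zero,
      run_one, posU_cons, posV_cons, posU_nil, posV_nil, List.length_cons, List.length_nil]
    omega)
  have side₁ := side₀.append_run (i + 1) (m := b) (m' := b + 1) hb hb' (by
    simp only [Near, abs_le, posU_append, posV_append, List.length_append, Nat.cast_add, run_zero,
      run_one, posU_cons, posV_cons, posU_nil, posV_nil, List.length_cons, List.length_nil,
      posU_run, posV_run, length_run, hb, hb', add_mul]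
    omega)
  have side₂ := side₁.append_run (i + 2) (m := c + 1) (m' := c) hc' hc (by
    simp only [Near, abs_le, posU_append, posV_append, List.length_append, Nat.cast_add, run_zero,
      run_one, posU_cons, posV_cons, posU_nil, posV_nil, List.length_cons, List.length_nil,
      posU_run, posV_run, length_run, hb, hb', hc, hc', add_mul]
    omega)
  simpa [run_one] using side₂.append_right B

namespace Quad

variable {ε c₁ c₂ : ℤ} {n : Quad} {j : Fin 4}

theorem exists_path_push_eq_append_cons (hε : ε = 0 ∨ ε = 1) (hn : ∀ i, 0 ≤ n i)
    (ht : ∀ i, 0 ≤ n.sides c₁ c₂ i) {k : ℤ} (hk : 0 ≤ k)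
    (hgain : k < (n.sides c₁ c₂).gain ε j) :
    ∃ (i : Fin 6) (b c : ℤ) (A B : List (Fin 6)), 0 ≤ b ∧ 0 ≤ c ∧
      n.path c₁ c₂ = A ++ run (i + 1) k ++ (run (i + 1) (b + 1) ++ run (i + 2) c ++ B) ∧
      (n.push j).path c₁ c₂ =
        A ++ i :: (run (i + 1) k ++ (run (i + 1) b ++ run (i + 2) (c + 1) ++ B)) := by
  obtain ⟨i, a, b, c, A, B, ha, hc, hb, hpath, hpath'⟩ := exists_path_push_eq_append hε hn ht j
  refine ⟨i, b - 1 - k, c, A ++ run i a, B, by omega, hc, ?_, ?_⟩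
  · have hsplit : run (i + 1) b = run (i + 1) k ++ run (i + 1) (b - 1 - k + 1) := by
      rw [← run_add _ hk (by omega)]
      ring_nf
    rw [hpath, hsplit]
    simp only [List.append_assoc]
  · have hsplit : run (i + 1) (b - 1) = run (i + 1) k ++ run (i + 1) (b - 1 - k) := by
      rw [← run_add _ hk (by omega)]
      ring_nf
    rw [hpath', run_add i ha zero_le_one, run_one, hsplit]
    simp only [List.append_assoc, List.cons_append, List.nil_append]

/-- The path follows the smaller hexagon, crosses by a single edge, and follows the larger one. -/
theorem exists_interpolation {s : ℤ} (hε : ε = 0 ∨ ε = 1) (hn : ∀ i, 0 ≤ n i)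
    (ht : ∀ i, 0 ≤ n.sides c₁ c₂ i) (hn' : ∀ i, 0 ≤ n.push j i)
    (ht' : ∀ i, 0 ≤ (n.push j).sides c₁ c₂ i) (hlt : n.area ε c₁ c₂ < 2 * s)
    (hle : 2 * s ≤ (n.push j).area ε c₁ c₂) :
    ∃ (A B : List (Fin 6)) (i : Fin 6), A <+: n.path c₁ c₂ ∧ B <:+ (n.push j).path c₁ c₂ ∧
      posU (A ++ i :: B) = c₁ ∧ posV (A ++ i :: B) = c₂ ∧ NilHex.area ε (A ++ i :: B) = s ∧
      ((A ++ i :: B).length : ℤ) = c₁ + c₂ + ∑ j, n j + 1 ∧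
      Tracks 1 (A ++ i :: B) (n.path c₁ c₂) := by
  have harea := two_mul_area_path ε hn' ht'
  have hU := posU_path hn' ht'
  have hV := posV_path hn' ht'
  have hlength := length_path hn' ht'
  rw [sum_push] at hlength
  have hpush := area_push ε c₁ c₂ n j
  obtain ⟨k, hk⟩ : ∃ k, k = NilHex.area ε ((n.push j).path c₁ c₂) - s := ⟨_, rfl⟩
  have hk₀ : 0 ≤ k := by omega
  obtain ⟨i, b, c, A, B, hb, hc, hpath, hpath'⟩ :=
    exists_path_push_eq_append_cons hε hn ht (j := j) hk₀ (by omega)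
  refine ⟨A ++ run (i + 1) k, run (i + 1) b ++ run (i + 2) (c + 1) ++ B, i,
    hpath ▸ List.prefix_append _ _, hpath' ▸ ⟨A ++ i :: run (i + 1) k, by simp⟩, ?_, ?_, ?_, ?_,
    hpath ▸ tracks_append_cons _ i hb hc B⟩
  · rw [← hU, hpath']
    simp only [posU_append, posU_cons]
    ring
  · rw [← hV, hpath']
    simp only [posV_append, posV_cons]
    ring
  · rw [hpath', area_append_cons_run ε i hk₀] at hk
    rw [List.append_assoc]
    omega
  · rw [add_assoc, ← hlength, hpath']
    simp only [List.length_append, List.length_cons]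
    push_cast
    ring

end Quad

/-! ### The lengths of the elements over a point -/

/-- The path in the parallelogram that runs `i` steps along one side, crosses to the opposite side
with `e` steps sideways, and ends with `l` steps along that side. -/
def parallelogramPath (i j e k l : ℤ) : List (Fin 6) :=
  run 0 i ++ run 1 j ++ run 0 e ++ run 1 k ++ run 0 l

/-- The step numbers of a `parallelogramPath` to `(c₁, c₂)` of area `s` that crosses the
parallelogram with at most one unit step sideways. -/
structure IsParallelogramSplitting (c₁ c₂ s i j e k l : ℤ) : Prop where
  i_nonneg : 0 ≤ i
  j_nonneg : 0 ≤ j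
  e_nonneg : 0 ≤ e
  e_le_one : e ≤ 1
  k_nonneg : 0 ≤ k
  l_nonneg : 0 ≤ l
  add_add_eq : i + e + l = c₁
  add_eq : j + k = c₂
  area_eq : s = -(l * c₂ + e * j)

theorem exists_isParallelogramSplitting {c₁ c₂ s : ℤ} (h₁ : 0 ≤ c₁) (h₂ : 0 ≤ c₂)
    (hs : -(c₁ * c₂) ≤ s) (hs₀ : s ≤ 0) :
    ∃ i j e k l : ℤ, IsParallelogramSplitting c₁ c₂ s i j e k l := by
  rcases h₂.eq_or_lt with rfl | h₂
  · exact ⟨c₁, 0, 0, 0, 0, h₁, le_rfl, le_rfl, zero_le_one, le_rfl, le_rfl, by omega, by omega,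
      by simp at hs; omega⟩
  have hdiv := Int.emod_add_mul_ediv (-s) c₂
  have hr := Int.emod_nonneg (-s) h₂.ne'
  have hrlt := Int.emod_lt_of_pos (-s) h₂
  have hl : 0 ≤ (-s) / c₂ := Int.ediv_nonneg (by omega) h₂.le
  generalize (-s) % c₂ = r at *
  generalize (-s) / c₂ = l at *
  rcases hr.eq_or_lt with rfl | hr
  · have hle : l ≤ c₁ := by nlinarith
    exact ⟨c₁ - l, c₂, 0, 0, l, by omega, by omega, le_rfl, zero_le_one, le_rfl, hl, by omega,
      by omega, by linarith⟩
  · have hlt : l < c₁ := by nlinarith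
    exact ⟨c₁ - l - 1, r, 1, c₂ - r, l, by omega, by omega, zero_le_one, le_rfl, by omega, hl,
      by omega, by omega, by linarith⟩

namespace IsParallelogramSplitting

variable {c₁ c₂ s i j e k l : ℤ}

theorem length_path (h : IsParallelogramSplitting c₁ c₂ s i j e k l) :
    ((parallelogramPath i j e k l).length : ℤ) = c₁ + c₂ := by
  simp only [parallelogramPath, List.length_append, Nat.cast_add, length_run, h.i_nonneg,
    h.j_nonneg, h.e_nonneg, h.k_nonneg, h.l_nonneg]
  linarith [h.add_add_eq, h.add_eq]

theorem posU_path (h : IsParallelogramSplitting c₁ c₂ s i j e k l) :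
    posU (parallelogramPath i j e k l) = c₁ := by
  simp only [parallelogramPath, posU_append, posU_run, h.i_nonneg, h.j_nonneg, h.e_nonneg,
    h.k_nonneg, h.l_nonneg, dU]
  linarith [h.add_add_eq]

theorem posV_path (h : IsParallelogramSplitting c₁ c₂ s i j e k l) :
    posV (parallelogramPath i j e k l) = c₂ := by
  simp only [parallelogramPath, posV_append, posV_run, h.i_nonneg, h.j_nonneg, h.e_nonneg,
    h.k_nonneg, h.l_nonneg, dV]
  linarith [h.add_eq]

theorem area_path (h : IsParallelogramSplitting c₁ c₂ s i j e k l) (ε : ℤ) :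
    area ε (parallelogramPath i j e k l) = s := by
  simp only [parallelogramPath, area_append, posV_append, posU_run, posV_run,
    area_run_eq_zero ε (i := 0) rfl, area_run_eq_zero ε (i := 1) rfl, h.i_nonneg, h.j_nonneg,
    h.e_nonneg, h.k_nonneg, h.l_nonneg, dU, dV]
  rw [h.area_eq, ← h.add_eq]
  ring

end IsParallelogramSplitting

theorem Frame.len_pt_le_of_nonpos (f : Frame) {c₁ c₂ s : ℤ} (h₁ : 0 ≤ c₁) (h₂ : 0 ≤ c₂)
    (hs : -(c₁ * c₂) ≤ s) (hs₀ : s ≤ 0) : (len (f.pt c₁ c₂ s) : ℤ) ≤ c₁ + c₂ := by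
  obtain ⟨i, j, e, k, l, h⟩ := exists_isParallelogramSplitting h₁ h₂ hs hs₀
  have hlength := h.length_path
  have := (f.len_pt_le_iff c₁ c₂ s (c₁ + c₂).toNat).2
    ⟨parallelogramPath i j e k l, by omega, h.posU_path, h.posV_path, h.area_path f.eps⟩
  omega

/-- The path first goes round a parallelogram of area `7 * q`, notched so as to enclose `r` more. -/
theorem Frame.len_pt_le_of_le (f : Frame) {c₁ c₂ s : ℤ} (h₁ : 0 ≤ c₁) (h₂ : 0 ≤ c₂)
    (hs : 0 ≤ s) (hs' : s ≤ 48) : (len (f.pt c₁ c₂ s) : ℤ) ≤ c₁ + c₂ + 28 := by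
  obtain ⟨q, r, hq, hr, hr₇, hq₆, rfl⟩ :
      ∃ q r : ℤ, 0 ≤ q ∧ 0 ≤ r ∧ 0 ≤ 7 - r ∧ q ≤ 6 ∧ s = 7 * q + r :=
    ⟨s / 7, s % 7, by omega, by omega, by omega, by omega, by omega⟩
  have hq' : 0 ≤ q + 1 := by omega
  have h₇ : (0 : ℤ) ≤ 7 := by omega
  have harea₀ := fun k => area_run_eq_zero f.eps (i := 0) rfl (k := k)
  have harea₁ := fun k => area_run_eq_zero f.eps (i := 1) rfl (k := k)
  have harea₃ := fun k => area_run_eq_zero f.eps (i := 3) rfl (k := k)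
  have harea₄ := fun k => area_run_eq_zero f.eps (i := 4) rfl (k := k)
  have := (f.len_pt_le_iff c₁ c₂ (7 * q + r) (c₁ + c₂ + 28).toNat).2
    ⟨run 4 q ++ run 0 (7 - r) ++ run 4 1 ++ run 0 r ++ run 1 (q + 1) ++ run 3 7 ++ run 0 c₁ ++
      run 1 c₂, by
      zify
      simp only [List.length_append, Nat.cast_add, length_run, zero_le_one, *]
      omega, by
      simp only [posU_append, posU_run, zero_le_one, *, dU]
      ring, by
      simp only [posV_append, posV_run, zero_le_one, *, dV]
      ring, by
      simp only [area_append, posV_append, posU_run, posV_run, zero_le_one, *, dU, dV]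
      ring⟩
  omega

theorem Quad.area_le_of_sum_eq {ε c₁ c₂ : ℤ} {n : Quad} (hε : ε = 0 ∨ ε = 1) (hn : ∀ j, 0 ≤ n j)
    (h₁ : 0 ≤ c₁) (h₂ : 0 ≤ c₂) (hs : 2 * (c₁ + c₂) + ∑ j, n j = 12) : n.area ε c₁ c₂ ≤ 84 := by
  have p₀ := hn 0; have p₁ := hn 1; have p₂ := hn 2; have p₃ := hn 3
  obtain ⟨k, hk⟩ : ∃ k, k = n 0 + n 1 + n 2 + n 3 := ⟨_, rfl⟩
  rw [Fin.sum_univ_four, ← hk] at hs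
  have hside₁ : c₁ * n 1 ≤ c₁ * k := mul_le_mul_of_nonneg_left (by omega) h₁
  have hside₂ : c₂ * n 2 ≤ c₂ * k := mul_le_mul_of_nonneg_left (by omega) h₂
  have hcorner : 4 * ((n 0 + n 2) * (n 1 + n 3)) ≤ k ^ 2 := by
    rw [hk]
    nlinarith [sq_nonneg (n 0 + n 2 - n 1 - n 3)]
  have hsign : (2 * ε - 1) * (n 0 + n 2) + (1 - 2 * ε) * (n 1 + n 3) ≤ k := by
    rcases hε with rfl | rfl <;> omega
  have hk' : k = 12 - 2 * (c₁ + c₂) := by omega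
  have hprod : (c₁ + c₂) * k + 2 * ((c₁ + c₂) * (c₁ + c₂)) = 12 * (c₁ + c₂) := by
    rw [hk']
    ring
  have hsq : k ^ 2 = 144 - 48 * (c₁ + c₂) + 4 * ((c₁ + c₂) * (c₁ + c₂)) := by
    rw [hk']
    ring
  rw [Quad.area]
  nlinarith [sq_nonneg (n 0), sq_nonneg (n 1), sq_nonneg (n 2), sq_nonneg (n 3), mul_nonneg p₀ p₃,
    mul_nonneg (add_nonneg h₁ h₂) (add_nonneg h₁ h₂)]

theorem Quad.eq_zero_of_sum_eq_zero {n : Quad} (hn : ∀ j, 0 ≤ n j) (hs : ∑ j, n j = 0) : n = 0 :=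
  funext fun j => (Finset.sum_eq_zero_iff_of_nonneg fun i _ => hn i).1 hs j (Finset.mem_univ j)

@[simp] theorem Quad.area_zero (ε c₁ c₂ : ℤ) : Quad.area ε c₁ c₂ 0 = 0 := by simp [Quad.area]

namespace IsOptimal

variable {f : Frame} {c₁ c₂ s : ℤ} {n t : Quad}

theorem area_nonneg (h : IsOptimal f.eps c₁ c₂ n t) (h₁ : 0 ≤ c₁) (h₂ : 0 ≤ c₂) :
    0 ≤ n.area f.eps c₁ c₂ := by
  simpa using h.area_mono h₁ h₂ (n' := 0) (fun _ => le_rfl) (by simpa using h.sum_nonneg)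

theorem le_area_of_len_le (h : IsOptimal f.eps c₁ c₂ n t) (h₁ : 0 ≤ c₁) (h₂ : 0 ≤ c₂)
    (hl : (len (f.pt c₁ c₂ s) : ℤ) ≤ c₁ + c₂ + ∑ j, n j) : 2 * s ≤ n.area f.eps c₁ c₂ := by
  obtain ⟨W, hlength, rfl, rfl, rfl⟩ := (f.len_pt_le_iff c₁ c₂ s _).1 le_rfl
  obtain ⟨n', hn', hsum, hle⟩ := exists_quad_area_ge (ε := f.eps) W h₁ h₂
  exact hle.trans (h.area_mono h₁ h₂ hn' (by omega))

theorem len_le_thirty_four (h : IsOptimal f.eps c₁ c₂ n t) (h₁ : 0 ≤ c₁) (h₂ : 0 ≤ c₂)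
    (hs : 0 ≤ s) (hS : 2 * s ≤ n.area f.eps c₁ c₂) (hsum : 2 * (c₁ + c₂) + ∑ j, n j ≤ 12) :
    len (f.pt c₁ c₂ s) ≤ 34 := by
  have hsum₀ := h.sum_nonneg
  obtain ⟨m, t', hm, hmsum⟩ := exists_isOptimal f.eps_eq_zero_or_one h₁ h₂
    (12 - 2 * (c₁ + c₂)).toNat
  have hmono := hm.area_mono h₁ h₂ h.nonneg (by omega)
  have hle := Quad.area_le_of_sum_eq f.eps_eq_zero_or_one hm.nonneg h₁ h₂ (by omega)
  have hlen := f.len_pt_le_of_le (s := s) h₁ h₂ hs (by omega)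
  omega

theorem len_le_of_pos (h : IsOptimal f.eps c₁ c₂ n t) (h₁ : 0 ≤ c₁) (h₂ : 0 ≤ c₂) (hs : 0 < s)
    (hS : 2 * s ≤ n.area f.eps c₁ c₂) :
    (len (f.pt c₁ c₂ s) : ℤ) ≤ c₁ + c₂ + ∑ j, n j ∨ len (f.pt c₁ c₂ s) ≤ 34 := by
  obtain ⟨k, hk⟩ : ∃ k : ℕ, ∑ j, n j = k := Int.eq_ofNat_of_zero_le h.sum_nonneg
  induction k generalizing n t with
  | zero =>
    rw [Quad.eq_zero_of_sum_eq_zero h.nonneg hk, Quad.area_zero] at hS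
    omega
  | succ k ih =>
    rcases le_or_gt (2 * (c₁ + c₂) + ∑ j, n j) 12 with hsmall | hbig
    · exact Or.inr (h.len_le_thirty_four h₁ h₂ hs.le hS hsmall)
    obtain ⟨m, t', hm, hmsum⟩ := exists_isOptimal f.eps_eq_zero_or_one h₁ h₂ k
    obtain ⟨j, t'', hpush, -⟩ := hm.exists_push
    have hpsum := Quad.sum_push m j
    have hle := hpush.area_le_of_sum_eq h.nonneg (by omega)
    rcases le_or_gt (2 * s) (m.area f.eps c₁ c₂) with hSm | hSm
    · rcases ih hm hSm hmsum with hlen | hlen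
      · left
        omega
      · exact Or.inr hlen
    · left
      obtain ⟨A, B, i, -, -, hu, hv, harea, hlength, -⟩ := Quad.exists_interpolation
        f.eps_eq_zero_or_one hm.nonneg (hm.sides_nonneg h₁ h₂ (by omega)) hpush.nonneg
        (hpush.sides_nonneg h₁ h₂ (by omega)) hSm (hS.trans hle)
      have := (f.len_pt_le_iff c₁ c₂ s (c₁ + c₂ + ∑ j, n j).toNat).2
        ⟨A ++ i :: B, by omega, hu, hv, harea⟩
      omega

theorem len_le (h : IsOptimal f.eps c₁ c₂ n t) (h₁ : 0 ≤ c₁) (h₂ : 0 ≤ c₂)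
    (hl : 34 ≤ c₁ + c₂ + ∑ j, n j) (hs : -(c₁ * c₂) ≤ s) (hS : 2 * s ≤ n.area f.eps c₁ c₂) :
    (len (f.pt c₁ c₂ s) : ℤ) ≤ c₁ + c₂ + ∑ j, n j := by
  rcases le_or_gt s 0 with hs₀ | hs₀
  · linarith [f.len_pt_le_of_nonpos h₁ h₂ hs hs₀, h.sum_nonneg]
  · rcases h.len_le_of_pos h₁ h₂ hs₀ hS with hlen | hlen <;> omega

end IsOptimal

/-! ### Extremal paths -/

namespace Frame

theorem pt_mul_Z_zpow (f : Frame) (a b s k : ℤ) : f.pt a b s * f.Z ^ k = f.pt a b (s + k) := by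
  rw [pt, pt, mul_assoc, ← zpow_add]

theorem isExtremal_pt (f : Frame) {a b s : ℤ} (s₀ : ℤ) {m : ℕ} (hm : len (f.pt a b s) ≤ m)
    (hmax : ∀ s', len (f.pt a b s') ≤ m → s' ≤ s) :
    IsExtremal (p (f.pt a b s₀)) m (f.pt a b s) := by
  obtain ⟨a', b', t, ht⟩ := exists_eq_normalForm (f.pt a b s)
  have hP : p (f.pt a b s₀) = Multiplicative.ofAdd (a', b') := by
    rw [p_pt, ← p_pt f a b s, ht, p_normalForm]
  rw [hP]
  have hfibre : ∀ τ : ℤ, x ^ a' * y ^ b' * z ^ τ = f.pt a b s * z ^ (τ - t) := by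
    intro τ
    rw [ht, mul_assoc _ (z ^ t), ← zpow_add, add_sub_cancel]
  have hmem : t ∈ fibreBall (Multiplicative.ofAdd (a', b')) m := by
    rw [ht] at hm
    exact hm
  refine ⟨t, ht, ?_⟩
  cases hpos : f.pos
  · refine Or.inr ⟨hmem, fun τ hτ => ?_⟩
    have hz : z ^ (τ - t) = f.Z ^ (t - τ) := by simp only [Z, hpos, inv_zpow', neg_sub]
    have := hmax (s + (t - τ)) (by rw [← pt_mul_Z_zpow, ← hz, ← hfibre]; exact hτ)
    omega
  · refine Or.inl ⟨hmem, fun τ hτ => ?_⟩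
    have hz : z ^ (τ - t) = f.Z ^ (τ - t) := by simp only [Z, hpos]
    have := hmax (s + (τ - t)) (by rw [← pt_mul_Z_zpow, ← hz, ← hfibre]; exact hτ)
    omega

theorem turn_eq_next_or_prev (f : Frame) : f.turn = Letter.next ∨ f.turn = Letter.prev := by
  obtain ⟨u, pos⟩ := f
  cases pos
  · exact Or.inr rfl
  · exact Or.inl rfl

theorem turn_letter (f : Frame) (i : Fin 6) : f.turn (f.letter i) = f.letter (i + 1) := by
  obtain ⟨u, pos⟩ := f
  cases u <;> cases pos <;> fin_cases i <;> rfl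

theorem hexWord_letter (f : Frame) (s : Fin 6 → ℕ) :
    hexWord f.turn (f.letter 4) s = List.replicate (s 0) (f.letter 4) ++
      List.replicate (s 1) (f.letter 5) ++ List.replicate (s 2) (f.letter 0) ++
      List.replicate (s 3) (f.letter 1) ++ List.replicate (s 4) (f.letter 2) ++
      List.replicate (s 5) (f.letter 3) := by
  simp [hexWord, List.finRange_succ, turn_letter, Fin.succ_one_eq_two]

theorem map_letter_run (f : Frame) (i : Fin 6) (k : ℤ) :
    (run i k).map f.letter = List.replicate k.toNat (f.letter i) := List.map_replicate

end Frame

theorem suffix_runs {i j k : Fin 6} {a b c a' b' c' : ℤ} (ha : 0 ≤ a) (hb : 0 ≤ b) (hc : 0 ≤ c)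
    (ha' : a ≤ a') (hb' : b ≤ b') (hc' : c ≤ c') (hab : 0 < a → b = b') (hbc : 0 < b → c = c')
    (hac : 0 < a → c = c') :
    run i a ++ run j b ++ run k c <:+ run i a' ++ run j b' ++ run k c' := by
  rcases ha.eq_or_lt with rfl | ha
  · rcases hb.eq_or_lt with rfl | hb
    · refine ⟨run i a' ++ run j b' ++ run k (c' - c), ?_⟩
      rw [← sub_add_cancel c' c, run_add k (by omega) hc]
      simp
    · refine ⟨run i a' ++ run j (b' - b), ?_⟩
      rw [← hbc hb, ← sub_add_cancel b' b, run_add j (by omega) hb.le]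
      simp
  · refine ⟨run i (a' - a), ?_⟩
    rw [← hab ha, ← hac ha, ← sub_add_cancel a' a, run_add i (by omega) ha.le]
    simp

theorem prefix_runs {i j k : Fin 6} {a b c a' b' c' : ℤ} (ha : 0 ≤ a) (hb : 0 ≤ b) (hc : 0 ≤ c)
    (ha' : a ≤ a') (hb' : b ≤ b') (hc' : c ≤ c') (hcb : 0 < c → b = b') (hba : 0 < b → a = a')
    (hca : 0 < c → a = a') :
    run i a ++ run j b ++ run k c <+: run i a' ++ run j b' ++ run k c' := by
  rw [← List.reverse_suffix]
  simpa [run] using suffix_runs (i := k) (j := j) (k := i) hc hb ha hc' hb' ha' hcb hba hca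

namespace Quad

/-- The side lengths of the closed hexagon with sides of lengths `t` in the directions `5, 0, 1, 2`,
beginning with the direction `4`. -/
def hexagonSides (t : Quad) : Fin 6 → ℤ :=
  ![t 2 + t 3 - t 0, t 0, t 1, t 2, t 3, t 0 + t 1 - t 3]

/-- The boundary of the closed hexagon with sides of lengths `t` in the directions `5, 0, 1, 2`. -/
def hexagon (t : Quad) : List (Fin 6) :=
  run 4 (t.hexagonSides 0) ++ run 5 (t.hexagonSides 1) ++ run 0 (t.hexagonSides 2) ++
    run 1 (t.hexagonSides 3) ++ run 2 (t.hexagonSides 4) ++ run 3 (t.hexagonSides 5)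

theorem Balanced.exists_hexagonSides_mem_Icc {ε : ℤ} {t : Quad} (h : (t.gain ε).Balanced ε) :
    ∃ b : ℤ, ∀ i, t.hexagonSides i ∈ Set.Icc b (b + 2) := by
  simp only [Balanced, gain, abs_le] at h
  refine ⟨min (min (t 0) (t 1)) (min (min (t 2) (t 3)) (min (t 2 + t 3 - t 0) (t 0 + t 1 - t 3))),
    fun i => ?_⟩
  fin_cases i <;> simp [hexagonSides, -le_inf_iff, -inf_le_iff] <;> omega

theorem posU_hexagon {t : Quad} (ht : ∀ i, 0 ≤ t.hexagonSides i) : posU t.hexagon = 0 := by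
  simp only [hexagon, posU_append, posU_run, ht]
  simp only [hexagonSides, dU, Matrix.cons_val]
  ring

theorem posV_hexagon {t : Quad} (ht : ∀ i, 0 ≤ t.hexagonSides i) : posV t.hexagon = 0 := by
  simp only [hexagon, posV_append, posV_run, ht]
  simp only [hexagonSides, dV, Matrix.cons_val]
  ring

theorem isAlmostRegularHexagon_hexagon {ε : ℤ} {t : Quad} (f : Frame) (h : (t.gain ε).Balanced ε)
    (ht : ∀ i, 0 ≤ t.hexagonSides i) : IsAlmostRegularHexagon (t.hexagon.map f.letter) := by
  refine ⟨f.turn, f.letter 4, fun i => (t.hexagonSides i).toNat, f.turn_eq_next_or_prev, ?_, ?_, ?_⟩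
  · obtain ⟨b, hb⟩ := h.exists_hexagonSides_mem_Icc
    intro i j
    have hi := hb i
    have hj := hb j
    simp only [Set.mem_Icc] at hi hj
    change (t.hexagonSides i).toNat ≤ (t.hexagonSides j).toNat + 2
    omega
  · simp only [f.hexWord_letter, hexagon, List.map_append, Frame.map_letter_run]
  · rw [f.eval_map, f.p_pt, posU_hexagon ht, posV_hexagon ht]
    simp

end Quad

namespace IsOptimal

variable {f : Frame} {ε c₁ c₂ : ℤ} {n t : Quad}

theorem hexagonSides_nonneg (h : IsOptimal ε c₁ c₂ n t) (hl : 28 ≤ 2 * (c₁ + c₂) + ∑ j, n j)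
    (i : Fin 6) : 0 ≤ t.hexagonSides i := by
  obtain ⟨b, hb⟩ := h.balanced.exists_hexagonSides_mem_Icc
  have hi := hb i
  have h₁ := hb 1
  have := h.le_six_mul 0
  simp only [Set.mem_Icc] at hi h₁
  simp only [Quad.hexagonSides, Matrix.cons_val_one, Matrix.cons_val_zero] at h₁
  omega

theorem path_isInfix_hexagon (h : IsOptimal ε c₁ c₂ n t) (h₁ : 0 ≤ c₁) (h₂ : 0 ≤ c₂)
    (ht : ∀ i, 0 ≤ t.hexagonSides i) (hside : ∀ j, 0 ≤ n.sides c₁ c₂ j) :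
    n.path c₁ c₂ <:+: t.hexagon := by
  have l₀ := h.le 0; have l₁ := h.le 1; have l₂ := h.le 2; have l₃ := h.le 3
  have e₀ := h.eq_of_pos 0; have e₁ := h.eq_of_pos 1; have e₂ := h.eq_of_pos 2
  have e₃ := h.eq_of_pos 3
  have p₀ := h.nonneg 0; have p₁ := h.nonneg 1; have p₂ := h.nonneg 2; have p₃ := h.nonneg 3
  have s₀ := hside 0; have s₁ := hside 1; have s₂ := hside 2; have s₃ := hside 3
  have t₀ : 0 ≤ t 2 + t 3 - t 0 := ht 0
  have t₅ : 0 ≤ t 0 + t 1 - t 3 := ht 5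
  obtain ⟨X, hX⟩ := suffix_runs (i := 4) (j := 5) (k := 0) (a' := t 2 + t 3 - t 0) p₀ s₀ s₁
    (by simp only [Quad.sides] at *; omega) l₀ l₁ (by simp only [Quad.sides] at *; omega)
    (by simp only [Quad.sides] at *; omega) (by simp only [Quad.sides] at *; omega)
  obtain ⟨Y, hY⟩ := prefix_runs (i := 1) (j := 2) (k := 3) (c' := t 0 + t 1 - t 3) s₂ s₃
    p₃ l₂ l₃ (by simp only [Quad.sides] at *; omega)
    (by simp only [Quad.sides] at *; omega) (by simp only [Quad.sides] at *; omega)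
    (by simp only [Quad.sides] at *; omega)
  have hhexagon : t.hexagon = (run 4 (t 2 + t 3 - t 0) ++ run 5 (t 0) ++ run 0 (t 1)) ++
      (run 1 (t 2) ++ run 2 (t 3) ++ run 3 (t 0 + t 1 - t 3)) := by
    simp [Quad.hexagon, Quad.hexagonSides]
  refine ⟨X, Y, ?_⟩
  rw [hhexagon, ← hX, ← hY]
  simp [Quad.path]

theorem isHexagonSubpath (h : IsOptimal ε c₁ c₂ n t) (h₁ : 0 ≤ c₁) (h₂ : 0 ≤ c₂)
    (hl : 28 ≤ 2 * (c₁ + c₂) + ∑ j, n j) : IsHexagonSubpath ((n.path c₁ c₂).map f.letter) := by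
  have ht := h.hexagonSides_nonneg hl
  have hinfix := (h.path_isInfix_hexagon h₁ h₂ ht (h.sides_nonneg h₁ h₂ (by omega))).map f.letter
  exact ⟨_, Quad.isAlmostRegularHexagon_hexagon f h.balanced ht,
    hinfix.trans (List.prefix_append _ _).isInfix, hinfix.length_le⟩

end IsOptimal

/-! ### Standard geodesics -/

theorem planeLen_le_len (g : N) : planeLen (p g) ≤ len g := by
  obtain ⟨w, hlength, rfl⟩ := exists_length_eq_len g
  exact hlength ▸ planeLen_p_eval_le w

theorem Frame.add_le_len_pt (f : Frame) {c₁ c₂ : ℤ} (s : ℤ) (h₁ : 0 ≤ c₁) (h₂ : 0 ≤ c₂) :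
    c₁ + c₂ ≤ len (f.pt c₁ c₂ s) := by
  rw [← f.planeLen_pt s h₁ h₂]
  exact_mod_cast planeLen_le_len _

namespace IsOptimal

variable {f : Frame} {c₁ c₂ s : ℤ} {n t : Quad}

theorem eval_path (h : IsOptimal f.eps c₁ c₂ n t) (h₁ : 0 ≤ c₁) (h₂ : 0 ≤ c₂)
    (hl : 34 ≤ c₁ + c₂ + ∑ j, n j) : ∃ S : ℤ, 2 * S = n.area f.eps c₁ c₂ ∧
      eval ((n.path c₁ c₂).map f.letter) = f.pt c₁ c₂ S := by
  have hside := h.sides_nonneg h₁ h₂ (by omega)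
  refine ⟨_, Quad.two_mul_area_path f.eps h.nonneg hside, ?_⟩
  rw [f.eval_map, Quad.posU_path h.nonneg hside, Quad.posV_path h.nonneg hside]

theorem len_eq_of_two_mul_eq (h : IsOptimal f.eps c₁ c₂ n t) (h₁ : 0 ≤ c₁) (h₂ : 0 ≤ c₂)
    (hl : 34 ≤ c₁ + c₂ + ∑ j, n j) (hs : 2 * s = n.area f.eps c₁ c₂) :
    (len (f.pt c₁ c₂ s) : ℤ) = c₁ + c₂ + ∑ j, n j := by
  have := h.area_nonneg h₁ h₂
  have := mul_nonneg h₁ h₂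
  refine le_antisymm (h.len_le h₁ h₂ hl (by omega) hs.le) ?_
  by_contra! hlt
  have := f.add_le_len_pt s h₁ h₂
  obtain ⟨n', t', h', hsum⟩ :=
    exists_isOptimal f.eps_eq_zero_or_one h₁ h₂ (∑ j, n j - 1).toNat
  obtain ⟨j, t'', h'', hgain⟩ := h'.exists_push
  have := Quad.area_push f.eps c₁ c₂ n' j
  have := Quad.sum_push n' j
  have := h.area_le_of_sum_eq h''.nonneg (by omega)
  have := h'.le_area_of_len_le h₁ h₂ (s := s) (by omega)
  omega

theorem isExtremalPath (h : IsOptimal f.eps c₁ c₂ n t) (h₁ : 0 ≤ c₁) (h₂ : 0 ≤ c₂)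
    (hl : 34 ≤ c₁ + c₂ + ∑ j, n j) (s₀ : ℤ) {m : ℕ} (hm : (m : ℤ) = c₁ + c₂ + ∑ j, n j) :
    IsExtremalPath (p (f.pt c₁ c₂ s₀)) m ((n.path c₁ c₂).map f.letter) := by
  obtain ⟨S, hS, heval⟩ := h.eval_path h₁ h₂ hl
  have hlen := h.len_eq_of_two_mul_eq h₁ h₂ hl hS
  refine ⟨?_, ?_, h.isHexagonSubpath h₁ h₂ (by omega)⟩
  · rw [IsGeodesic, heval, List.length_map]
    have := Quad.length_path h.nonneg (h.sides_nonneg h₁ h₂ (by omega))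
    omega
  · rw [heval]
    refine f.isExtremal_pt s₀ (by omega) fun s' hs' => ?_
    have := h.le_area_of_len_le h₁ h₂ (s := s') (by omega)
    omega

theorem exists_isStandardGeodesic (h : IsOptimal f.eps c₁ c₂ n t) (h₁ : 0 ≤ c₁) (h₂ : 0 ≤ c₂)
    (hl : 34 ≤ c₁ + c₂ + ∑ j, n j) (hs : 0 < s)
    (hlen : (len (f.pt c₁ c₂ s) : ℤ) = c₁ + c₂ + ∑ j, n j + 1) :
    ∃ w, IsStandardGeodesic w (f.pt c₁ c₂ s) ∧ Similar 1 w ((n.path c₁ c₂).map f.letter) := by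
  have := h.sum_nonneg
  obtain ⟨j, t', h', -⟩ := h.exists_push
  have := Quad.sum_push n j
  have hlt : n.area f.eps c₁ c₂ < 2 * s := by
    by_contra! hle
    have := mul_nonneg h₁ h₂
    have := h.len_le h₁ h₂ hl (s := s) (by omega) hle
    omega
  have hle := h'.le_area_of_len_le h₁ h₂ (s := s) (by omega)
  obtain ⟨A, B, d, hA, hB, hU, hV, harea, hlength, hT⟩ := Quad.exists_interpolation
    f.eps_eq_zero_or_one h.nonneg (h.sides_nonneg h₁ h₂ (by omega)) h'.nonneg
    (h'.sides_nonneg h₁ h₂ (by omega)) hlt hle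
  have heval : eval ((A ++ d :: B).map f.letter) = f.pt c₁ c₂ s := by
    rw [f.eval_map, hU, hV, harea]
  obtain ⟨m, hm⟩ : ∃ m : ℕ, c₁ + c₂ + ∑ j, n j = m := Int.eq_ofNat_of_zero_le (by omega)
  refine ⟨(A ++ d :: B).map f.letter, ⟨heval, ?_, Or.inr ⟨m, by omega, ?_, ?_⟩⟩, hT.similar f⟩
  · rw [IsGeodesic, heval, List.length_map]
    omega
  · have := f.planeLen_pt s h₁ h₂
    omega
  · exact ⟨_, _, A.map f.letter, B.map f.letter, f.letter d, h.isExtremalPath h₁ h₂ hl s hm.symm,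
      h'.isExtremalPath h₁ h₂ (by omega) s (by push_cast; omega), hA.map _, hB.map _, by simp⟩

end IsOptimal

theorem IsParallelogramSplitting.isStandardGeodesic {c₁ c₂ s i j e k l : ℤ}
    (h : IsParallelogramSplitting c₁ c₂ s i j e k l) (f : Frame) :
    IsStandardGeodesic ((parallelogramPath i j e k l).map f.letter) (f.pt c₁ c₂ s) := by
  have heval : eval ((parallelogramPath i j e k l).map f.letter) = f.pt c₁ c₂ s := by
    rw [f.eval_map, h.posU_path, h.posV_path, h.area_path]
  have := h.i_nonneg; have := h.j_nonneg; have := h.e_nonneg; have := h.k_nonneg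
  have := h.l_nonneg; have := h.e_le_one; have := h.add_add_eq; have := h.add_eq
  have hplane := f.planeLen_pt s (a := c₁) (b := c₂) (by omega) (by omega)
  have hlower := f.add_le_len_pt s (c₁ := c₁) (c₂ := c₂) (by omega) (by omega)
  have hlength := h.length_path
  have hupper := len_eval_le ((parallelogramPath i j e k l).map f.letter)
  rw [heval, List.length_map] at hupper
  refine ⟨heval, ?_, Or.inl ⟨by omega, f.letter 0, f.letter 1, i.toNat, j.toNat, e.toNat, k.toNat,
    l.toNat, ?_, by omega, ?_⟩⟩
  · rw [IsGeodesic, heval, List.length_map]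
    omega
  · rw [← zero_add (1 : Fin 6), ← f.turn_letter]
    exact f.turn_eq_next_or_prev.imp (congrFun · _) (congrFun · _)
  · simp only [parallelogramPath, List.map_append, Frame.map_letter_run]

namespace Frame

/-- The frame with the first two directions exchanged, which turns a sector into itself and the
upper extremals over it into the lower ones. -/
def flip (f : Frame) : Frame := ⟨f.letter 1, !f.pos⟩

theorem flip_letter (f : Frame) (i : Fin 6) : f.flip.letter i = f.letter (1 - i) := by
  obtain ⟨u, pos⟩ := f
  cases u <;> cases pos <;> fin_cases i <;> rfl

theorem flip_Z (f : Frame) : f.flip.Z = f.Z⁻¹ := by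
  obtain ⟨u, pos⟩ := f
  cases pos <;> simp [flip, Z]

theorem flip_pt (f : Frame) (a b s : ℤ) : f.flip.pt a b s = f.pt b a (-s - a * b) := by
  have h : f.flip.pt a b s = f.pt 0 a 0 * f.pt b 0 0 * f.pt 0 0 (-s) := by
    simp [pt, flip_Z, U, V, flip_letter]
  rw [h, f.pt_mul, f.pt_mul]
  congr 1 <;> ring

theorem pt_eq_flip_pt (f : Frame) (a b s : ℤ) : f.pt a b s = f.flip.pt b a (-s - a * b) := by
  rw [f.flip_pt]
  congr 1
  ring

theorem map_flip_letter (f : Frame) (W : List (Fin 6)) :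
    W.map f.flip.letter = (W.map (1 - ·)).map f.letter := by
  rw [List.map_map]
  exact List.map_congr_left fun i _ => f.flip_letter i

variable {c₁ c₂ : ℤ}

theorem nonpos_of_len_pt_eq (f : Frame) {s : ℤ} (h₁ : 0 ≤ c₁) (h₂ : 0 ≤ c₂)
    (h : (len (f.pt c₁ c₂ s) : ℤ) = c₁ + c₂) : s ≤ 0 := by
  obtain ⟨n, t, hn, hsum⟩ := exists_isOptimal f.eps_eq_zero_or_one h₁ h₂ 0
  have hs := hn.le_area_of_len_le h₁ h₂ (s := s) (by omega)
  rw [Quad.eq_zero_of_sum_eq_zero hn.nonneg hsum, Quad.area_zero] at hs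
  omega

theorem len_pt_eq_iff (f : Frame) (s : ℤ) (h₁ : 0 ≤ c₁) (h₂ : 0 ≤ c₂) :
    (len (f.pt c₁ c₂ s) : ℤ) = c₁ + c₂ ↔ -(c₁ * c₂) ≤ s ∧ s ≤ 0 := by
  refine ⟨fun h => ⟨?_, f.nonpos_of_len_pt_eq h₁ h₂ h⟩, fun ⟨hs, hs₀⟩ =>
    le_antisymm (f.len_pt_le_of_nonpos h₁ h₂ hs hs₀) (f.add_le_len_pt s h₁ h₂)⟩
  rw [f.pt_eq_flip_pt, add_comm] at h
  linarith [f.flip.nonpos_of_len_pt_eq h₂ h₁ h]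

end Frame

/-! ### Neighbouring elements over a common sector -/

theorem dist_comm (g h : N) : dist g h = dist h g := by
  have len_inv_le (g : N) : len g⁻¹ ≤ len g := by
    obtain ⟨w, hlength, rfl⟩ := exists_length_eq_len g
    obtain ⟨w', hlength', heval⟩ := exists_eval_eq_inv w
    rw [← heval, ← hlength, ← hlength']
    exact len_eval_le w'
  have hle (g h : N) : dist g h ≤ dist h g := by
    simpa [dist] using len_inv_le (h⁻¹ * g)
  exact (hle g h).antisymm (hle h g)

theorem dist_le_iff_exists_word {g h : N} {k : ℕ} :
    dist g h ≤ k ↔ ∃ r : Word, r.length ≤ k ∧ h = g * eval r := by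
  constructor
  · intro hdist
    obtain ⟨r, hlength, heval⟩ := exists_length_eq_len (g⁻¹ * h)
    exact ⟨r, hlength.le.trans hdist, by rw [heval, mul_inv_cancel_left]⟩
  · rintro ⟨r, hr, rfl⟩
    rw [dist, inv_mul_cancel_left]
    exact (len_eval_le r).trans hr

theorem bounds_of_length_le_two {ε : ℤ} (hε : ε = 0 ∨ ε = 1) {R : List (Fin 6)}
    (hR : R.length ≤ 2) :
    |posU R| ≤ 2 ∧ |posV R| ≤ 2 ∧ |posU R + posV R| ≤ 2 ∧ |area ε R - 1| ≤ 2 := by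
  match R, hR with
  | [], _ => simp
  | [i], _ =>
    simp only [posU_cons, posV_cons, posU_nil, posV_nil, area_cons, area_nil]
    rcases hε with rfl | rfl <;> revert i <;> decide
  | [i, j], _ =>
    simp only [posU_cons, posV_cons, posU_nil, posV_nil, area_cons, area_nil]
    rcases hε with rfl | rfl <;> revert i j <;> decide

theorem Frame.bounds_of_dist_pt_le_two (f : Frame) {c₁ c₂ s c₁' c₂' s' : ℤ}
    (h : dist (f.pt c₁ c₂ s) (f.pt c₁' c₂' s') ≤ 2) :
    |c₁' - c₁| ≤ 2 ∧ |c₂' - c₂| ≤ 2 ∧ |c₁' - c₁ + (c₂' - c₂)| ≤ 2 ∧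
      |s' - s + c₂ * (c₁' - c₁) - 1| ≤ 2 := by
  obtain ⟨r, hr, heq⟩ := dist_le_iff_exists_word.1 h
  obtain ⟨R, rfl⟩ := f.exists_map_letter_eq r
  rw [f.eval_map, f.pt_mul] at heq
  obtain ⟨rfl, rfl, rfl⟩ := f.pt_injective heq
  rw [List.length_map] at hr
  convert bounds_of_length_le_two f.eps_eq_zero_or_one hr using 4 <;> ring_nf

/-- Two elements of the same length and at distance at most `2`, given by their coordinates in the
sector of a frame. -/
structure IsNeighbourPair (f : Frame) (L : ℕ) (c₁ c₂ s c₁' c₂' s' : ℤ) : Prop where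
  nonneg₁ : 0 ≤ c₁
  nonneg₂ : 0 ≤ c₂
  nonneg₁' : 0 ≤ c₁'
  nonneg₂' : 0 ≤ c₂'
  len_eq : len (f.pt c₁ c₂ s) = L
  len_eq' : len (f.pt c₁' c₂' s') = L
  dist_le : dist (f.pt c₁ c₂ s) (f.pt c₁' c₂' s') ≤ 2

namespace IsNeighbourPair

variable {f : Frame} {L : ℕ} {c₁ c₂ s c₁' c₂' s' : ℤ}

theorem symm (h : IsNeighbourPair f L c₁ c₂ s c₁' c₂' s') :
    IsNeighbourPair f L c₁' c₂' s' c₁ c₂ s :=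
  ⟨h.nonneg₁', h.nonneg₂', h.nonneg₁, h.nonneg₂, h.len_eq', h.len_eq, dist_comm _ _ ▸ h.dist_le⟩

theorem flip (h : IsNeighbourPair f L c₁ c₂ s c₁' c₂' s') :
    IsNeighbourPair f.flip L c₂ c₁ (-s - c₁ * c₂) c₂' c₁' (-s' - c₁' * c₂') := by
  refine ⟨h.nonneg₂, h.nonneg₁, h.nonneg₂', h.nonneg₁', ?_, ?_, ?_⟩ <;>
    simp only [← f.pt_eq_flip_pt]
  exacts [h.len_eq, h.len_eq', h.dist_le]

theorem bounds (h : IsNeighbourPair f L c₁ c₂ s c₁' c₂' s') :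
    |c₁' - c₁| ≤ 2 ∧ |c₂' - c₂| ≤ 2 ∧ |c₁' - c₁ + (c₂' - c₂)| ≤ 2 ∧
      |s' - s + c₂ * (c₁' - c₁) - 1| ≤ 2 :=
  f.bounds_of_dist_pt_le_two h.dist_le

end IsNeighbourPair

section

variable {f : Frame} {c₁ c₂ s c₁' c₂' s' : ℤ} {n n' : Quad}

theorem HaveCloseGeodesics.of_flip
    (h : HaveCloseGeodesics (f.flip.pt c₂ c₁ (-s - c₁ * c₂))
      (f.flip.pt c₂' c₁' (-s' - c₁' * c₂'))) :
    HaveCloseGeodesics (f.pt c₁ c₂ s) (f.pt c₁' c₂' s') := by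
  rwa [← f.pt_eq_flip_pt, ← f.pt_eq_flip_pt] at h

theorem Quad.tracks_path (hn : ∀ j, 0 ≤ n j) (ht : ∀ j, 0 ≤ n.sides c₁ c₂ j)
    (hn' : ∀ j, 0 ≤ n' j) (ht' : ∀ j, 0 ≤ n'.sides c₁' c₂' j) (hc₁ : |c₁' - c₁| ≤ 2)
    (hc₂ : |c₂' - c₂| ≤ 2) (hc : |c₁' - c₁ + (c₂' - c₂)| ≤ 2)
    (hl : |c₁' + c₂' + ∑ j, n' j - (c₁ + c₂ + ∑ j, n j)| ≤ 1)
    (hb : |n' 0 - n 0| ≤ 8 ∧ |n' 1 - n 1| ≤ 6 ∧ |n' 2 - n 2| ≤ 6 ∧ |n' 3 - n 3| ≤ 8) :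
    Tracks 18 (n.path c₁ c₂) (n'.path c₁' c₂') := by
  simp only [abs_le, Fin.sum_univ_four] at hc₁ hc₂ hc hl hb
  refine ((((((Tracks.nil (by omega)).append_run 4 (hn 0) (hn' 0) ?_).append_run 5 (ht 0) (ht' 0)
    ?_).append_run 0 (ht 1) (ht' 1) ?_).append_run 1 (ht 2) (ht' 2) ?_).append_run 2 (ht 3) (ht' 3)
    ?_).append_run 3 (hn 3) (hn' 3) ?_
  all_goals
    simp only [Near, abs_le, List.nil_append, posU_append, posV_append, List.length_append,
      Nat.cast_add, posU_run, posV_run, length_run, dU, dV, hn, hn', ht, ht']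
    try simp only [sides]
    omega

theorem Quad.path_zero (c₁ c₂ : ℤ) : (0 : Quad).path c₁ c₂ = run 0 c₁ ++ run 1 c₂ := by
  simp [path, sides]

theorem exists_isOptimal_similar_path {L : ℕ} (h₁ : 0 ≤ c₁) (h₂ : 0 ≤ c₂) (hs : 0 < s)
    (hlen : len (f.pt c₁ c₂ s) = L) (hL : 50 ≤ L) :
    ∃ n t w, IsOptimal f.eps c₁ c₂ n t ∧ c₁ + c₂ + ∑ j, n j + 1 = L ∧
      n.area f.eps c₁ c₂ < 2 * s ∧ IsStandardGeodesic w (f.pt c₁ c₂ s) ∧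
      Similar 1 w ((n.path c₁ c₂).map f.letter) := by
  have hge := f.add_le_len_pt s h₁ h₂
  have hne : (len (f.pt c₁ c₂ s) : ℤ) ≠ c₁ + c₂ := fun heq =>
    hs.not_ge ((f.len_pt_eq_iff s h₁ h₂).1 heq).2
  obtain ⟨n, t, hn, hsum⟩ := exists_isOptimal f.eps_eq_zero_or_one h₁ h₂
    ((L : ℤ) - 1 - c₁ - c₂).toNat
  have harea : n.area f.eps c₁ c₂ < 2 * s := by
    by_contra! hle
    have := mul_nonneg h₁ h₂
    have := hn.len_le h₁ h₂ (by omega) (by omega) hle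
    omega
  obtain ⟨w, hw, hsim⟩ := hn.exists_isStandardGeodesic h₁ h₂ (by omega) hs (by omega)
  exact ⟨n, t, w, hn, by omega, harea, hw, hsim⟩

end

namespace IsNeighbourPair

variable {f : Frame} {L : ℕ} {c₁ c₂ s c₁' c₂' s' : ℤ}

theorem haveCloseGeodesics_of_pos (h : IsNeighbourPair f L c₁ c₂ s c₁' c₂' s') (hL : 50 ≤ L)
    (hs : 0 < s) (hs' : 0 < s') : HaveCloseGeodesics (f.pt c₁ c₂ s) (f.pt c₁' c₂' s') := by
  obtain ⟨h₁, h₂, h₁', h₂', hlen, hlen', -⟩ := id h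
  obtain ⟨hc₁, hc₂, hc, -⟩ := h.bounds
  obtain ⟨n, t, w, hn, hsum, -, hw, hsim⟩ := exists_isOptimal_similar_path h₁ h₂ hs hlen hL
  obtain ⟨n', t', w', hn', hsum', -, hw', hsim'⟩ :=
    exists_isOptimal_similar_path h₁' h₂' hs' hlen' hL
  have hb : |n' 0 - n 0| ≤ 8 ∧ |n' 1 - n 1| ≤ 6 ∧ |n' 2 - n 2| ≤ 6 ∧ |n' 3 - n 3| ≤ 8 := by
    have := abs_le.1 hc
    rcases le_total (∑ j, n j) (∑ j, n' j) with hle | hle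
    · exact hn.sub_bounds_of_sum_le hn' h₁ h₂ hle (by omega) hc₁ hc₂
    · simp only [abs_sub_comm (n' _)]
      exact hn'.sub_bounds_of_sum_le hn h₁' h₂' hle (by omega) (abs_sub_comm c₁ c₁' ▸ hc₁)
        (abs_sub_comm c₂ c₂' ▸ hc₂)
  have htracks := Quad.tracks_path hn.nonneg (hn.sides_nonneg h₁ h₂ (by omega)) hn'.nonneg
    (hn'.sides_nonneg h₁' h₂' (by omega)) hc₁ hc₂ hc (abs_le.2 ⟨by omega, by omega⟩) hb
  exact ⟨w, w', hw, hw',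
    ((hsim.trans (htracks.similar (K := 18) f)).trans hsim'.symm).mono (by norm_num)⟩

end IsNeighbourPair

theorem IsParallelogramSplitting.tracks_runs {c₁ c₂ s i j e k l : ℤ}
    (h : IsParallelogramSplitting c₁ c₂ s i j e k l) (hthin : l ≤ 2 ∨ c₂ ≤ 2) :
    Tracks 3 (parallelogramPath i j e k l) (run 0 c₁ ++ run 1 c₂) := by
  obtain ⟨hi, hj, he, he₁, hk, hl, rfl, rfl, -⟩ := h
  have start := Tracks.nil (K := 3) (by omega)
  have hiel : 0 ≤ i + e + l := by omega
  have hie : 0 ≤ i + e := by omega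
  have hjk : 0 ≤ j + k := by omega
  rcases hthin with hthin | hthin
  · have := ((((start.append_run 0 hi hiel ?_).append_run 1 hj hj ?_).append_run 0 he le_rfl
      ?_).append_run 1 hk hk ?_).append_run 0 hl le_rfl ?_
    · simpa [parallelogramPath, run_add 1 hj hk] using this
    all_goals
      simp only [Near, abs_le, List.nil_append, posU_append, posV_append, List.length_append,
        Nat.cast_add, posU_run, posV_run, length_run, dU, dV, hi, hj, he, hk, hl, hiel, le_refl]
      omega
  · have := (((((start.append_run 0 hi hi ?_).append_run 1 hj le_rfl ?_).append_run 0 he he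
      ?_).append_run 1 hk le_rfl ?_).append_run 0 hl hl ?_).append_run 1 le_rfl hjk ?_
    · simpa [parallelogramPath, run_add 0 hie hl, run_add 0 hi he] using this
    all_goals
      simp only [Near, abs_le, List.nil_append, posU_append, posV_append, List.length_append,
        Nat.cast_add, posU_run, posV_run, length_run, dU, dV, hi, hj, he, hk, hl, hjk, le_refl]
      omega

namespace IsNeighbourPair

variable {f : Frame} {L : ℕ} {c₁ c₂ s c₁' c₂' s' : ℤ}

theorem haveCloseGeodesics_of_nonpos_of_pos (h : IsNeighbourPair f L c₁ c₂ s c₁' c₂' s')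
    (hL : 50 ≤ L) (hs : -(c₁ * c₂) ≤ s) (hs₀ : s ≤ 0) (hs' : 0 < s') :
    HaveCloseGeodesics (f.pt c₁ c₂ s) (f.pt c₁' c₂' s') := by
  obtain ⟨h₁, h₂, h₁', h₂', hlen, hlen', -⟩ := id h
  obtain ⟨hc₁, hc₂, hc, hss⟩ := h.bounds
  obtain ⟨n', t', w', hn', hsum', -, hw', hsim'⟩ :=
    exists_isOptimal_similar_path h₁' h₂' hs' hlen' hL
  have hlen₀ := (f.len_pt_eq_iff s h₁ h₂).2 ⟨hs, hs₀⟩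
  obtain ⟨i, j, e, k, l, hpar⟩ := exists_isParallelogramSplitting h₁ h₂ hs hs₀
  have hthin : l ≤ 2 ∨ c₂ ≤ 2 := by
    by_contra! hthick
    have harea := hpar.area_eq
    have := mul_nonneg hpar.e_nonneg hpar.j_nonneg
    rw [abs_le] at hc₁ hss
    nlinarith
  have hstraight := hpar.tracks_runs hthin
  rw [← Quad.path_zero] at hstraight
  have hhexagon := Quad.tracks_path (n := 0) (fun _ => le_rfl) (c₁ := c₁) (c₂ := c₂)
    (fun j => by fin_cases j <;> simp [Quad.sides, h₁, h₂]) hn'.nonneg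
    (hn'.sides_nonneg h₁' h₂' (by omega)) hc₁ hc₂ hc (by simp [abs_le]; omega) (by
      have := hn'.nonneg 0; have := hn'.nonneg 1; have := hn'.nonneg 2; have := hn'.nonneg 3
      simp only [abs_le, Fin.sum_univ_four, Pi.zero_apply] at *
      omega)
  exact ⟨_, w', hpar.isStandardGeodesic f, hw', (((hstraight.similar (K := 3) f).trans
    (hhexagon.similar (K := 18) f)).trans hsim'.symm).mono (by norm_num)⟩

end IsNeighbourPair

theorem IsOptimal.sixteen_le_area {f : Frame} {c₁ c₂ : ℤ} {n t : Quad}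
    (h : IsOptimal f.eps c₁ c₂ n t) (h₁ : 0 ≤ c₁) (h₂ : 0 ≤ c₂) (hn : 1 ≤ ∑ j, n j)
    (hl : 49 ≤ c₁ + c₂ + ∑ j, n j) : 16 ≤ n.area f.eps c₁ c₂ := by
  obtain ⟨m, u, hm, hsum⟩ :=
    exists_isOptimal f.eps_eq_zero_or_one h₁ h₂ (∑ j, n j - 1).toNat
  obtain ⟨j, u', hm', hgain⟩ := hm.exists_push
  have := Quad.area_push f.eps c₁ c₂ m j
  have := Quad.sum_push m j
  have := h.area_le_of_sum_eq hm'.nonneg (by omega)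
  have := hm.area_nonneg h₁ h₂
  omega

theorem tracks_runs_comm {a b a' b' : ℤ} (ha : 0 ≤ a) (hb : 0 ≤ b) (ha' : 0 ≤ a') (hb' : 0 ≤ b')
    (haa : |a' - a| ≤ 2) (hbb : |b' - b| ≤ 2) (hab : |a' - a + (b' - b)| ≤ 2)
    (hthin : a ≤ 1 ∨ b' ≤ 1) : Tracks 18 (run 0 a ++ run 1 b) (run 1 b' ++ run 0 a') := by
  have start := Tracks.nil (K := 18) (by omega)
  simp only [abs_le] at haa hbb hab
  rcases hthin with hthin | hthin
  · have := ((start.append_run 0 ha le_rfl ?_).append_run 1 hb hb' ?_).append_run 0 le_rfl ha' ?_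
    · simpa using this
    all_goals
      simp only [Near, abs_le, List.nil_append, posU_append, posV_append, List.length_append,
        Nat.cast_add, posU_run, posV_run, length_run, dU, dV, ha, hb, ha', hb', le_refl]
      omega
  · have := ((start.append_run 1 le_rfl hb' ?_).append_run 0 ha ha' ?_).append_run 1 hb le_rfl ?_
    · simpa using this
    all_goals
      simp only [Near, abs_le, List.nil_append, posU_append, posV_append, List.length_append,
        Nat.cast_add, posU_run, posV_run, length_run, dU, dV, ha, hb, ha', hb', le_refl]
      omega

namespace IsNeighbourPair

variable {f : Frame} {L : ℕ} {c₁ c₂ s c₁' c₂' s' : ℤ}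

/-- Beyond both ends of the interval of area `c₁ * c₂` that the parallelogram covers: this is only
possible when the parallelogram is thin. -/
theorem haveCloseGeodesics_of_pos_of_lt (h : IsNeighbourPair f L c₁ c₂ s c₁' c₂' s') (hL : 50 ≤ L)
    (hs : 0 < s) (hs' : s' < -(c₁' * c₂')) :
    HaveCloseGeodesics (f.pt c₁ c₂ s) (f.pt c₁' c₂' s') := by
  obtain ⟨h₁, h₂, h₁', h₂', hlen, -⟩ := id h
  obtain ⟨hc₁, hc₂, hc, -⟩ := h.bounds
  have hss := h.flip.bounds.2.2.2
  obtain ⟨n, t, w, hn, hsum, harea, hw, hsim⟩ := exists_isOptimal_similar_path h₁ h₂ hs hlen hL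
  obtain ⟨n', t', w', hn', hsum', harea', hw', hsim'⟩ :=
    exists_isOptimal_similar_path h₂' h₁' (by omega) h.flip.len_eq' hL
  have hwidth : s + (-s' - c₁' * c₂') + c₁ * c₂' ≤ 3 := by linarith [(abs_le.1 hss).2]
  have := mul_nonneg h₁ h₂'
  have hn₀ := hn.sum_nonneg
  have hn₀' := hn'.sum_nonneg
  have hzero : n = 0 := by
    refine Quad.eq_zero_of_sum_eq_zero hn.nonneg (hn₀.antisymm' ?_)
    by_contra! hpos
    have := hn.sixteen_le_area h₁ h₂ hpos (by omega)
    omega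
  have hzero' : n' = 0 := by
    refine Quad.eq_zero_of_sum_eq_zero hn'.nonneg (hn₀'.antisymm' ?_)
    by_contra! hpos
    have := hn'.sixteen_le_area h₂' h₁' hpos (by omega)
    omega
  have hthin : c₁ ≤ 1 ∨ c₂' ≤ 1 := by
    by_contra! hthick
    nlinarith
  have htracks := tracks_runs_comm h₁ h₂ h₁' h₂' hc₁ hc₂ hc hthin
  have hswap : (run 0 c₂' ++ run 1 c₁').map (1 - ·) = run 1 c₂' ++ run 0 c₁' := by simp [run]
  rw [hzero, Quad.path_zero] at hsim
  rw [hzero', Quad.path_zero, f.map_flip_letter, hswap] at hsim'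
  rw [← f.pt_eq_flip_pt] at hw'
  exact ⟨w, w', hw, hw',
    ((hsim.trans (htracks.similar (K := 18) f)).trans hsim'.symm).mono (by norm_num)⟩

end IsNeighbourPair

namespace IsParallelogramSplitting

variable {c₁ c₂ s i j e k l c₁' c₂' s' i' j' e' k' l' : ℤ}

theorem tracks_straight (h : IsParallelogramSplitting c₁ c₂ s i j e k l) :
    Tracks 1 (parallelogramPath i j e k l) (run 0 i ++ run 1 c₂ ++ run 0 (e + l)) := by
  obtain ⟨hi, hj, he, he₁, hk, hl, -, rfl, -⟩ := h
  have hel : 0 ≤ e + l := by omega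
  have := (((((Tracks.nil (K := 1) (by omega)).append_run 0 hi hi ?_).append_run 1 hj hj
    ?_).append_run 0 he le_rfl ?_).append_run 1 hk hk ?_).append_run 0 hl hel ?_
  · simpa [parallelogramPath, run_add 1 hj hk] using this
  all_goals
    simp only [Near, abs_le, List.nil_append, posU_append, posV_append, List.length_append,
      Nat.cast_add, posU_run, posV_run, length_run, dU, dV, hi, hj, he, hk, hl, hel, le_refl]
    omega

theorem mul_bounds (h : IsParallelogramSplitting c₁ c₂ s i j e k l) : 0 ≤ e * j ∧ e * j ≤ c₂ := by
  have := mul_le_mul_of_nonneg_right h.e_le_one h.j_nonneg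
  have := h.add_eq
  have := h.k_nonneg
  exact ⟨mul_nonneg h.e_nonneg h.j_nonneg, by omega⟩

theorem abs_sub_le_five (h : IsParallelogramSplitting c₁ c₂ s i j e k l)
    (h' : IsParallelogramSplitting c₁' c₂' s' i' j' e' k' l') (hc₁ : |c₁' - c₁| ≤ 2)
    (hc₂ : |c₂' - c₂| ≤ 2) (hss : |s' - s + c₂ * (c₁' - c₁) - 1| ≤ 2) (hle : c₁ ≤ c₂)
    (hL : 50 ≤ c₁ + c₂) : |l' - l| ≤ 5 := by
  have key : (l' - l) * c₂ = c₂ * (c₁' - c₁) - (s' - s + c₂ * (c₁' - c₁)) + e * j - e' * j' -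
      l' * (c₂' - c₂) := by linear_combination h'.area_eq - h.area_eq
  obtain ⟨hej, hej'⟩ := h.mul_bounds
  obtain ⟨hej₀, hej₀'⟩ := h'.mul_bounds
  have hl' := h'.l_nonneg
  have := h'.add_add_eq
  have := h'.i_nonneg
  have := h'.e_nonneg
  rw [abs_le] at *
  constructor <;> nlinarith

end IsParallelogramSplitting

theorem tracks_three_runs {a b c a' b' c' : ℤ} (ha : 0 ≤ a) (hb : 0 ≤ b) (hc : 0 ≤ c) (ha' : 0 ≤ a')
    (hb' : 0 ≤ b') (hc' : 0 ≤ c') (haa : |a' - a| ≤ 8) (hbb : |b' - b| ≤ 2) (hcc : |c' - c| ≤ 8) :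
    Tracks 18 (run 0 a ++ run 1 b ++ run 0 c) (run 0 a' ++ run 1 b' ++ run 0 c') := by
  simp only [abs_le] at haa hbb hcc
  refine (((Tracks.nil (by omega)).append_run 0 ha ha' ?_).append_run 1 hb hb' ?_).append_run 0 hc
    hc' ?_
  all_goals
    simp only [Near, abs_le, List.nil_append, posU_append, posV_append, List.length_append,
      Nat.cast_add, posU_run, posV_run, length_run, dU, dV, ha, hb, hc, ha', hb', hc']
    omega

namespace IsNeighbourPair

variable {f : Frame} {L : ℕ} {c₁ c₂ s c₁' c₂' s' : ℤ}

theorem haveCloseGeodesics_of_nonpos_of_le (h : IsNeighbourPair f L c₁ c₂ s c₁' c₂' s')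
    (hL : 50 ≤ L) (hs : -(c₁ * c₂) ≤ s) (hs₀ : s ≤ 0) (hs' : -(c₁' * c₂') ≤ s') (hs₀' : s' ≤ 0)
    (hle : c₁ ≤ c₂) : HaveCloseGeodesics (f.pt c₁ c₂ s) (f.pt c₁' c₂' s') := by
  obtain ⟨h₁, h₂, h₁', h₂', hlen, -⟩ := id h
  obtain ⟨hc₁, hc₂, -, hss⟩ := h.bounds
  have hlen₀ := (f.len_pt_eq_iff s h₁ h₂).2 ⟨hs, hs₀⟩
  obtain ⟨i, j, e, k, l, hpar⟩ := exists_isParallelogramSplitting h₁ h₂ hs hs₀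
  obtain ⟨i', j', e', k', l', hpar'⟩ := exists_isParallelogramSplitting h₁' h₂' hs' hs₀'
  have hll := hpar.abs_sub_le_five hpar' hc₁ hc₂ hss hle (by omega)
  obtain ⟨hi, -, he, he₁, -, hl, hsum, -, -⟩ := id hpar
  obtain ⟨hi', -, he', he₁', -, hl', hsum', -, -⟩ := id hpar'
  have htracks := tracks_three_runs hi h₂ (add_nonneg he hl) hi' h₂' (add_nonneg he' hl')
    (by rw [abs_le] at *; omega) hc₂ (by rw [abs_le] at *; omega)
  exact ⟨_, _, hpar.isStandardGeodesic f, hpar'.isStandardGeodesic f,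
    (((hpar.tracks_straight.similar (K := 1) f).trans (htracks.similar (K := 18) f)).trans
      (hpar'.tracks_straight.similar (K := 1) f).symm).mono (by norm_num)⟩

theorem haveCloseGeodesics_of_nonpos (h : IsNeighbourPair f L c₁ c₂ s c₁' c₂' s')
    (hL : 50 ≤ L) (hs : -(c₁ * c₂) ≤ s) (hs₀ : s ≤ 0) (hs' : -(c₁' * c₂') ≤ s') (hs₀' : s' ≤ 0) :
    HaveCloseGeodesics (f.pt c₁ c₂ s) (f.pt c₁' c₂' s') := by
  rcases le_total c₁ c₂ with hle | hle
  · exact h.haveCloseGeodesics_of_nonpos_of_le hL hs hs₀ hs' hs₀' hle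
  · exact .of_flip <| h.flip.haveCloseGeodesics_of_nonpos_of_le hL (by linarith) (by linarith)
      (by linarith) (by linarith) hle

theorem haveCloseGeodesics (h : IsNeighbourPair f L c₁ c₂ s c₁' c₂' s') (hL : 50 ≤ L) :
    HaveCloseGeodesics (f.pt c₁ c₂ s) (f.pt c₁' c₂' s') := by
  have hcases (c₁ c₂ s : ℤ) : 0 < s ∨ (-(c₁ * c₂) ≤ s ∧ s ≤ 0) ∨ s < -(c₁ * c₂) := by omega
  rcases hcases c₁ c₂ s with hs | ⟨hs, hs₀⟩ | hs <;>
    rcases hcases c₁' c₂' s' with hs' | ⟨hs', hs₀'⟩ | hs'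
  · exact h.haveCloseGeodesics_of_pos hL hs hs'
  · exact (h.symm.haveCloseGeodesics_of_nonpos_of_pos hL hs' hs₀' hs).symm
  · exact h.haveCloseGeodesics_of_pos_of_lt hL hs hs'
  · exact h.haveCloseGeodesics_of_nonpos_of_pos hL hs hs₀ hs'
  · exact h.haveCloseGeodesics_of_nonpos hL hs hs₀ hs' hs₀'
  · exact .of_flip <| h.flip.haveCloseGeodesics_of_nonpos_of_pos hL (by linarith) (by linarith)
      (by linarith)
  · exact (h.symm.haveCloseGeodesics_of_pos_of_lt hL hs' hs).symm
  · exact .of_flip <| (h.flip.symm.haveCloseGeodesics_of_nonpos_of_pos hL (by linarith)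
      (by linarith) (by linarith)).symm
  · exact .of_flip <| h.flip.haveCloseGeodesics_of_pos hL (by linarith) (by linarith)

end IsNeighbourPair

/-! ### Elements near an axis -/

namespace Frame

/-- The elements over the sector of the plane between the first two directions of the frame. -/
def sector (f : Frame) : Set N := {g | ∃ a b s : ℤ, 0 ≤ a ∧ 0 ≤ b ∧ g = f.pt a b s}

/-- The frame with the opposite first direction. -/
def opp (f : Frame) : Frame := ⟨f.letter 3, f.pos⟩

/-- The frame with the opposite sense of rotation. -/
def mirror (f : Frame) : Frame := ⟨f.u, !f.pos⟩

/-- The frame whose second direction is the first direction of `f`. -/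
def lower (f : Frame) : Frame := ⟨f.letter 5, f.pos⟩

variable (f : Frame)

theorem opp_letter (i : Fin 6) : f.opp.letter i = f.letter (i + 3) := by
  obtain ⟨u, pos⟩ := f
  cases u <;> cases pos <;> fin_cases i <;> rfl

theorem lower_letter (i : Fin 6) : f.lower.letter i = f.letter (i + 5) := by
  obtain ⟨u, pos⟩ := f
  cases u <;> cases pos <;> fin_cases i <;> rfl

theorem lower_eps : f.lower.eps = 1 - f.eps := by
  obtain ⟨u, pos⟩ := f
  cases u <;> cases pos <;> rfl

theorem opp_pt (c s : ℤ) : f.opp.pt c 0 s = f.pt (-c) 0 s := by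
  have hU : f.opp.U = f.U⁻¹ := by
    rw [U, opp_letter, zero_add, f.val_letter 3]
    simp [pt, dU, dV, dS]
  have hZ : f.opp.Z = f.Z := rfl
  simp only [pt, hU, hZ, inv_zpow', zpow_zero]

theorem mirror_pt (c s : ℤ) : f.mirror.pt c 0 s = f.pt c 0 (-s) := by
  obtain ⟨u, pos⟩ := f
  cases pos <;> simp [pt, mirror, Z, U, letter]

theorem lower_pt (c s : ℤ) : f.lower.pt 0 c s = f.pt c 0 s := by
  have hV : f.lower.V = f.U := by rw [V, lower_letter]; rfl
  have hZ : f.lower.Z = f.Z := rfl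
  simp only [pt, hV, hZ, zpow_zero, one_mul, mul_one]

theorem pt_mul_val_letter (a b s : ℤ) (i : Fin 6) :
    f.pt a b s * (f.letter i).val = f.pt (a + dU i) (b + dV i) (s + dS f.eps i - b * dU i) := by
  rw [f.val_letter, f.pt_mul]

theorem pt_mul_val_letter_zero (c s : ℤ) :
    f.pt c 0 s * (f.letter 0).val = f.pt (c + 1) 0 s := by
  simp [pt_mul_val_letter, dU, dV, dS]

theorem pt_mul_val_letter_mem_sector {a b : ℤ} (s : ℤ) {i : Fin 6} (ha : 0 ≤ a + dU i)
    (hb : 0 ≤ b + dV i) : f.pt a b s * (f.letter i).val ∈ f.sector :=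
  ⟨_, _, _, ha, hb, f.pt_mul_val_letter a b s i⟩

variable {f} {L : ℕ}

theorem haveCloseGeodesics_of_mem_sector {g g' : N} (h : g ∈ f.sector) (h' : g' ∈ f.sector)
    (hlen : len g = L) (hlen' : len g' = L) (hL : 50 ≤ L) (hdist : dist g g' ≤ 2) :
    HaveCloseGeodesics g g' := by
  obtain ⟨a, b, s, ha, hb, rfl⟩ := h
  obtain ⟨a', b', s', ha', hb', rfl⟩ := h'
  exact IsNeighbourPair.haveCloseGeodesics ⟨ha, hb, ha', hb', hlen, hlen', hdist⟩ hL

variable {c₁ c₂ s : ℤ}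

theorem exists_isOptimal_of_len_pt_le (h₁ : 0 ≤ c₁) (h₂ : 0 ≤ c₂)
    (hlen : len (f.pt c₁ c₂ s) ≤ L) :
    ∃ n t, IsOptimal f.eps c₁ c₂ n t ∧ c₁ + c₂ + ∑ j, n j = L ∧ 2 * s ≤ n.area f.eps c₁ c₂ := by
  have := f.add_le_len_pt s h₁ h₂
  obtain ⟨n, t, hn, hsum⟩ := exists_isOptimal f.eps_eq_zero_or_one h₁ h₂ (L - (c₁ + c₂)).toNat
  exact ⟨n, t, hn, by omega, hn.le_area_of_len_le h₁ h₂ (by omega)⟩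

theorem len_pt_le_of_le_area {n : Quad} (h₁ : 0 ≤ c₁) (h₂ : 0 ≤ c₂) (hn : ∀ j, 0 ≤ n j)
    (hsum : c₁ + c₂ + ∑ j, n j ≤ L) (hL : 34 ≤ L) (hs : -(c₁ * c₂) ≤ s)
    (hS : 2 * s ≤ n.area f.eps c₁ c₂) : len (f.pt c₁ c₂ s) ≤ L := by
  have hpos : 0 ≤ ∑ j, n j := Finset.sum_nonneg fun j _ => hn j
  obtain ⟨m, u, hm, hmsum⟩ := exists_isOptimal f.eps_eq_zero_or_one h₁ h₂ (L - (c₁ + c₂)).toNat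
  have hmono := hm.area_mono h₁ h₂ hn (by omega)
  have hlen := hm.len_le h₁ h₂ (by omega) hs (hS.trans hmono)
  omega

end Frame

namespace IsOptimal

variable {ε c : ℤ} {n t : Quad}

theorem exists_area_le_add_one_zero (h : IsOptimal ε c 1 n t) (hc : 0 ≤ c)
    (hl : 12 ≤ 2 * c + ∑ j, n j) :
    ∃ n' : Quad, (∀ j, 0 ≤ n' j) ∧ ∑ j, n' j = ∑ j, n j ∧
      n.area ε c 1 ≤ n'.area ε (c + 1) 0 := by
  by_cases hpos : 1 ≤ n 2 ∧ 1 ≤ n 3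
  · refine ⟨![n 0 + 1, n 1 + 1, n 2 - 1, n 3 - 1], fun j => ?_, ?_, ?_⟩
    · have := h.nonneg 0; have := h.nonneg 1
      fin_cases j <;> simp <;> omega
    · simp [Fin.sum_univ_four]; ring
    · simp [Quad.area]; linarith
  · have hle : n 2 ≤ n 1 := by
      have := h.nonneg 1; have := h.nonneg 2; have := h.nonneg 3
      have := h.eq_of_pos 2; have := h.le_six_mul 2
      simp only [Quad.sides] at *
      omega
    refine ⟨n, h.nonneg, rfl, ?_⟩
    simp only [Quad.area]
    linarith

theorem one_le_one_and_lt_or_eq_zero (h : IsOptimal ε c 0 n t) (hc : 0 ≤ c)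
    (hl : 12 < 2 * c + ∑ j, n j) (harea : 0 < n.area ε c 0) :
    1 ≤ n 1 ∧ (n 3 < n 2 ∨ n 2 = 0 ∧ n 3 = 0) := by
  have p₀ := h.nonneg 0; have p₁ := h.nonneg 1; have p₂ := h.nonneg 2; have p₃ := h.nonneg 3
  have hor : n 3 < n 2 ∨ n 2 = 0 ∧ n 3 = 0 := by
    have := h.eq_of_pos 3; have := h.le_six_mul 3
    simp only [Quad.sides] at *
    omega
  refine ⟨?_, hor⟩
  by_contra! hlt
  have t₀ := h.sides_nonneg hc le_rfl (by omega) 0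
  have t₂ := h.sides_nonneg hc le_rfl (by omega) 2
  simp only [Quad.sides] at t₀ t₂
  have hzero : n = 0 := by
    ext j
    fin_cases j <;> simp <;> omega
  rw [hzero, Quad.area_zero] at harea
  exact harea.false

theorem exists_area_sub_le_one (h : IsOptimal ε c 0 n t) (hc : 0 ≤ c)
    (hl : 12 < 2 * c + ∑ j, n j) (harea : 0 < n.area ε c 0) :
    ∃ n' : Quad, (∀ j, 0 ≤ n' j) ∧ ∑ j, n' j < ∑ j, n j ∧
      n.area ε c 0 - 2 * c ≤ n'.area (1 - ε) 1 c := by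
  have p₀ := h.nonneg 0; have p₃ := h.nonneg 3
  obtain ⟨hone, hlt | ⟨h₂, h₃⟩⟩ := h.one_le_one_and_lt_or_eq_zero hc hl harea
  · refine ⟨![n 3, n 0 + n 3, n 1 - 1, n 2 - n 3 - 1], fun j => ?_, ?_, ?_⟩
    · fin_cases j <;> simp <;> omega
    · simp [Fin.sum_univ_four]; omega
    · simp [Quad.area]; linarith
  · refine ⟨![0, n 0, n 1 - 1, 0], fun j => ?_, ?_, ?_⟩
    · fin_cases j <;> simp <;> omega
    · simp [Fin.sum_univ_four]; omega
    · simp only [Quad.area, h₂, h₃]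
      rcases h.balanced.eq_zero_or_one with rfl | rfl <;> simp <;> linarith

theorem exists_area_sub_le_one_sub (h : IsOptimal ε c 0 n t) (hc : 0 ≤ c)
    (hl : 12 < 2 * c + ∑ j, n j) (harea : 0 < n.area ε c 0) :
    ∃ n' : Quad, (∀ j, 0 ≤ n' j) ∧ ∑ j, n' j ≤ ∑ j, n j ∧
      n.area ε c 0 + 2 * ε - 2 * c ≤ n'.area (1 - ε) 1 (c - 1) := by
  have p₀ := h.nonneg 0; have p₃ := h.nonneg 3
  obtain ⟨hone, hlt | ⟨h₂, h₃⟩⟩ := h.one_le_one_and_lt_or_eq_zero hc hl harea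
  · refine ⟨![n 3 + 1, n 0 + n 3 + 1, n 1 - 1, n 2 - n 3 - 1], fun j => ?_, ?_, ?_⟩
    · fin_cases j <;> simp <;> omega
    · simp [Fin.sum_univ_four]; omega
    · rcases h.balanced.eq_zero_or_one with rfl | rfl <;> simp [Quad.area] <;> linarith
  · refine ⟨![0, n 0, n 1 - 1, 0], fun j => ?_, ?_, ?_⟩
    · fin_cases j <;> simp <;> omega
    · simp [Fin.sum_univ_four]; omega
    · simp [Quad.area, h₂, h₃]; linarith

end IsOptimal

section

variable {f : Frame} {c s : ℤ} {L : ℕ}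

theorem len_pt_add_one_zero_le {s' : ℤ} (hc : 0 ≤ c) (hs : 0 ≤ s) (hss' : s ≤ s') (hL : 34 ≤ L)
    (h : len (f.pt c 1 s') ≤ L) : len (f.pt (c + 1) 0 s) ≤ L := by
  obtain ⟨n, t, hn, hsum, harea⟩ := Frame.exists_isOptimal_of_len_pt_le hc zero_le_one h
  obtain ⟨n', hn', hsum', harea'⟩ := hn.exists_area_le_add_one_zero hc (by omega)
  exact Frame.len_pt_le_of_le_area (by omega) le_rfl hn' (by omega) hL (by simpa) (by omega)

theorem len_pt_mul_val_letter_five_le (hc : 0 ≤ c) (hs : 0 < s) (hL : 34 ≤ L)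
    (h : len (f.pt c 0 s) ≤ L) : len (f.pt c 0 s * (f.letter 5).val) ≤ L := by
  obtain ⟨n, t, hn, hsum, harea⟩ := Frame.exists_isOptimal_of_len_pt_le hc le_rfl h
  obtain ⟨n', hn', hsum', harea'⟩ := hn.exists_area_sub_le_one hc (by omega) (by omega)
  have heq : f.pt c 0 s * (f.letter 5).val = f.lower.pt 1 c (s - c) := by
    rw [← f.lower_pt, show f.letter 5 = f.lower.letter 0 from (f.lower_letter 0).symm,
      f.lower.pt_mul_val_letter]
    simp [dU, dV, dS]
  rw [heq]
  exact Frame.len_pt_le_of_le_area zero_le_one hc hn' (by omega) hL (by omega)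
    (by rw [f.lower_eps]; omega)

theorem len_pt_mul_val_letter_four_le (hc : 1 ≤ c) (hs : 0 < s) (hL : 34 ≤ L)
    (h : len (f.pt c 0 s) ≤ L) : len (f.pt c 0 s * (f.letter 4).val) ≤ L := by
  have := f.eps_eq_zero_or_one
  obtain ⟨n, t, hn, hsum, harea⟩ := Frame.exists_isOptimal_of_len_pt_le (by omega) le_rfl h
  obtain ⟨n', hn', hsum', harea'⟩ :=
    hn.exists_area_sub_le_one_sub (by omega) (by omega) (by omega)
  have heq : f.pt c 0 s * (f.letter 4).val = f.lower.pt 1 (c - 1) (s + f.eps - c) := by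
    rw [← f.lower_pt, show f.letter 4 = f.lower.letter 5 from (f.lower_letter 5).symm,
      f.lower.pt_mul_val_letter, f.lower_eps]
    simp only [dU, dV, dS]
    congr 1
    ring
  rw [heq]
  exact Frame.len_pt_le_of_le_area zero_le_one (by omega) hn' (by omega) hL (by omega)
    (by rw [f.lower_eps]; omega)

theorem len_mul_eval_le (g : N) (r : Word) : len (g * eval r) ≤ len g + r.length := by
  obtain ⟨w, hlength, rfl⟩ := exists_length_eq_len g
  rw [← eval_append, ← hlength, ← List.length_append]
  exact len_eval_le _

theorem len_mul_val_bounds (g : N) (l : Letter) :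
    len (g * l.val) ≤ len g + 1 ∧ len g ≤ len (g * l.val) + 1 := by
  obtain ⟨r, hlength, heval⟩ := exists_eval_eq_inv [l]
  have h := len_mul_eval_le g [l]
  have h' := len_mul_eval_le (g * l.val) r
  simp only [hlength, heval, eval_cons, eval_nil, mul_one, mul_inv_cancel_right] at h h'
  exact ⟨h, h'⟩

theorem dist_mul_val_mul_eval_le (g : N) (l : Letter) (r : Word) :
    dist (g * l.val) (g * eval r) ≤ r.length + 1 := by
  obtain ⟨r', hlength, heval⟩ := exists_eval_eq_inv [l]
  refine dist_le_iff_exists_word.2 ⟨r' ++ r, by simp [hlength, add_comm], ?_⟩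
  simp [eval_append, heval, eval_cons, mul_assoc]

theorem dist_pt_mul_val_pt_le (f : Frame) (l : Letter) {c c' : ℤ} (s : ℤ)
    (h : c' = c ∨ c' = c + 1) : dist (f.pt c 0 s * l.val) (f.pt c' 0 s) ≤ 2 := by
  rcases h with rfl | rfl
  · simpa using (dist_mul_val_mul_eval_le (f.pt c' 0 s) l []).trans (by simp)
  · simpa [eval_cons, f.pt_mul_val_letter_zero] using
      dist_mul_val_mul_eval_le (f.pt c 0 s) l [f.letter 0]

/-- If the middle element is too short, then the enclosed area makes room for a neighbour below the
axis of the same length; if it is too long, then the neighbour above the axis is long as well. -/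
theorem len_pt_eq_or_len_pt_add_one_eq (hc : 0 ≤ c) (hs : 0 ≤ s) (hL : 50 ≤ L) {i j : Fin 6}
    (hi : i = 1 ∨ i = 2) (hj : j = 4 ∨ j = 5) (hij : 1 ≤ c ∨ i = 1 ∧ j = 5)
    (hlen : len (f.pt c 0 s * (f.letter i).val) = L)
    (hlen' : len (f.pt c 0 s * (f.letter j).val) = L) :
    len (f.pt c 0 s) = L ∨ len (f.pt (c + 1) 0 s) = L := by
  have hbound := len_mul_val_bounds (f.pt c 0 s) (f.letter i)
  rcases lt_trichotomy (len (f.pt c 0 s)) L with hlt | heq | hgt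
  · rcases hs.eq_or_lt with rfl | hs
    · have h₁ := (f.len_pt_eq_iff 0 hc le_rfl).2 (by simp)
      have h₂ := (f.len_pt_eq_iff (c₁ := c + 1) 0 (by omega) le_rfl).2 (by simp)
      omega
    · rcases hj with rfl | rfl
      · have := len_pt_mul_val_letter_four_le (f := f) (L := L - 1) (c := c) (by omega) hs
          (by omega) (by omega)
        omega
      · have := len_pt_mul_val_letter_five_le (f := f) (L := L - 1) hc hs (by omega) (by omega)
        omega
  · exact Or.inl heq
  · rcases hi with rfl | rfl
    · have hle := len_pt_add_one_zero_le (f := f) (L := L) (s' := s) hc hs le_rfl (by omega)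
        (by rw [← hlen]; simp [f.pt_mul_val_letter, dU, dV, dS])
      have hbound' := len_mul_val_bounds (f.pt c 0 s) (f.letter 0)
      rw [f.pt_mul_val_letter_zero] at hbound'
      omega
    · have := f.eps_eq_zero_or_one
      have hle := len_pt_add_one_zero_le (f := f) (c := c - 1) (s := s) (s' := s + f.eps)
        (L := L) (by omega) hs (by omega) (by omega)
        (by rw [← hlen]; simp [f.pt_mul_val_letter, dU, dV, dS]; rfl)
      rw [sub_add_cancel] at hle
      omega

/-- `m` has length `L`, is at distance at most `2` from `g` and `g'`, and has standard geodesics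
close to standard geodesics for `g` and `g'`. -/
structure IsLink (L : ℕ) (g g' m : N) : Prop where
  len_eq : len m = L
  dist_le : dist g m ≤ 2
  dist_le' : dist g' m ≤ 2
  haveCloseGeodesics : HaveCloseGeodesics g m
  haveCloseGeodesics' : HaveCloseGeodesics g' m

theorem IsLink.symm {g g' m : N} (h : IsLink L g g' m) : IsLink L g' g m :=
  ⟨h.len_eq, h.dist_le', h.dist_le, h.haveCloseGeodesics', h.haveCloseGeodesics⟩

theorem exists_isLink_pt (hc : 0 ≤ c) (hs : 0 ≤ s) (hL : 50 ≤ L) {i j : Fin 6}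
    (hi : i = 1 ∨ i = 2) (hj : j = 4 ∨ j = 5) (hij : 1 ≤ c ∨ i = 1 ∧ j = 5)
    (hlen : len (f.pt c 0 s * (f.letter i).val) = L)
    (hlen' : len (f.pt c 0 s * (f.letter j).val) = L) :
    ∃ c' : ℤ, IsLink L (f.pt c 0 s * (f.letter i).val) (f.pt c 0 s * (f.letter j).val)
      (f.pt c' 0 s) := by
  obtain ⟨c', hc', hlen₀⟩ : ∃ c', (c' = c ∨ c' = c + 1) ∧ len (f.pt c' 0 s) = L := by
    rcases len_pt_eq_or_len_pt_add_one_eq hc hs hL hi hj hij hlen hlen' with h | h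
    exacts [⟨c, Or.inl rfl, h⟩, ⟨c + 1, Or.inr rfl, h⟩]
  have hdist (l : Letter) := dist_pt_mul_val_pt_le f l s hc'
  refine ⟨c', hlen₀, hdist _, hdist _, ?_, ?_⟩
  · refine Frame.haveCloseGeodesics_of_mem_sector (f := f)
      (f.pt_mul_val_letter_mem_sector s ?_ ?_) ⟨c', 0, s, by omega, le_rfl, rfl⟩ hlen hlen₀ hL
      (hdist _) <;>
      rcases hi with rfl | rfl <;> simp only [dU, dV] <;> omega
  · refine Frame.haveCloseGeodesics_of_mem_sector (f := f.lower) ?_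
      ⟨0, c', s, le_rfl, by omega, (f.lower_pt c' s).symm⟩ hlen' hlen₀ hL (hdist _)
    obtain ⟨k, rfl⟩ : ∃ k, j = k + 5 := ⟨j - 5, by simp⟩
    rw [← f.lower_letter, ← f.lower_pt]
    have hk : k = 5 ∨ k = 0 := by omega
    refine f.lower.pt_mul_val_letter_mem_sector s ?_ ?_ <;>
      rcases hk with rfl | rfl <;> simp only [dU, dV] <;> omega

end

/-! ### Crossing an axis -/

namespace Axis

variable (A : Axis)

theorem form_mul (P Q : Plane) : A.form (P * Q) = A.form P + A.form Q := by
  cases A <;> simp [form, fstCoord, sndCoord]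
  ring

theorem form_zpow (P : Plane) (k : ℤ) : A.form (P ^ k) = k * A.form P := by
  cases A <;> simp [form, fstCoord, sndCoord]
  ring

theorem form_p_val_bounds (l : Letter) : -1 ≤ A.form (p l.val) ∧ A.form (p l.val) ≤ 1 := by
  cases A <;> cases l <;> simp [p_val, Letter.vec, form, fstCoord, sndCoord]

theorem form_p_pt (f : Frame) (a b s : ℤ) :
    A.form (p (f.pt a b s)) = a * A.form (p f.U) + b * A.form (p f.V) := by
  have hZ : A.form (p f.Z) = 0 := by
    unfold Frame.Z
    split <;> cases A <;> simp [p_z, form, fstCoord, sndCoord]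
  simp only [Frame.pt, map_mul, map_zpow, A.form_mul, A.form_zpow, hZ, mul_zero, add_zero]

theorem form_p_letter (f : Frame) (i : Fin 6) :
    A.form (p (f.letter i).val) = dU i * A.form (p f.U) + dV i * A.form (p f.V) := by
  rw [f.val_letter, A.form_p_pt]

theorem form_p_letter_add_three (f : Frame) (i : Fin 6) :
    A.form (p (f.letter (i + 3)).val) = -A.form (p (f.letter i).val) := by
  rw [form_p_letter, form_p_letter]
  fin_cases i <;> simp [dU, dV] <;> ring

theorem exists_ne_form_ne_zero {P : Plane} (h : A.form P ≠ 0) :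
    ∃ B : Axis, B ≠ A ∧ B.form P ≠ 0 := by
  by_contra! hzero
  have hx := hzero .x; have hy := hzero .y; have ht := hzero .t
  cases A <;> simp [form] at h hx hy ht <;> omega

/-- The points `P` and `Q` lie strictly on different sides of the axis. -/
def Separates (P Q : Plane) : Prop := A.form P * A.form Q < 0

end Axis

theorem Axis.Separates.crosses {A : Axis} {g : N} {r : Word}
    (h : A.Separates (p g) (p (g * eval r))) : Crosses g r A := by
  rcases mul_neg_iff.1 h with ⟨hpos, hneg⟩ | ⟨hneg, hpos⟩
  · exact ⟨r.length, 0, by simpa using hneg, by simpa using hpos⟩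
  · exact ⟨0, r.length, by simpa using hneg, by simpa using hpos⟩

/-- The forms change by at most `1` along an edge, so that a path that crosses an axis has a vertex
on it. -/
theorem Crosses.exists_eq_pair {g : N} {r : Word} {A : Axis} (h : Crosses g r A)
    (hr : r.length ≤ 2) :
    ∃ l l' : Letter, r = [l, l'] ∧ A.form (p (g * l.val)) = 0 ∧
      A.Separates (p g) (p (g * eval r)) := by
  obtain ⟨i, j, hi, hj⟩ := h
  match r, hr with
  | [], _ => simp only [List.take_nil] at hi hj; omega
  | [l], _ =>
    have := A.form_p_val_bounds l
    rcases i with - | i <;> rcases j with - | j <;> simp [eval_cons, A.form_mul] at hi hj <;> omega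
  | [l, l'], _ =>
    have := A.form_p_val_bounds l
    have := A.form_p_val_bounds l'
    refine ⟨l, l', rfl, ?_⟩
    rw [Axis.Separates, mul_neg_iff]
    rcases i with - | - | i <;> rcases j with - | - | j <;>
      simp [eval_cons, A.form_mul] at hi hj ⊢ <;> omega

theorem mem_sector_of_coord {l : Letter} {g : N}
    (h₁ : 0 ≤ fstCoord (p g) * l.next.vec.2 - sndCoord (p g) * l.next.vec.1)
    (h₂ : 0 ≤ sndCoord (p g) * l.vec.1 - fstCoord (p g) * l.vec.2) :
    g ∈ (⟨l, true⟩ : Frame).sector := by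
  obtain ⟨a, b, s, rfl⟩ := (⟨l, true⟩ : Frame).exists_eq_pt g
  have hl₀ : (⟨l, true⟩ : Frame).letter 0 = l := rfl
  have hl₁ : (⟨l, true⟩ : Frame).letter 1 = l.next := rfl
  rw [Frame.fstCoord_pt, Frame.sndCoord_pt, hl₀, hl₁] at h₁ h₂
  refine ⟨a, b, s, ?_, ?_, rfl⟩ <;> cases l <;> simp only [Letter.next, Letter.vec] at h₁ h₂ <;>
    omega

theorem exists_mem_sector_of_not_separates {g g' : N}
    (h : ∀ A : Axis, ¬A.Separates (p g) (p g')) : ∃ f : Frame, g ∈ f.sector ∧ g' ∈ f.sector := by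
  have hx := h .x; have hy := h .y; have ht := h .t
  simp only [Axis.Separates, Axis.form, mul_neg_iff] at hx hy ht
  suffices ∃ l : Letter,
      (0 ≤ fstCoord (p g) * l.next.vec.2 - sndCoord (p g) * l.next.vec.1 ∧
        0 ≤ sndCoord (p g) * l.vec.1 - fstCoord (p g) * l.vec.2) ∧
      (0 ≤ fstCoord (p g') * l.next.vec.2 - sndCoord (p g') * l.next.vec.1 ∧
        0 ≤ sndCoord (p g') * l.vec.1 - fstCoord (p g') * l.vec.2) by
    obtain ⟨l, h, h'⟩ := this
    exact ⟨⟨l, true⟩, mem_sector_of_coord h.1 h.2, mem_sector_of_coord h'.1 h'.2⟩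
  by_contra! hnone
  have h₁ := hnone .x; have h₂ := hnone .t; have h₃ := hnone .y
  have h₄ := hnone .xi; have h₅ := hnone .ti; have h₆ := hnone .yi
  simp only [Letter.next, Letter.vec] at h₁ h₂ h₃ h₄ h₅ h₆
  omega

theorem Axis.exists_frame_form_eq_zero (A : Axis) :
    ∃ f : Frame, A.form (p f.U) = 0 ∧ A.form (p f.V) ≠ 0 := by
  cases A
  · exact ⟨⟨.x, true⟩, by simp [Frame.U, Frame.V, Frame.letter, Frame.turn, Letter.next, p_val,
      Letter.vec, form, sndCoord]⟩
  · exact ⟨⟨.y, true⟩, by simp [Frame.U, Frame.V, Frame.letter, Frame.turn, Letter.next, p_val,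
      Letter.vec, form, fstCoord]⟩
  · exact ⟨⟨.t, true⟩, by simp [Frame.U, Frame.V, Frame.letter, Frame.turn, Letter.next, p_val,
      Letter.vec, form, fstCoord, sndCoord]⟩

theorem exists_eq_pt_of_form_eq_zero {A : Axis} {g : N} (h : A.form (p g) = 0) :
    ∃ (f : Frame) (c s : ℤ), A.form (p f.U) = 0 ∧ 0 ≤ c ∧ 0 ≤ s ∧ g = f.pt c 0 s := by
  obtain ⟨f, c, s, hU, hc, rfl⟩ :
      ∃ (f : Frame) (c s : ℤ), A.form (p f.U) = 0 ∧ 0 ≤ c ∧ g = f.pt c 0 s := by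
    obtain ⟨f, hU, hV⟩ := A.exists_frame_form_eq_zero
    obtain ⟨a, b, s, rfl⟩ := f.exists_eq_pt g
    rw [A.form_p_pt, hU, mul_zero, zero_add] at h
    obtain rfl := (mul_eq_zero.1 h).resolve_right hV
    rcases le_total 0 a with ha | ha
    · exact ⟨f, a, s, hU, ha, rfl⟩
    · refine ⟨f.opp, -a, s, ?_, by omega, by rw [f.opp_pt, neg_neg]⟩
      rw [Frame.U, f.opp_letter, A.form_p_letter_add_three]
      exact neg_eq_zero.2 hU
  rcases le_total 0 s with hs | hs
  · exact ⟨f, c, s, hU, hc, hs, rfl⟩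
  · exact ⟨f.mirror, c, -s, hU, hc, by omega, by rw [f.mirror_pt, neg_neg]⟩

section

variable {A : Axis} {f : Frame} {c s : ℤ} {L : ℕ} {i j : Fin 6}

theorem exists_isLink_of_above_below (hU : A.form (p f.U) = 0) (hc : 0 ≤ c) (hs : 0 ≤ s)
    (hL : 50 ≤ L) (hi : i = 1 ∨ i = 2) (hj : j = 4 ∨ j = 5) (hne : c = 0 → j ≠ i + 3)
    (hlen : len (f.pt c 0 s * (f.letter i).val) = L)
    (hlen' : len (f.pt c 0 s * (f.letter j).val) = L) :
    ∃ m, A.form (p m) = 0 ∧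
      IsLink L (f.pt c 0 s * (f.letter i).val) (f.pt c 0 s * (f.letter j).val) m := by
  have haxis (c' : ℤ) : A.form (p (f.pt c' 0 s)) = 0 := by simp [A.form_p_pt, hU]
  by_cases hij : 1 ≤ c ∨ i = 1 ∧ j = 5
  · obtain ⟨c', hm⟩ := exists_isLink_pt hc hs hL hi hj hij hlen hlen'
    exact ⟨_, haxis c', hm⟩
  · obtain ⟨rfl, rfl, rfl⟩ : c = 0 ∧ i = 2 ∧ j = 4 := by
      have hc₀ : c = 0 := by omega
      have := hne hc₀
      rcases hi with rfl | rfl <;> rcases hj with rfl | rfl <;> simp_all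
    have hpt : f.pt 0 0 s = f.opp.pt 0 0 s := by rw [f.opp_pt, neg_zero]
    have h₂ : f.letter 2 = f.opp.letter 5 := (f.opp_letter 5).symm
    have h₄ : f.letter 4 = f.opp.letter 1 := (f.opp_letter 1).symm
    simp only [hpt, h₂, h₄] at hlen hlen' ⊢
    obtain ⟨c', hm⟩ := exists_isLink_pt (f := f.opp) (i := 1) (j := 5) le_rfl hs hL (Or.inl rfl)
      (Or.inr rfl) (Or.inr ⟨rfl, rfl⟩) hlen' hlen
    exact ⟨_, f.opp_pt c' s ▸ haxis (-c'), hm.symm⟩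

theorem above_below_of_dV_mul_dV_neg (h : dV i * dV j < 0) :
    ((i = 1 ∨ i = 2) ∧ (j = 4 ∨ j = 5)) ∨ ((j = 1 ∨ j = 2) ∧ (i = 4 ∨ i = 5)) := by
  revert i j
  decide

theorem exists_isLink_of_separates (hU : A.form (p f.U) = 0) (hc : 0 ≤ c) (hs : 0 ≤ s)
    (hL : 50 ≤ L) (hne : c = 0 → j ≠ i + 3)
    (hsep : A.Separates (p (f.pt c 0 s * (f.letter i).val)) (p (f.pt c 0 s * (f.letter j).val)))
    (hlen : len (f.pt c 0 s * (f.letter i).val) = L)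
    (hlen' : len (f.pt c 0 s * (f.letter j).val) = L) :
    ∃ m, A.form (p m) = 0 ∧
      IsLink L (f.pt c 0 s * (f.letter i).val) (f.pt c 0 s * (f.letter j).val) m := by
  have hdV : dV i * dV j < 0 := by
    have hform (k : Fin 6) :
        A.form (p (f.pt c 0 s * (f.letter k).val)) = dV k * A.form (p f.V) := by
      rw [f.pt_mul_val_letter, A.form_p_pt, hU, mul_zero, zero_add, zero_add]
    rw [Axis.Separates, hform, hform, mul_mul_mul_comm] at hsep
    exact neg_of_mul_neg_left hsep (mul_self_nonneg _)
  rcases above_below_of_dV_mul_dV_neg hdV with ⟨hi, hj⟩ | ⟨hj, hi⟩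
  · exact exists_isLink_of_above_below hU hc hs hL hi hj hne hlen hlen'
  · have hne' (h₀ : c = 0) : i ≠ j + 3 := by
      rintro rfl
      exact hne h₀ (by rw [add_assoc]; simp)
    obtain ⟨m, hm, hlink⟩ := exists_isLink_of_above_below hU hc hs hL hj hi hne' hlen' hlen
    exact ⟨m, hm, hlink.symm⟩

end

theorem Axis.Separates.exists_ne {A : Axis} {f : Frame} {s : ℤ} {i : Fin 6}
    (h : A.Separates (p (f.pt 0 0 s * (f.letter i).val))
      (p (f.pt 0 0 s * (f.letter (i + 3)).val))) :
    ∃ B ≠ A, B.Separates (p (f.pt 0 0 s * (f.letter i).val))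
      (p (f.pt 0 0 s * (f.letter (i + 3)).val)) := by
  simp only [Separates, map_mul, form_mul, form_p_pt, form_p_letter_add_three, zero_mul,
    zero_add, mul_neg, neg_lt_zero, mul_self_pos] at h ⊢
  exact A.exists_ne_form_ne_zero h

theorem Crosses.exists_isLink {g : N} {r : Word} {A : Axis} {L : ℕ} (h : Crosses g r A)
    (hA : ∀ B, Crosses g r B → B = A) (hr : r.length ≤ 2) (hlen : len g = L)
    (hlen' : len (g * eval r) = L) (hL : 50 ≤ L) :
    ∃ m, A.form (p m) = 0 ∧ IsLink L g (g * eval r) m := by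
  obtain ⟨l, l', rfl, hmid, hsep⟩ := h.exists_eq_pair hr
  obtain ⟨f, c, s, hU, hc, hs, hpt⟩ := exists_eq_pt_of_form_eq_zero hmid
  obtain ⟨k, hk⟩ := l.exists_val_eq_inv
  obtain ⟨i, rfl⟩ := f.letter_surjective k
  obtain ⟨j, rfl⟩ := f.letter_surjective l'
  have hg : g = f.pt c 0 s * (f.letter i).val := by rw [← hpt, hk, mul_inv_cancel_right]
  have hg' : g * eval [l, f.letter j] = f.pt c 0 s * (f.letter j).val := by
    simp [← hpt, eval_cons, mul_assoc]
  have hne : c = 0 → j ≠ i + 3 := by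
    rintro rfl rfl
    rw [hg', hg] at hsep
    obtain ⟨B, hBA, hB⟩ := hsep.exists_ne
    rw [← hg, ← hg'] at hB
    exact hBA (hA B hB.crosses)
  rw [hg'] at hlen' hsep ⊢
  rw [hg] at hlen hsep ⊢
  exact exists_isLink_of_separates hU hc hs hL hne hsep hlen hlen'

end NilHex

theorem lemma12 (n : ℕ) (g g' : NilHex.N) (r : NilHex.Word)
    (hg : NilHex.len g = n) (hg' : NilHex.len g' = n)
    (hr : r.length ≤ 2) (hgr : g' = g * NilHex.eval r) :
    (NilHex.len g < 50 ∧ NilHex.len g' < 50) ∨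
    NilHex.HaveFellowTravellingGeodesics g g' ∨
    ((∃ A : NilHex.Axis, NilHex.Crosses g r A) ∧
      ∀ A : NilHex.Axis, NilHex.Crosses g r A →
        (∀ B : NilHex.Axis, NilHex.Crosses g r B → B = A) →
        ∃ g'' : NilHex.N, NilHex.len g'' = n ∧ NilHex.dist g g'' ≤ 2 ∧
          A.form (NilHex.p g'') = 0 ∧ NilHex.dist g' g'' ≤ 2 ∧
          NilHex.HaveFellowTravellingGeodesics g g'' ∧
          NilHex.HaveFellowTravellingGeodesics g'' g') := by
  rcases lt_or_ge n 50 with hn | hn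
  · exact Or.inl ⟨hg.trans_lt hn, hg'.trans_lt hn⟩
  right
  subst hgr
  by_cases hA : ∃ A : NilHex.Axis, NilHex.Crosses g r A
  · refine Or.inr ⟨hA, fun A hcross hunique => ?_⟩
    obtain ⟨m, hm, hlink⟩ := hcross.exists_isLink hunique hr hg hg' hn
    exact ⟨m, hlink.len_eq, hlink.dist_le, hm, hlink.dist_le',
      hlink.haveCloseGeodesics.haveFellowTravellingGeodesics (hg.trans hlink.len_eq.symm),
      hlink.haveCloseGeodesics'.symm.haveFellowTravellingGeodesics (hlink.len_eq.trans hg'.symm)⟩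
  · left
    obtain ⟨f, hf, hf'⟩ := NilHex.exists_mem_sector_of_not_separates
      fun A (h : A.Separates (NilHex.p g) _) => hA ⟨A, h.crosses⟩
    have hdist : NilHex.dist g (g * NilHex.eval r) ≤ 2 :=
      NilHex.dist_le_iff_exists_word.2 ⟨r, hr, rfl⟩
    exact (NilHex.Frame.haveCloseGeodesics_of_mem_sector hf hf' hg hg' hn
      hdist).haveFellowTravellingGeodesics (hg.trans hg'.symm)
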